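/- Let $B(x,y,p)=(y-xp)^3$, so that $y''=B(x,y,y')$ is the complex second order ODE $y''=(y-xy')^3$ of the quartic. On $\mathbb C^3$ with coordinates $(x,y,p)$ consider the holomorphic direction fields $$Z_1=\frac{\partial}{\partial p},\qquad Z_2=\frac{\partial}{\partial x}+p\frac{\partial}{\partial y}+B\frac{\partial}{\partial p}.$$ The quartic is the elliptic CR-manifold (real dimension 6) on $\mathbb C^3$ whose distribution is $D=\operatorname{span}_{\mathbb C}(Z_1,Z_2)$, with $J(aZ_1+bZ_2)=iaZ_1-ibZ_2$ for $a,b\in\mathbb C$. A local CR-automorphism is a diffeomorphism $f$ between open sets (smooth in the real sense) whose differential preserves $D$ and commutes with $J$ on $D$; the isotropy group at $q$ is the group of germs at $q$ of local CR-automorphisms fixing $q$. It is called linearizable if there is a local coordinate system centred at $q$ in which all its elements are linear. An infinitesimal CR-automorphism is a (real) smooth vector field $X$ such that $[X,Y]$ is a section of $D$ and $[X,JY]=J[X,Y]$ for all smooth sections $Y$ of $D$. Put $\Gamma=\{(x,y,p)\in\mathbb C^3: y=xp\}$. Then: 1. The set of points at which the isotropy group of the quartic is not linearizable is exactly the complex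 hypersurface $\Gamma$. This holds both for holomorphic coordinates with complex linear maps and for real smooth coordinates with real linear maps. 2. For every $q\in\Gamma$ there is an invertible affine map of the $(x,y)$-plane that carries the line element $q$ to the line element $(0,0,0)$ and the ODE $y''=(y-xy')^3$ to an ODE of the form $y''=K(y-(x+e)y')^3$ with $K\in\mathbb C\setminus\{0\}$, $e\in\mathbb C$; the latter ODE is invariant under the shears $(x,y)\mapsto(x+ty,y)$, $t\in\mathbb C$. Explicitly, if $a\ne0$ and $ad-bc\neq 0$, the substitution $(x,y)=(a(x_1+1)+cy_1,\ b(x_1+1)+dy_1)$ takes the point $(a,b,b/a)$ to $(0,0,0)$ and the ODE to $y_1''=(ad-bc)^2\,(y_1-(x_1+1)y_1')^3$. 3. At every point $q\notin\Gamma$ the isotropy is infinitesimally trivial: every infinitesimal CR-automorphism defined near $q$ and vanishing at $q$ vanishes in a neighbourhood of $q$. Moreover, the isotropy group at such a point consists of exactly two elements, the identity and an involution. -/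

import Mathlib

open scoped ContDiff Topology

/-- The complex 3-fold of line elements, with coordinates `(x, y, p)`, `p = dy/dx`. -/
abbrev JetSpace : Type := ℂ × ℂ × ℂ

/-- A complex second order ODE `y'' = B(x, y, y')`, given by its right-hand side. -/
abbrev SecondOrderODE : Type := ℂ → ℂ → ℂ → ℂ

namespace SecondOrderODE

/-- The direction field `∂/∂p`. -/
def Z₁ : JetSpace := (0, 0, 1)

/-- The direction field `∂/∂x + p ∂/∂y + B ∂/∂p`. -/
def Z₂ (B : SecondOrderODE) (q : JetSpace) : JetSpace := (1, q.2.2, B q.1 q.2.1 q.2.2)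

/-- The real rank-four distribution `D` of the CR-manifold of the ODE: the complex span of the two
direction fields, regarded as a real subspace of the tangent space. -/
noncomputable def crDist (B : SecondOrderODE) (q : JetSpace) : Submodule ℝ JetSpace :=
  (Submodule.span ℂ {Z₁, Z₂ B q}).restrictScalars ℝ

/-- The complex structure `J` on `D`: `J Z₁ = i Z₁`, `J Z₂ = - i Z₂`. A vector `v = a Z₁ + b Z₂` of
`D` has `b = v.1` and `a = v.2.2 - v.1 * B`; the formula is used only for vectors of `D`. -/
noncomputable def crJ (B : SecondOrderODE) (q : JetSpace) (v : JetSpace) : JetSpace :=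
  (Complex.I * (v.2.2 - v.1 * B q.1 q.2.1 q.2.2)) • Z₁ - (Complex.I * v.1) • Z₂ B q

theorem crJ_apply (B : SecondOrderODE) (q : JetSpace) (a b : ℂ) :
    crJ B q (a • Z₁ + b • Z₂ B q) = (Complex.I * a) • Z₁ - (Complex.I * b) • Z₂ B q := by
  simp [crJ, Z₁, Z₂]

theorem crJ_mem (B : SecondOrderODE) (q v : JetSpace) : crJ B q v ∈ crDist B q := by
  change crJ B q v ∈ Submodule.span ℂ {Z₁, Z₂ B q}
  exact sub_mem (Submodule.smul_mem _ _ (Submodule.subset_span (by simp)))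
    (Submodule.smul_mem _ _ (Submodule.subset_span (by simp)))

theorem crJ_crJ (B : SecondOrderODE) (q v : JetSpace) (hv : v ∈ crDist B q) :
    crJ B q (crJ B q v) = -v := by
  obtain ⟨a, b, rfl⟩ := Submodule.mem_span_pair.1 (show v ∈ Submodule.span ℂ {Z₁, Z₂ B q} from hv)
  rw [crJ_apply, sub_eq_add_neg, ← neg_smul, crJ_apply]
  have h : Complex.I * Complex.I = -1 := Complex.I_mul_I
  rw [mul_neg, ← mul_assoc, ← mul_assoc, h]
  simp [sub_eq_add_neg, add_comm]

/-- A local CR-automorphism: a diffeomorphism between open subsets, smooth in the real sense in both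
directions, whose differential preserves `D` and commutes with `J` on `D`. -/
structure IsLocalCRAut (B : SecondOrderODE) (f : OpenPartialHomeomorph JetSpace JetSpace) :
    Prop where
  smooth : ContDiffOn ℝ ∞ f f.source
  smooth_symm : ContDiffOn ℝ ∞ f.symm f.target
  map_dist : ∀ r ∈ f.source, ∀ v ∈ crDist B r, fderiv ℝ f r v ∈ crDist B (f r)
  map_J : ∀ r ∈ f.source, ∀ v ∈ crDist B r,
    fderiv ℝ f r (crJ B r v) = crJ B (f r) (fderiv ℝ f r v)

/-- Representatives of the elements of the isotropy group at `q`, that is, of the germs at `q` of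
local CR-automorphisms fixing `q`. -/
def isotropy (B : SecondOrderODE) (q : JetSpace) : Set (OpenPartialHomeomorph JetSpace JetSpace) :=
  {f | IsLocalCRAut B f ∧ q ∈ f.source ∧ f q = q}

/-- The isotropy group at `q` is linearizable: in suitable local coordinates `Φ` centred at `q`, all
its elements are linear. For `𝕜 = ℂ` the coordinates are holomorphic and the linear maps complex
linear, for `𝕜 = ℝ` they are real smooth and real linear. -/
def HasLinearizableIsotropy (𝕜 : Type) [NontriviallyNormedField 𝕜] [NormedSpace 𝕜 JetSpace]
    (B : SecondOrderODE) (q : JetSpace) : Prop :=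
  ∃ Φ : OpenPartialHomeomorph JetSpace JetSpace,
    q ∈ Φ.source ∧ Φ q = 0 ∧ ContDiffOn 𝕜 ∞ Φ Φ.source ∧ ContDiffOn 𝕜 ∞ Φ.symm Φ.target ∧
    ∀ f ∈ isotropy B q, ∃ A : JetSpace →L[𝕜] JetSpace, ∀ᶠ r in 𝓝 q, Φ (f r) = A (Φ r)

/-- `X` is an infinitesimal CR-automorphism on `U`: a (real) smooth vector field such that
`[X, Y]` is a section of `D` and `[X, J Y] = J [X, Y]` for all smooth sections `Y` of `D`. -/
structure IsInfinitesimalCRAut (B : SecondOrderODE) (X : JetSpace → JetSpace) (U : Set JetSpace) :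
    Prop where
  smooth : ContDiffOn ℝ ∞ X U
  map_dist : ∀ Y : JetSpace → JetSpace, ContDiffOn ℝ ∞ Y U → (∀ r ∈ U, Y r ∈ crDist B r) →
    ∀ r ∈ U, VectorField.lieBracket ℝ X Y r ∈ crDist B r
  map_J : ∀ Y : JetSpace → JetSpace, ContDiffOn ℝ ∞ Y U → (∀ r ∈ U, Y r ∈ crDist B r) →
    ∀ r ∈ U, VectorField.lieBracket ℝ X (fun s => crJ B s (Y s)) r =
      crJ B r (VectorField.lieBracket ℝ X Y r)

/-- `u` is a holomorphic solution of `y'' = B(x, y, y')` on `U`. -/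
def IsSolutionOn (B : SecondOrderODE) (u : ℂ → ℂ) (U : Set ℂ) : Prop :=
  DifferentiableOn ℂ u U ∧ ∀ x ∈ U, deriv (deriv u) x = B x (u x) (deriv u x)

end SecondOrderODE

/-- The affine transformation `g` of the `(x, y)`-plane carries the line element `(x, y, p)` to the
line element `(x', y', p')`. -/
def CarriesElement (g : (ℂ × ℂ) ≃ᵃ[ℂ] (ℂ × ℂ)) (q q' : JetSpace) : Prop :=
  g (q.1, q.2.1) = (q'.1, q'.2.1) ∧ ∃ k : ℂ, k ≠ 0 ∧ g.linear (1, q.2.2) = k • (1, q'.2.2)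

/-- The affine transformation `g` of the `(x, y)`-plane carries the ODE `y'' = B` to the ODE
`y'' = B'`: whenever `g` maps the graph of `u` onto the graph of `v`, then `u` solves the first
ODE if and only if `v` solves the second one. -/
def CarriesODE (g : (ℂ × ℂ) ≃ᵃ[ℂ] (ℂ × ℂ)) (B B' : SecondOrderODE) : Prop :=
  ∀ (U V : Set ℂ) (u v : ℂ → ℂ), IsOpen U → IsOpen V →
    DifferentiableOn ℂ u U → DifferentiableOn ℂ v V →
    g '' ((fun x => (x, u x)) '' U) = (fun x => (x, v x)) '' V →
    (B.IsSolutionOn u U ↔ B'.IsSolutionOn v V)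

/-- The ODE `y'' = B` admits the shear `y ∂/∂x`: it is invariant under all the transformations
`(x, y) ↦ (x + t y, y)`. -/
def AdmitsShear (B : SecondOrderODE) : Prop :=
  ∀ (t : ℂ) (g : (ℂ × ℂ) ≃ᵃ[ℂ] (ℂ × ℂ)), (∀ x y : ℂ, g (x, y) = (x + t * y, y)) → CarriesODE g B B

/-- The ODE `y'' = (y - x y')³` of the quartic. -/
def quarticODE : SecondOrderODE := fun x y p => (y - x * p) ^ 3

/-- The ODE `y'' = K (y - (x + e) y')³`. -/
def shiftedQuarticODE (K e : ℂ) : SecondOrderODE := fun x y p => K * (y - (x + e) * p) ^ 3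

/-- The complex hypersurface `Γ = {y = x p}`. -/
def hypersurfaceΓ : Set JetSpace := {q | q.2.1 = q.1 * q.2.2}

/-!
Write `W = x p - y`, so that `Γ = {W = 0}` and the ODE is `y'' = -W³`. A linear map of the
`(x, y)`-plane acts on line elements, and the action is by CR-automorphisms if the determinant is
`1` or `-1` (`isCRAt_linAction`). All elements of the isotropy groups turn out to be of this form
at the points off `Γ`.

**Off the hypersurface.** Let `ξ = 1 / W` and `η = p / W`; a line element off `Γ` is then the same
thing as the unimodular matrix with columns `(x, y)` and `(ξ, η)`. The fields `E₁ = -W² ∂/∂p` and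
`E₂ = Z₂ / W` span the two eigenlines of `J` on `D`, and with `E₃ = [E₁, E₂] = x ∂/∂x + y ∂/∂y`
they form a frame with constant structure coefficients:
`[E₃, E₁] = 2 E₁` and `[E₃, E₂] = 4 E₁ - 2 E₂`.
For the germ `f` of a CR-map, `E₁` and `i E₁` commute and `J` interchanges them up to sign, and
likewise for `E₂`. The Levi form therefore forces `f` to send each of the two eigenlines into one of
them (`CRFrame.IsCRMap.levi`). As `f` is a local diffeomorphism, it either preserves or swaps the
eigenlines (`not_injective_of_linear_of_antilinear`). In the first case `f_* E₁ = λ E₁` and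
`f_* E₂ = μ E₂` with nowhere vanishing functions `λ`, `μ`. The bracket relations, applied to the
components of `f`, become an overdetermined system of differential equations for `λ` and `μ`, and
differential elimination leaves only `λ = μ = ±1` (`CRFrame.diagonal_solution`). The same
elimination shows that a swap is impossible (`CRFrame.antidiagonal_no_solution`). Up to the sign `μ`
of the second column, the matrices of `f` and of the identity then satisfy the same linear first
order system, so they differ by a constant matrix `C` (`CRFrame.IsCRMap.isConstant_pairing`), and
`f` is the action of `C`. If `f` fixes `q`, then `C` is determined by the sign: the identity for `μ = 1`,
and for `μ = -1` the reflection of the plane that fixes the point `(x, y)` of `q` and reverses its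
direction. An explicit chart linearizes the latter (`linearizingChart`).

The argument uses nothing but derivations of a commutative `ℂ`-algebra `A` with the above bracket
relations. For germs of CR-maps `A` is the algebra of germs of smooth functions. For an
infinitesimal CR-automorphism `X` it is the algebra of dual numbers over these germs, in which `X`
is the CR-map `id + ε X`. As it reduces to the identity modulo `ε`, the sign is `1`, and the
constant matrix is the identity when `X` vanishes at `q` (`CRFrame.IsInfinitesimal.eq_zero`).

**On the hypersurface.** The point `(x, y)` of `q ∈ Γ` lies on the line through the origin with
slope `p`, so the shear `1 + N` along this line, with `N (x, y) = (y - p x) (1, p)`, fixes `q`. Its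
differential at `q` fixes `∂/∂p`. If it were linear in some chart, there would be a curve of fixed
points through `q` with velocity `∂/∂p` (`exists_curve_of_linearization`), but every fixed point
near `q` has the same `p`.

**Affine maps.** An affine map carries the graph of `u` to the graph of `v` only if the first and
second derivatives of `u` and `v` are related by the usual formulas
(`deriv_deriv_of_graph_image`), so the claims about ODEs reduce to rational identities.
-/

/-! ### The structure equations and their solutions -/

/-- The abstract form of the frame of the quartic: the derivations `e₁`, `e₂` stand for the real
vector fields `E₁`, `E₂` acting on complex-valued functions, and `f₁`, `f₂` for `i E₁`, `i E₂`. Only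
the bracket relations that the argument uses are recorded. -/
structure CRFrame (A : Type*) [CommRing A] [Algebra ℂ A] where
  e₁ : Derivation ℂ A A
  f₁ : Derivation ℂ A A
  e₂ : Derivation ℂ A A
  f₂ : Derivation ℂ A A
  lie_e₁_f₁ (a : A) : ⁅e₁, f₁⁆ a = 0
  lie_e₂_f₂ (a : A) : ⁅e₂, f₂⁆ a = 0
  lie_e₃_e₁ (a : A) : ⁅⁅e₁, e₂⁆, e₁⁆ a = 2 * e₁ a
  lie_e₃_e₂ (a : A) : ⁅⁅e₁, e₂⁆, e₂⁆ a = 4 * e₁ a - 2 * e₂ a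

namespace CRFrame

variable {A : Type*} [CommRing A]

theorem eq_zero_of_nat_mul_eq_zero [Algebra ℂ A] {n : ℕ} (hn : n ≠ 0) {a : A}
    (h : (n : A) * a = 0) : a = 0 := by
  have h1 : algebraMap ℂ A ((n : ℂ)⁻¹) * (n : A) = 1 := by
    rw [← map_natCast (algebraMap ℂ A), ← map_mul, inv_mul_cancel₀ (by exact_mod_cast hn), map_one]
  linear_combination algebraMap ℂ A ((n : ℂ)⁻¹) * h - a * h1

/-- The columns of a unimodular matrix are linearly independent. -/
theorem coeff_eq_zero {x y ξ η P Q : A} (hdet : x * η - ξ * y = 1)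
    (h : P * x + Q * ξ = 0) (h' : P * y + Q * η = 0) : P = 0 ∧ Q = 0 :=
  ⟨by linear_combination η * h - ξ * h' - P * hdet, by linear_combination x * h' - y * h - Q * hdet⟩

/-- The bracket relations, applied to the entries of a unimodular matrix that is differentiated as
the matrix of a map with `f_* E₁ = l E₁` and `f_* E₂ = m E₂`. -/
theorem diagonal_eqs [Algebra ℂ A] (F : CRFrame A) {x y ξ η l m : A}
    (hdet : x * η - ξ * y = 1)
    (h1x : F.e₁ x = 0) (h1y : F.e₁ y = 0) (h1ξ : F.e₁ ξ = l * x) (h1η : F.e₁ η = l * y)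
    (h2x : F.e₂ x = m * ξ) (h2y : F.e₂ y = m * η) (h2ξ : F.e₂ ξ = m * x) (h2η : F.e₂ η = m * y) :
    2 * l * F.e₁ m + m * F.e₁ l = 0 ∧ F.e₁ (F.e₁ m) = 0 ∧
    2 * m * F.e₂ l + l * F.e₂ m = 0 ∧ F.e₂ (F.e₂ l) + 4 * l * m ^ 2 = 4 * l ∧
    ⁅F.e₁, F.e₂⁆ m - F.e₂ (F.e₁ m) = 2 * l * m ^ 2 - 2 * m := by
  have r1x := F.lie_e₃_e₁ x
  have r1y := F.lie_e₃_e₁ y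
  have r2x := F.lie_e₃_e₂ x
  have r2y := F.lie_e₃_e₂ y
  have r2ξ := F.lie_e₃_e₂ ξ
  have r2η := F.lie_e₃_e₂ η
  simp only [Derivation.commutator_apply, h1x, h1y, h1ξ, h1η, h2x, h2y, h2ξ, h2η, map_add, map_sub,
    map_zero, Derivation.leibniz, smul_eq_mul] at r1x r1y r2x r2y r2ξ r2η ⊢
  obtain ⟨a1, a2⟩ := coeff_eq_zero hdet (P := 2 * l * F.e₁ m + m * F.e₁ l) (Q := F.e₁ (F.e₁ m))
    (by linear_combination -r1x) (by linear_combination -r1y)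
  obtain ⟨b1, b2⟩ := coeff_eq_zero hdet (P := 2 * m * F.e₂ l + l * F.e₂ m)
    (Q := 2 * l * m ^ 2 - 2 * m - (F.e₁ (F.e₂ m) - F.e₂ (F.e₁ m) - F.e₂ (F.e₁ m)))
    (by linear_combination -r2x) (by linear_combination -r2y)
  obtain ⟨c1, c2⟩ := coeff_eq_zero hdet (P := F.e₁ (F.e₂ m) - F.e₂ (F.e₁ m) - F.e₂ (F.e₁ m)
      + 2 * l * m ^ 2 + F.e₂ (F.e₂ l) - 4 * l + 2 * m)
    (Q := 2 * m * F.e₂ l + l * F.e₂ m)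
    (by linear_combination r2ξ) (by linear_combination r2η)
  exact ⟨a1, a2, b1, by linear_combination c1 + b2, by linear_combination -b2⟩

theorem derivation_two [Algebra ℂ A] (D : Derivation ℂ A A) : D 2 = 0 := D.map_natCast 2

theorem derivation_four [Algebra ℂ A] (D : Derivation ℂ A A) : D 4 = 0 := D.map_natCast 4

theorem eq_zero_of_unit_mul {u v X : A} (h : u * v = 1) (hX : u * X = 0) : X = 0 := by
  linear_combination v * hX - X * h

/-- Invertible multipliers that satisfy the equations of `diagonal_eqs` are equal to each other and
to `1` or `-1`. The proof prolongs the system: `U` and `V` are the logarithmic derivatives of `l`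
along `e₂` and of `m` along `e₁`, and `M`, `N` are the unknown derivatives of `U` and `V`. The
bracket relations on `l` and `m` express the derivatives of `M` and `N` through the unknowns, and
the relations on `N` and `U` are algebraic equations. -/
theorem diagonal_solution [Algebra ℂ A] (F : CRFrame A) {l m li mi : A} (hl : l * li = 1)
    (hm : m * mi = 1)
    (p1 : 2 * l * F.e₁ m + m * F.e₁ l = 0) (p2 : F.e₁ (F.e₁ m) = 0)
    (p3 : 2 * m * F.e₂ l + l * F.e₂ m = 0) (p4 : F.e₂ (F.e₂ l) + 4 * l * m ^ 2 = 4 * l)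
    (p5 : ⁅F.e₁, F.e₂⁆ m - F.e₂ (F.e₁ m) = 2 * l * m ^ 2 - 2 * m) :
    l * m = 1 ∧ m * m = 1 := by
  obtain ⟨U, hU⟩ : ∃ U, U = li * F.e₂ l := ⟨_, rfl⟩
  obtain ⟨V, hV⟩ : ∃ V, V = mi * F.e₁ m := ⟨_, rfl⟩
  have d1m : F.e₁ m = m * V := by linear_combination -F.e₁ m * hm - m * hV
  have d2l : F.e₂ l = l * U := by linear_combination -F.e₂ l * hl - l * hU
  have d1l : F.e₁ l = -(2 * (l * V)) := by
    linear_combination mi * p1 - F.e₁ l * hm + 2 * l * hV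
  have d2m : F.e₂ m = -(2 * (m * U)) := by
    linear_combination li * p3 - F.e₂ m * hl + 2 * m * hU
  obtain ⟨M, d1U⟩ : ∃ M, F.e₁ U = M := ⟨_, rfl⟩
  obtain ⟨N, d2V⟩ : ∃ N, F.e₂ V = N := ⟨_, rfl⟩
  have d1V : F.e₁ V = -(V * V) := by
    simp only [d1m, Derivation.leibniz, smul_eq_mul] at p2
    linear_combination mi * p2 - (F.e₁ V + V * V) * hm
  have d2U : F.e₂ U = 4 - 4 * (m * m) - U * U := by
    simp only [d2l, Derivation.leibniz, smul_eq_mul] at p4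
    linear_combination li * p4 - (F.e₂ U + U * U + 4 * m * m - 4) * hl
  have hMN : M + N = 1 - l * m + U * V := by
    refine sub_eq_zero.1 (eq_zero_of_nat_mul_eq_zero two_ne_zero ?_)
    simp only [Derivation.commutator_apply, d1m, d2m, d1U, d2V, Derivation.leibniz, smul_eq_mul,
      map_neg, derivation_two] at p5
    push_cast
    linear_combination -mi * p5 + (-2 * l * m - 2 * M - 2 * N + 2 * U * V + 2) * hm
  have c1 := congrArg F.e₁ hMN
  have c2 := congrArg F.e₂ hMN
  have r1 := F.lie_e₃_e₁ l
  have r2 := F.lie_e₃_e₂ m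
  simp only [Derivation.commutator_apply, d1m, d2m, d1l, d2l, d1U, d2V, d1V, d2U, map_add,
      map_sub, map_neg, map_zero,
      Derivation.leibniz, smul_eq_mul, Derivation.map_one_eq_zero,
      derivation_two, derivation_four] at c1 c2 r1 r2
  have r1' : 4 * F.e₁ N + 4 * V * N + F.e₁ M - 4 * V = 0 :=
    eq_zero_of_unit_mul hl (by linear_combination -r1)
  have r2' : 16 * (m * m) * V + 4 * U * M + 4 * F.e₂ M + F.e₂ N - 4 * V - 4 * U = 0 :=
    eq_zero_of_unit_mul hm (by linear_combination r2)
  have d1N : F.e₁ N = V * (1 - N) := by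
    refine sub_eq_zero.1 (eq_zero_of_nat_mul_eq_zero three_ne_zero ?_)
    push_cast
    linear_combination r1' - c1 - V * hMN
  have d2M : F.e₂ M = U * (1 - M) - 4 * (m * m) * V := by
    refine sub_eq_zero.1 (eq_zero_of_nat_mul_eq_zero three_ne_zero ?_)
    push_cast
    linear_combination r2' - c2 - U * hMN
  have d2N : F.e₂ N = 4 * V := by
    linear_combination c2 - d2M + U * hMN
  have hV0 : V = 0 := by
    have r := F.lie_e₃_e₂ N
    simp only [Derivation.commutator_apply, d1N, d2N, d2V, d1V, map_add, map_sub, map_neg, map_zero,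
      Derivation.leibniz, smul_eq_mul, Derivation.map_one_eq_zero, derivation_four] at r
    refine eq_zero_of_nat_mul_eq_zero (n := 12) (by norm_num) ?_
    push_cast
    linear_combination r
  have hN0 : N = 0 := by rw [← d2V, hV0, map_zero]
  have hM : M = 1 - l * m := by linear_combination hMN - hN0 + U * hV0
  -- with `V = 0`, the relation on `U` becomes `l m³ = 1`; differentiating it gives `5 U = 0`
  have hu : l * m * (m * m) = 1 := by
    have r := F.lie_e₃_e₂ U
    simp only [Derivation.commutator_apply, d1m, d2m, d2M, d1U, d2U, map_add, map_sub, map_neg,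
      map_zero, Derivation.leibniz, smul_eq_mul, Derivation.map_one_eq_zero, derivation_two,
      derivation_four, hV0] at r
    refine sub_eq_zero.1 (eq_zero_of_nat_mul_eq_zero (n := 12) (by norm_num) ?_)
    push_cast
    linear_combination -r + 12 * (m * m) * hM
  have hU0 : U = 0 := by
    have r := congrArg F.e₂ hu
    simp only [d2m, d2l, Derivation.leibniz, smul_eq_mul, Derivation.map_one_eq_zero] at r
    refine eq_zero_of_nat_mul_eq_zero (n := 5) (by norm_num) ?_
    push_cast
    linear_combination -r - 5 * U * hu
  have hM0 : M = 0 := by rw [← d1U, hU0, map_zero]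
  have hlm : l * m = 1 := by linear_combination hM - hM0
  exact ⟨hlm, by linear_combination hu - m * m * hlm⟩

/-- The bracket relations, applied to the entries of a unimodular matrix that is differentiated as
the matrix of a map with `f_* E₁ = l E₂` and `f_* E₂ = m E₁`. -/
theorem antidiagonal_eqs [Algebra ℂ A] (F : CRFrame A) {x y ξ η l m : A}
    (hdet : x * η - ξ * y = 1)
    (h1x : F.e₁ x = l * ξ) (h1y : F.e₁ y = l * η) (h1ξ : F.e₁ ξ = l * x) (h1η : F.e₁ η = l * y)
    (h2x : F.e₂ x = 0) (h2y : F.e₂ y = 0) (h2ξ : F.e₂ ξ = m * x) (h2η : F.e₂ η = m * y) :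
    2 * l * F.e₁ m + m * F.e₁ l = 0 ∧ 4 * l ^ 2 * m + F.e₁ (F.e₁ m) = 0 ∧
    2 * m * F.e₂ l + l * F.e₂ m = 0 ∧ F.e₂ (F.e₂ l) = 4 * l ∧
    ⁅F.e₁, F.e₂⁆ m - F.e₂ (F.e₁ m) = 2 * l * m ^ 2 - 2 * m := by
  have r1x := F.lie_e₃_e₁ x
  have r1y := F.lie_e₃_e₁ y
  have r1ξ := F.lie_e₃_e₁ ξ
  have r1η := F.lie_e₃_e₁ η
  have r2x := F.lie_e₃_e₂ x
  have r2y := F.lie_e₃_e₂ y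
  have r2ξ := F.lie_e₃_e₂ ξ
  have r2η := F.lie_e₃_e₂ η
  simp only [Derivation.commutator_apply, h1x, h1y, h1ξ, h1η, h2x, h2y, h2ξ, h2η, map_add, map_sub,
    map_zero, Derivation.leibniz, smul_eq_mul] at r1x r1y r1ξ r1η r2x r2y r2ξ r2η ⊢
  obtain ⟨a1, a2⟩ := coeff_eq_zero hdet (P := 2 * l * F.e₁ m + m * F.e₁ l)
    (Q := F.e₁ (F.e₂ l) - F.e₂ (F.e₁ l) + F.e₁ (F.e₂ l) + 2 * l ^ 2 * m - 2 * l)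
    (by linear_combination r1x) (by linear_combination r1y)
  obtain ⟨b1, -⟩ := coeff_eq_zero hdet
    (P := F.e₁ (F.e₂ l) - F.e₂ (F.e₁ l) - 2 * l ^ 2 * m - F.e₁ (F.e₁ m) + F.e₁ (F.e₂ l) - 2 * l)
    (Q := -(2 * l * F.e₁ m + m * F.e₁ l))
    (by linear_combination r1ξ) (by linear_combination r1η)
  obtain ⟨c1, c2⟩ := coeff_eq_zero hdet (P := 2 * m * F.e₂ l + l * F.e₂ m)
    (Q := F.e₂ (F.e₂ l) - 4 * l) (by linear_combination r2x) (by linear_combination r2y)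
  obtain ⟨d1, -⟩ := coeff_eq_zero hdet
    (P := F.e₁ (F.e₂ m) - F.e₂ (F.e₁ m) - 2 * l * m ^ 2 - F.e₂ (F.e₁ m) + F.e₂ (F.e₂ l) - 4 * l
      + 2 * m)
    (Q := -(2 * m * F.e₂ l + l * F.e₂ m))
    (by linear_combination r2ξ) (by linear_combination r2η)
  exact ⟨a1, by linear_combination a2 - b1, c1, by linear_combination c2,
    by linear_combination d1 - c2⟩

/-- The equations of `antidiagonal_eqs` have no invertible solutions. The notation is that of
`diagonal_solution`; here the prolonged system yields `V = 0` and then `l² = 0`. -/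
theorem antidiagonal_no_solution [Algebra ℂ A] (F : CRFrame A) {l m li mi : A} (hl : l * li = 1)
    (hm : m * mi = 1)
    (p1 : 2 * l * F.e₁ m + m * F.e₁ l = 0) (p2 : 4 * l ^ 2 * m + F.e₁ (F.e₁ m) = 0)
    (p3 : 2 * m * F.e₂ l + l * F.e₂ m = 0) (p4 : F.e₂ (F.e₂ l) = 4 * l)
    (p5 : ⁅F.e₁, F.e₂⁆ m - F.e₂ (F.e₁ m) = 2 * l * m ^ 2 - 2 * m) :
    (1 : A) = 0 := by
  obtain ⟨U, hU⟩ : ∃ U, U = li * F.e₂ l := ⟨_, rfl⟩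
  obtain ⟨V, hV⟩ : ∃ V, V = mi * F.e₁ m := ⟨_, rfl⟩
  have d1m : F.e₁ m = m * V := by linear_combination -F.e₁ m * hm - m * hV
  have d2l : F.e₂ l = l * U := by linear_combination -F.e₂ l * hl - l * hU
  have d1l : F.e₁ l = -(2 * (l * V)) := by
    linear_combination mi * p1 - F.e₁ l * hm + 2 * l * hV
  have d2m : F.e₂ m = -(2 * (m * U)) := by
    linear_combination li * p3 - F.e₂ m * hl + 2 * m * hU
  obtain ⟨M, d1U⟩ : ∃ M, F.e₁ U = M := ⟨_, rfl⟩
  obtain ⟨N, d2V⟩ : ∃ N, F.e₂ V = N := ⟨_, rfl⟩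
  have d1V : F.e₁ V = -(V * V) - 4 * (l * l) := by
    simp only [d1m, Derivation.leibniz, smul_eq_mul] at p2
    linear_combination mi * p2 - (F.e₁ V + V * V + 4 * l ^ 2) * hm
  have d2U : F.e₂ U = 4 - U * U := by
    simp only [d2l, Derivation.leibniz, smul_eq_mul] at p4
    linear_combination li * p4 - (F.e₂ U + U * U - 4) * hl
  have hMN : M + N = 1 - l * m + U * V := by
    refine sub_eq_zero.1 (eq_zero_of_nat_mul_eq_zero two_ne_zero ?_)
    simp only [Derivation.commutator_apply, d1m, d2m, d1U, d2V, Derivation.leibniz, smul_eq_mul,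
      map_neg, derivation_two] at p5
    push_cast
    linear_combination -mi * p5 + (-2 * l * m - 2 * M - 2 * N + 2 * U * V + 2) * hm
  have c1 := congrArg F.e₁ hMN
  have c2 := congrArg F.e₂ hMN
  have r1 := F.lie_e₃_e₁ l
  have r2 := F.lie_e₃_e₂ m
  simp only [Derivation.commutator_apply, d1m, d2m, d1l, d2l, d1U, d2V, d1V, d2U, map_add,
      map_sub, map_neg, map_zero,
      Derivation.leibniz, smul_eq_mul, Derivation.map_one_eq_zero,
      derivation_two, derivation_four] at c1 c2 r1 r2
  have r1' : 4 * F.e₁ N + 4 * V * N + F.e₁ M - 4 * V + 16 * (l * l) * U = 0 :=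
    eq_zero_of_unit_mul hl (by linear_combination -r1)
  have r2' : 4 * U * M + 4 * F.e₂ M + F.e₂ N - 4 * V - 4 * U = 0 :=
    eq_zero_of_unit_mul hm (by linear_combination r2)
  have d1N : F.e₁ N = V * (1 - N) - 4 * (l * l) * U := by
    refine sub_eq_zero.1 (eq_zero_of_nat_mul_eq_zero three_ne_zero ?_)
    push_cast
    linear_combination r1' - c1 - V * hMN
  have d2M : F.e₂ M = U * (1 - M) := by
    refine sub_eq_zero.1 (eq_zero_of_nat_mul_eq_zero three_ne_zero ?_)
    push_cast
    linear_combination r2' - c2 - U * hMN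
  have d2N : F.e₂ N = 4 * V := by
    linear_combination c2 - d2M + U * hMN
  have hV0 : V = 0 := by
    have r := F.lie_e₃_e₂ N
    simp only [Derivation.commutator_apply, d2l, d1N, d2N, d2V, d1V, d2U, map_add, map_sub,
        map_neg, map_zero,
      Derivation.leibniz, smul_eq_mul, Derivation.map_one_eq_zero, derivation_four] at r
    refine eq_zero_of_nat_mul_eq_zero (n := 12) (by norm_num) ?_
    push_cast
    linear_combination r
  have hl2 : l * l = 0 := by
    refine eq_zero_of_nat_mul_eq_zero (n := 4) (by norm_num) ?_
    rw [hV0, map_zero] at d1V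
    push_cast
    linear_combination d1V
  linear_combination li ^ 2 * hl2 - (l * li + 1) * hl

end CRFrame

/-! ### Points with coordinates in an algebra, and CR-maps -/

/-- A line element off the hypersurface with coordinates in a commutative ring; `ξ` is the inverse
of `x p - y`. -/
structure LinePoint (A : Type*) [CommRing A] where
  x : A
  y : A
  p : A
  ξ : A
  ξ_mul : ξ * (x * p - y) = 1

namespace LinePoint

variable {A : Type*} [CommRing A] (P : LinePoint A)

/-- The second entry of the column `(ξ, p ξ)` that completes `(x, y)` to a unimodular matrix. -/
def η : A := P.p * P.ξ

theorem det_eq_one : P.x * P.η - P.ξ * P.y = 1 := by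
  rw [η]
  linear_combination P.ξ_mul

variable [Algebra ℂ A]

/-- For a derivation `D` along which `P` moves tangentially to the distribution, the coefficient of
`E₁` in its velocity. -/
def vert (D : Derivation ℂ A A) : A := -P.ξ ^ 2 * D P.p - (P.x * P.p - P.y) * D P.x

/-- For a derivation `D` along which `P` moves tangentially to the distribution, the coefficient of
`E₂` in its velocity. -/
def horiz (D : Derivation ℂ A A) : A := (P.x * P.p - P.y) * D P.x

variable {P} {D : Derivation ℂ A A}

theorem deriv_x (D : Derivation ℂ A A) : D P.x = P.horiz D * P.ξ := by
  unfold horiz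
  linear_combination -D P.x * P.ξ_mul

theorem deriv_y (h : D P.y = P.p * D P.x) : D P.y = P.horiz D * P.η := by
  rw [h, deriv_x, η]; ring

theorem deriv_ξ (h : D P.y = P.p * D P.x) : D P.ξ = (P.vert D + P.horiz D) * P.x := by
  have := congrArg D P.ξ_mul
  simp only [Derivation.leibniz, smul_eq_mul, map_sub, Derivation.map_one_eq_zero, h] at this
  unfold vert horiz
  linear_combination P.ξ * this - D P.ξ * P.ξ_mul

theorem deriv_η (h : D P.y = P.p * D P.x) : D P.η = (P.vert D + P.horiz D) * P.y := by
  rw [η, Derivation.leibniz, smul_eq_mul, smul_eq_mul, deriv_ξ h]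
  unfold vert horiz
  linear_combination -P.ξ * D P.p * P.ξ_mul

end LinePoint

namespace CRFrame

variable {A : Type*} [CommRing A] [Algebra ℂ A]

/-- The point `P`, regarded as a map to the space of line elements, is a CR-map: the derivatives of
`P` along the frame lie in the distribution, that along `f₁` is `J` times that along `e₁`, and that
along `f₂` is `-J` times that along `e₂`. The complex structure is given by its effect
`x ↦ -i x`, `p ↦ i (p + 2 W³ x)` on the coordinates of vectors of the distribution. -/
structure IsCRMap (F : CRFrame A) (P : LinePoint A) : Prop where
  e₁_y : F.e₁ P.y = P.p * F.e₁ P.x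
  f₁_y : F.f₁ P.y = P.p * F.f₁ P.x
  e₂_y : F.e₂ P.y = P.p * F.e₂ P.x
  f₂_y : F.f₂ P.y = P.p * F.f₂ P.x
  f₁_x : F.f₁ P.x = -algebraMap ℂ A Complex.I * F.e₁ P.x
  f₁_p : F.f₁ P.p =
    algebraMap ℂ A Complex.I * (F.e₁ P.p + 2 * (P.x * P.p - P.y) ^ 3 * F.e₁ P.x)
  f₂_x : F.f₂ P.x = algebraMap ℂ A Complex.I * F.e₂ P.x
  f₂_p : F.f₂ P.p =
    -algebraMap ℂ A Complex.I * (F.e₂ P.p + 2 * (P.x * P.p - P.y) ^ 3 * F.e₂ P.x)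

theorem algebraMap_I_mul_self : algebraMap ℂ A Complex.I * algebraMap ℂ A Complex.I = -1 := by
  rw [← map_mul, Complex.I_mul_I, map_neg, map_one]

namespace IsCRMap

variable {F : CRFrame A} {P : LinePoint A}

theorem vert_f₁ (h : F.IsCRMap P) : P.vert F.f₁ = algebraMap ℂ A Complex.I * P.vert F.e₁ := by
  unfold LinePoint.vert
  rw [h.f₁_x, h.f₁_p]
  linear_combination -2 * algebraMap ℂ A Complex.I * (P.x * P.p - P.y) * F.e₁ P.x *
    (P.ξ * (P.x * P.p - P.y) + 1) * P.ξ_mul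

theorem horiz_f₁ (h : F.IsCRMap P) : P.horiz F.f₁ = -algebraMap ℂ A Complex.I * P.horiz F.e₁ := by
  unfold LinePoint.horiz
  rw [h.f₁_x]; ring

theorem vert_f₂ (h : F.IsCRMap P) : P.vert F.f₂ = -algebraMap ℂ A Complex.I * P.vert F.e₂ := by
  unfold LinePoint.vert
  rw [h.f₂_x, h.f₂_p]
  linear_combination 2 * algebraMap ℂ A Complex.I * (P.x * P.p - P.y) * F.e₂ P.x *
    (P.ξ * (P.x * P.p - P.y) + 1) * P.ξ_mul

theorem horiz_f₂ (h : F.IsCRMap P) : P.horiz F.f₂ = algebraMap ℂ A Complex.I * P.horiz F.e₂ := by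
  unfold LinePoint.horiz
  rw [h.f₂_x]; ring

/-- If `e` and `f` commute and the images of `e` and `f` are `v E₁ + h E₂` and `c (v E₁ - h E₂)`,
then the `E₃`-component `-2 c v h` of the bracket of the images vanishes. -/
theorem levi {e f : Derivation ℂ A A} {c : ℂ} (hc : c ≠ 0) (hlie : ∀ a, ⁅e, f⁆ a = 0)
    (he : e P.y = P.p * e P.x) (hf : f P.y = P.p * f P.x)
    (hv : P.vert f = algebraMap ℂ A c * P.vert e)
    (hh : P.horiz f = -algebraMap ℂ A c * P.horiz e) : P.vert e * P.horiz e = 0 := by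
  have rx := hlie P.x
  have ry := hlie P.y
  have hf' : f P.ξ = (P.vert f + P.horiz f) * P.x := P.deriv_ξ hf
  have hg' : f P.η = (P.vert f + P.horiz f) * P.y := P.deriv_η hf
  rw [Derivation.commutator_apply, P.deriv_x f, P.deriv_x e] at rx
  rw [Derivation.commutator_apply, P.deriv_y he, P.deriv_y hf] at ry
  simp only [Derivation.leibniz, smul_eq_mul, map_neg, Derivation.map_algebraMap, hf', hg',
    P.deriv_ξ he, P.deriv_η he, hv, hh] at rx ry
  obtain ⟨h1, -⟩ := coeff_eq_zero P.det_eq_one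
    (P := -2 * algebraMap ℂ A c * (P.vert e * P.horiz e))
    (Q := -algebraMap ℂ A c * e (P.horiz e) - f (P.horiz e))
    (by linear_combination rx) (by linear_combination ry)
  have hc' : algebraMap ℂ A c * algebraMap ℂ A c⁻¹ = 1 := by
    rw [← map_mul, mul_inv_cancel₀ hc, map_one]
  refine eq_zero_of_nat_mul_eq_zero two_ne_zero (eq_zero_of_unit_mul hc' ?_)
  push_cast
  linear_combination -h1

theorem vert_mul_horiz_e₁ (h : F.IsCRMap P) : P.vert F.e₁ * P.horiz F.e₁ = 0 :=
  levi Complex.I_ne_zero F.lie_e₁_f₁ h.e₁_y h.f₁_y h.vert_f₁ h.horiz_f₁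

theorem vert_mul_horiz_e₂ (h : F.IsCRMap P) : P.vert F.e₂ * P.horiz F.e₂ = 0 :=
  levi (neg_ne_zero.2 Complex.I_ne_zero) F.lie_e₂_f₂ h.e₂_y h.f₂_y
    (by rw [h.vert_f₂, map_neg]) (by rw [h.horiz_f₂, map_neg, neg_neg])

/-- The multipliers of a CR-map that preserves the two eigenlines are equal to each other and
square to `1`. -/
theorem rigid (h : F.IsCRMap P) (h1 : IsUnit (P.vert F.e₁)) (h2 : IsUnit (P.horiz F.e₂)) :
    P.vert F.e₁ * P.horiz F.e₂ = 1 ∧ P.horiz F.e₂ * P.horiz F.e₂ = 1 := by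
  have b1 := h1.mul_right_eq_zero.1 h.vert_mul_horiz_e₁
  have a2 := h2.mul_left_eq_zero.1 h.vert_mul_horiz_e₂
  have k1 := P.deriv_x F.e₁
  have k2 := P.deriv_y h.e₁_y
  have k3 := P.deriv_ξ h.e₁_y
  have k4 := P.deriv_η h.e₁_y
  have k7 := P.deriv_ξ h.e₂_y
  have k8 := P.deriv_η h.e₂_y
  rw [b1, zero_mul] at k1 k2
  rw [b1, add_zero] at k3 k4
  rw [a2, zero_add] at k7 k8
  obtain ⟨li, hl⟩ := h1.exists_right_inv
  obtain ⟨mi, hm⟩ := h2.exists_right_inv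
  obtain ⟨p1, p2, p3, p4, p5⟩ := F.diagonal_eqs P.det_eq_one k1 k2 k3 k4 (P.deriv_x F.e₂)
    (P.deriv_y h.e₂_y) k7 k8
  exact F.diagonal_solution hl hm p1 p2 p3 p4 p5

/-- A CR-map cannot swap the two eigenlines. -/
theorem not_swap [Nontrivial A] (h : F.IsCRMap P) (h1 : IsUnit (P.horiz F.e₁))
    (h2 : IsUnit (P.vert F.e₂)) : False := by
  have a1 := h1.mul_left_eq_zero.1 h.vert_mul_horiz_e₁
  have b2 := h2.mul_right_eq_zero.1 h.vert_mul_horiz_e₂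
  have k3 := P.deriv_ξ h.e₁_y
  have k4 := P.deriv_η h.e₁_y
  have k5 := P.deriv_x F.e₂
  have k6 := P.deriv_y h.e₂_y
  have k7 := P.deriv_ξ h.e₂_y
  have k8 := P.deriv_η h.e₂_y
  rw [a1, zero_add] at k3 k4
  rw [b2, zero_mul] at k5 k6
  rw [b2, add_zero] at k7 k8
  obtain ⟨li, hl⟩ := h1.exists_right_inv
  obtain ⟨mi, hm⟩ := h2.exists_right_inv
  obtain ⟨p1, p2, p3, p4, p5⟩ := F.antidiagonal_eqs P.det_eq_one (P.deriv_x F.e₁)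
    (P.deriv_y h.e₁_y) k3 k4 k5 k6 k7 k8
  exact one_ne_zero (F.antidiagonal_no_solution hl hm p1 p2 p3 p4 p5)

end IsCRMap

/-- If `P` and `Q` have proportional velocities along `D` with a factor `m` that squares to `1`,
then `D` annihilates the entries of the matrix of `P`, with second column multiplied by `m`, times
the inverse of the matrix of `Q`. -/
theorem derivation_linePoint_pairing {P Q : LinePoint A} {m : A} {D : Derivation ℂ A A}
    (hm : m * m = 1) (hP : D P.y = P.p * D P.x) (hQ : D Q.y = Q.p * D Q.x)
    (hh : P.horiz D = m * Q.horiz D) (hv : P.vert D = m * Q.vert D) :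
    D (P.x * Q.η - m * P.ξ * Q.y) = 0 ∧ D (m * P.ξ * Q.x - P.x * Q.ξ) = 0 ∧
    D (P.y * Q.η - m * P.η * Q.y) = 0 ∧ D (m * P.η * Q.x - P.y * Q.ξ) = 0 := by
  have hDm : D m = 0 := by
    have := congrArg D hm
    simp only [Derivation.leibniz, smul_eq_mul, Derivation.map_one_eq_zero] at this
    refine eq_zero_of_nat_mul_eq_zero two_ne_zero ?_
    push_cast
    linear_combination m * this - 2 * D m * hm
  simp only [Derivation.leibniz, smul_eq_mul, map_sub, hDm, P.deriv_x D, P.deriv_y hP, P.deriv_ξ hP,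
    P.deriv_η hP, Q.deriv_x D, Q.deriv_y hQ, Q.deriv_ξ hQ, Q.deriv_η hQ, hh, hv]
  refine ⟨?_, ?_, ?_, ?_⟩
  · linear_combination -(Q.vert D + Q.horiz D) * P.x * Q.y * hm
  · linear_combination (Q.vert D + Q.horiz D) * P.x * Q.x * hm
  · linear_combination -(Q.vert D + Q.horiz D) * P.y * Q.y * hm
  · linear_combination (Q.vert D + Q.horiz D) * P.y * Q.x * hm

/-- The velocities of `Q` along `e₁` and `e₂` are `E₁` and `E₂`: this expresses that `Q` is the
identity map. -/
structure IsAdapted (F : CRFrame A) (Q : LinePoint A) : Prop where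
  vert_e₁ : Q.vert F.e₁ = 1
  horiz_e₁ : Q.horiz F.e₁ = 0
  vert_e₂ : Q.vert F.e₂ = 0
  horiz_e₂ : Q.horiz F.e₂ = 1

/-- The element is annihilated by all derivations of the frame. -/
structure IsConstant (F : CRFrame A) (a : A) : Prop where
  e₁ : F.e₁ a = 0
  f₁ : F.f₁ a = 0
  e₂ : F.e₂ a = 0
  f₂ : F.f₂ a = 0

/-- The matrix of a CR-map that preserves the two eigenlines is, up to the sign `m` of its second
column, the product of a constant matrix and the matrix of the identity map. -/
theorem IsCRMap.isConstant_pairing {F : CRFrame A} {P Q : LinePoint A} (hP : F.IsCRMap P)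
    (hQ : F.IsCRMap Q) (hA : F.IsAdapted Q) (hu₁ : IsUnit (P.vert F.e₁))
    (hu₂ : IsUnit (P.horiz F.e₂)) :
    ∃ m, m = P.horiz F.e₂ ∧ m * m = 1 ∧
      F.IsConstant (P.x * Q.η - m * P.ξ * Q.y) ∧ F.IsConstant (m * P.ξ * Q.x - P.x * Q.ξ) ∧
      F.IsConstant (P.y * Q.η - m * P.η * Q.y) ∧ F.IsConstant (m * P.η * Q.x - P.y * Q.ξ) := by
  obtain ⟨hlm, hmm⟩ := hP.rigid hu₁ hu₂
  refine ⟨_, rfl, hmm, ?_⟩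
  have hl : P.vert F.e₁ = P.horiz F.e₂ := by
    linear_combination P.horiz F.e₂ * hlm - P.vert F.e₁ * hmm
  have hb1 : P.horiz F.e₁ = 0 := hu₁.mul_right_eq_zero.1 hP.vert_mul_horiz_e₁
  have ha2 : P.vert F.e₂ = 0 := hu₂.mul_left_eq_zero.1 hP.vert_mul_horiz_e₂
  obtain ⟨a1, b1, c1, d1⟩ := derivation_linePoint_pairing hmm hP.e₁_y hQ.e₁_y
    (by rw [hb1, hA.horiz_e₁, mul_zero]) (by rw [hl, hA.vert_e₁, mul_one])
  obtain ⟨a2, b2, c2, d2⟩ := derivation_linePoint_pairing hmm hP.f₁_y hQ.f₁_y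
    (by rw [hP.horiz_f₁, hQ.horiz_f₁, hb1, hA.horiz_e₁, mul_zero, mul_zero])
    (by rw [hP.vert_f₁, hQ.vert_f₁, hl, hA.vert_e₁]; ring)
  obtain ⟨a3, b3, c3, d3⟩ := derivation_linePoint_pairing hmm hP.e₂_y hQ.e₂_y
    (by rw [hA.horiz_e₂, mul_one]) (by rw [ha2, hA.vert_e₂, mul_zero])
  obtain ⟨a4, b4, c4, d4⟩ := derivation_linePoint_pairing hmm hP.f₂_y hQ.f₂_y
    (by rw [hP.horiz_f₂, hQ.horiz_f₂, hA.horiz_e₂]; ring)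
    (by rw [hP.vert_f₂, hQ.vert_f₂, ha2, hA.vert_e₂, mul_zero, mul_zero])
  exact ⟨⟨a1, a2, a3, a4⟩, ⟨b1, b2, b3, b4⟩, ⟨c1, c2, c3, c4⟩, ⟨d1, d2, d3, d4⟩⟩

end CRFrame

/-- If the matrix of `P`, with second column multiplied by `m`, is the product of the matrix with
entries `a`, `b`, `c`, `d` and that of `Q`, then `P` is the image of `Q` under the linear map with
these entries. -/
theorem LinePoint.recover {A : Type*} [CommRing A] {P Q : LinePoint A} {m a b c d : A}
    (ha : P.x * Q.η - m * P.ξ * Q.y = a) (hb : m * P.ξ * Q.x - P.x * Q.ξ = b)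
    (hc : P.y * Q.η - m * P.η * Q.y = c) (hd : m * P.η * Q.x - P.y * Q.ξ = d) :
    P.x = a * Q.x + b * Q.y ∧ P.y = c * Q.x + d * Q.y ∧ P.p * (a + b * Q.p) = c + d * Q.p := by
  subst ha hb hc hd
  have hQ := Q.ξ_mul
  simp only [LinePoint.η]
  refine ⟨?_, ?_, ?_⟩
  · linear_combination -P.x * hQ
  · linear_combination -P.y * hQ
  · ring

/-! ### Germs of smooth functions -/

section

open Filter

section SmoothGerm

variable {E : Type*} [NormedAddCommGroup E] [NormedSpace ℝ E]

/-- The germs at `q` of complex-valued functions that are smooth in the real sense. -/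
def smoothGerms (q : E) : Subring (Germ (𝓝 q) ℂ) where
  carrier := {φ | ∃ g : E → ℂ, ContDiffAt ℝ ∞ g q ∧ φ = (g : Germ (𝓝 q) ℂ)}
  mul_mem' := by
    rintro _ _ ⟨g, hg, rfl⟩ ⟨h, hh, rfl⟩
    exact ⟨g * h, hg.mul hh, rfl⟩
  one_mem' := ⟨1, contDiffAt_const, rfl⟩
  add_mem' := by
    rintro _ _ ⟨g, hg, rfl⟩ ⟨h, hh, rfl⟩
    exact ⟨g + h, hg.add hh, rfl⟩
  zero_mem' := ⟨0, contDiffAt_const, rfl⟩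
  neg_mem' := by
    rintro _ ⟨g, hg, rfl⟩
    exact ⟨-g, hg.neg, rfl⟩

/-- The algebra of germs at `q` of complex-valued functions, smooth in the real sense. -/
abbrev SmoothGerm (q : E) : Type _ := smoothGerms q

namespace SmoothGerm

variable {q : E} {g h : E → ℂ}

/-- The germ of a smooth function. -/
def mk (g : E → ℂ) (hg : ContDiffAt ℝ ∞ g q) : SmoothGerm q := ⟨(g : Germ (𝓝 q) ℂ), g, hg, rfl⟩

theorem exists_rep (φ : SmoothGerm q) : ∃ (g : E → ℂ) (hg : ContDiffAt ℝ ∞ g q), φ = mk g hg := by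
  obtain ⟨_, g, hg, rfl⟩ := φ
  exact ⟨g, hg, rfl⟩

theorem mk_eq_mk {hg : ContDiffAt ℝ ∞ g q} {hh : ContDiffAt ℝ ∞ h q} :
    mk g hg = mk h hh ↔ g =ᶠ[𝓝 q] h := by
  rw [← Germ.coe_eq]
  exact Subtype.ext_iff

theorem mk_mul (hg : ContDiffAt ℝ ∞ g q) (hh : ContDiffAt ℝ ∞ h q) :
    mk g hg * mk h hh = mk (fun r => g r * h r) (hg.mul hh) := rfl

theorem mk_add (hg : ContDiffAt ℝ ∞ g q) (hh : ContDiffAt ℝ ∞ h q) :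
    mk g hg + mk h hh = mk (fun r => g r + h r) (hg.add hh) := rfl

theorem mk_sub (hg : ContDiffAt ℝ ∞ g q) (hh : ContDiffAt ℝ ∞ h q) :
    mk g hg - mk h hh = mk (fun r => g r - h r) (hg.sub hh) := rfl

noncomputable instance : Algebra ℂ (SmoothGerm q) :=
  RingHom.toAlgebra
    { toFun := fun c => mk (fun _ => c) contDiffAt_const
      map_one' := rfl
      map_mul' := fun _ _ => rfl
      map_zero' := rfl
      map_add' := fun _ _ => rfl }

theorem algebraMap_eq (c : ℂ) :
    algebraMap ℂ (SmoothGerm q) c = mk (fun _ => c) contDiffAt_const := rfl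

/-- The value of a germ at the base point. -/
def value (q : E) : SmoothGerm q →+* ℂ := (Germ.valueRingHom).comp (smoothGerms q).subtype

@[simp] theorem value_mk (hg : ContDiffAt ℝ ∞ g q) : value q (mk g hg) = g q := rfl

instance : Nontrivial (SmoothGerm q) := (value q).domain_nontrivial

theorem isUnit_of_value_ne_zero {φ : SmoothGerm q} (hφ : value q φ ≠ 0) : IsUnit φ := by
  obtain ⟨g, hg, rfl⟩ := φ.exists_rep
  rw [value_mk] at hφ
  refine IsUnit.of_mul_eq_one (mk (fun r => (g r)⁻¹) (hg.inv hφ)) ?_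
  rw [mk_mul]
  refine mk_eq_mk (hh := contDiffAt_const) |>.2 ?_
  filter_upwards [hg.continuousAt.eventually_ne hφ] with r hr using mul_inv_cancel₀ hr

variable {V W : E → E}

theorem contDiffAt_fderiv_apply {F : Type*} [NormedAddCommGroup F] [NormedSpace ℝ F] {g : E → F}
    (hg : ContDiffAt ℝ ∞ g q) (hV : ContDiffAt ℝ ∞ V q) :
    ContDiffAt ℝ ∞ (fun r => fderiv ℝ g r (V r)) q :=
  (hg.fderiv_right (m := ∞) (by simp)).clm_apply hV

theorem eventually_differentiableAt {F : Type*} [NormedAddCommGroup F] [NormedSpace ℝ F] {g : E → F}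
    (hg : ContDiffAt ℝ ∞ g q) :
    ∀ᶠ r in 𝓝 q, DifferentiableAt ℝ g r := by
  filter_upwards [(hg.of_le (m := 1) (by exact_mod_cast le_top)).eventually (by simp)] with r hr
  exact hr.differentiableAt one_ne_zero

/-- The function underlying `dirDeriv`, defined by means of a chosen representative. -/
noncomputable def dirDerivFun (V : E → E) (hV : ContDiffAt ℝ ∞ V q) (φ : SmoothGerm q) :
    SmoothGerm q :=
  mk (fun r => fderiv ℝ φ.exists_rep.choose r (V r))
    (contDiffAt_fderiv_apply φ.exists_rep.choose_spec.choose hV)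

theorem dirDerivFun_mk (hV : ContDiffAt ℝ ∞ V q) (hg : ContDiffAt ℝ ∞ g q) :
    dirDerivFun V hV (mk g hg) =
      mk (fun r => fderiv ℝ g r (V r)) (contDiffAt_fderiv_apply hg hV) := by
  refine mk_eq_mk.2 ?_
  have := mk_eq_mk.1 (mk g hg).exists_rep.choose_spec.choose_spec
  filter_upwards [this.fderiv (𝕜 := ℝ)] with r hr
  rw [← hr]

/-- The derivative of complex-valued germs along the real vector field `V`. The derivation is
`ℂ`-linear, since `V` differentiates real and imaginary parts. -/
noncomputable def dirDeriv (V : E → E) (hV : ContDiffAt ℝ ∞ V q) :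
    Derivation ℂ (SmoothGerm q) (SmoothGerm q) :=
  Derivation.mk'
    { toFun := dirDerivFun V hV
      map_add' := by
        intro φ ψ
        obtain ⟨g, hg, rfl⟩ := φ.exists_rep
        obtain ⟨h, hh, rfl⟩ := ψ.exists_rep
        rw [mk_add, dirDerivFun_mk, dirDerivFun_mk, dirDerivFun_mk, mk_add]
        refine mk_eq_mk.2 ?_
        filter_upwards [eventually_differentiableAt hg, eventually_differentiableAt hh] with r h1 h2
        rw [fderiv_fun_add h1 h2]; rfl
      map_smul' := by
        intro c φ
        obtain ⟨g, hg, rfl⟩ := φ.exists_rep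
        rw [Algebra.smul_def, algebraMap_eq, mk_mul, dirDerivFun_mk, dirDerivFun_mk,
          RingHom.id_apply, Algebra.smul_def, algebraMap_eq, mk_mul]
        refine mk_eq_mk.2 ?_
        filter_upwards [eventually_differentiableAt hg] with r h1
        rw [fderiv_const_mul h1]; rfl }
    (by
      intro φ ψ
      obtain ⟨g, hg, rfl⟩ := φ.exists_rep
      obtain ⟨h, hh, rfl⟩ := ψ.exists_rep
      change dirDerivFun V hV _ = _ * dirDerivFun V hV _ + _ * dirDerivFun V hV _
      rw [mk_mul, dirDerivFun_mk, dirDerivFun_mk, dirDerivFun_mk, mk_mul, mk_mul, mk_add]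
      refine mk_eq_mk.2 ?_
      filter_upwards [eventually_differentiableAt hg, eventually_differentiableAt hh] with r h1 h2
      rw [fderiv_fun_mul h1 h2]; rfl)

theorem dirDeriv_mk (hV : ContDiffAt ℝ ∞ V q) (hg : ContDiffAt ℝ ∞ g q) :
    dirDeriv V hV (mk g hg) =
      mk (fun r => fderiv ℝ g r (V r)) (contDiffAt_fderiv_apply hg hV) :=
  dirDerivFun_mk hV hg

theorem contDiffAt_lieBracket (hV : ContDiffAt ℝ ∞ V q) (hW : ContDiffAt ℝ ∞ W q) :
    ContDiffAt ℝ ∞ (VectorField.lieBracket ℝ V W) q :=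
  ((hW.fderiv_right (m := ∞) (by simp)).clm_apply hV).sub
    ((hV.fderiv_right (m := ∞) (by simp)).clm_apply hW)

theorem lie_dirDeriv (hV : ContDiffAt ℝ ∞ V q) (hW : ContDiffAt ℝ ∞ W q) :
    ⁅dirDeriv V hV, dirDeriv W hW⁆ =
      dirDeriv (VectorField.lieBracket ℝ V W) (contDiffAt_lieBracket hV hW) := by
  ext1 φ
  obtain ⟨g, hg, rfl⟩ := φ.exists_rep
  rw [Derivation.commutator_apply]
  simp only [dirDeriv_mk, mk_sub]
  refine mk_eq_mk.2 ?_
  have hg2 : ∀ᶠ r in 𝓝 q, ContDiffAt ℝ 2 g r :=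
    (hg.of_le (m := 2) (by exact WithTop.coe_le_coe.2 le_top)).eventually (by simp)
  filter_upwards [eventually_differentiableAt hV, eventually_differentiableAt hW, hg2,
    eventually_differentiableAt (hg.fderiv_right (m := ∞) (by simp))] with r h1 h2 h3 h4
  have hs : IsSymmSndFDerivAt ℝ g r := h3.isSymmSndFDerivAt (by simp)
  rw [fderiv_clm_apply h4 h2, fderiv_clm_apply h4 h1]
  simp [VectorField.lieBracket_eq, hs.eq (V r) (W r)]

theorem eq_algebraMap_of_fderiv_eq_zero (hg : ContDiffAt ℝ ∞ g q)
    (h : ∀ᶠ r in 𝓝 q, fderiv ℝ g r = 0) : mk g hg = algebraMap ℂ (SmoothGerm q) (g q) := by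
  obtain ⟨ε, hε, hb⟩ := Metric.eventually_nhds_iff_ball.1 (h.and (eventually_differentiableAt hg))
  rw [algebraMap_eq]
  refine mk_eq_mk.2 ?_
  filter_upwards [Metric.ball_mem_nhds q hε] with r hr
  exact Metric.isOpen_ball.is_const_of_fderiv_eq_zero (convex_ball q ε).isPreconnected
    (fun s hs => (hb s hs).2.differentiableWithinAt) (fun s hs => (hb s hs).1) hr
    (Metric.mem_ball_self hε)

end SmoothGerm

end SmoothGerm

end

/-! ### Germs of maps into the jet space and of vector fields on it -/

section

open Filter

namespace SmoothGerm

section JetSpace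

variable {q : JetSpace}

/-- The germ of the `x`-coordinate of a map. -/
noncomputable def fst (X : JetSpace → JetSpace) (hX : ContDiffAt ℝ ∞ X q) : SmoothGerm q :=
  mk (fun r => (X r).1) hX.fst

/-- The germ of the `y`-coordinate of a map. -/
noncomputable def snd (X : JetSpace → JetSpace) (hX : ContDiffAt ℝ ∞ X q) : SmoothGerm q :=
  mk (fun r => (X r).2.1) hX.snd.fst

/-- The germ of the `p`-coordinate of a map. -/
noncomputable def trd (X : JetSpace → JetSpace) (hX : ContDiffAt ℝ ∞ X q) : SmoothGerm q :=
  mk (fun r => (X r).2.2) hX.snd.snd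

variable {f V W : JetSpace → JetSpace} (hf : ContDiffAt ℝ ∞ f q) (hV : ContDiffAt ℝ ∞ V q)
  (hW : ContDiffAt ℝ ∞ W q)

theorem dirDeriv_fst : dirDeriv V hV (fst f hf) =
    fst (fun r => fderiv ℝ f r (V r)) (contDiffAt_fderiv_apply hf hV) := by
  rw [fst, dirDeriv_mk]
  refine mk_eq_mk.2 ?_
  filter_upwards [eventually_differentiableAt hf] with r hr
  rw [fderiv.fst hr]; rfl

theorem dirDeriv_snd : dirDeriv V hV (snd f hf) =
    snd (fun r => fderiv ℝ f r (V r)) (contDiffAt_fderiv_apply hf hV) := by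
  rw [snd, dirDeriv_mk]
  refine mk_eq_mk.2 ?_
  filter_upwards [eventually_differentiableAt hf] with r hr
  rw [fderiv.fst hr.snd, fderiv.snd hr]; rfl

theorem dirDeriv_trd : dirDeriv V hV (trd f hf) =
    trd (fun r => fderiv ℝ f r (V r)) (contDiffAt_fderiv_apply hf hV) := by
  rw [trd, dirDeriv_mk]
  refine mk_eq_mk.2 ?_
  filter_upwards [eventually_differentiableAt hf] with r hr
  rw [fderiv.snd hr.snd, fderiv.snd hr]; rfl

theorem dirDeriv_fst_id : dirDeriv V hV (fst id contDiffAt_id) = fst V hV := by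
  rw [dirDeriv_fst]; simp [fst]

theorem dirDeriv_snd_id : dirDeriv V hV (snd id contDiffAt_id) = snd V hV := by
  rw [dirDeriv_snd]; simp [snd]

theorem dirDeriv_trd_id : dirDeriv V hV (trd id contDiffAt_id) = trd V hV := by
  rw [dirDeriv_trd]; simp [trd]

theorem dirDeriv_congr (h : V =ᶠ[𝓝 q] W) : dirDeriv V hV = dirDeriv W hW := by
  ext1 φ
  obtain ⟨g, hg, rfl⟩ := φ.exists_rep
  rw [dirDeriv_mk, dirDeriv_mk]
  refine mk_eq_mk.2 ?_
  filter_upwards [h] with r hr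
  rw [hr]

theorem eventuallyEq_of_coords (h1 : fst V hV = fst W hW) (h2 : snd V hV = snd W hW)
    (h3 : trd V hV = trd W hW) : V =ᶠ[𝓝 q] W := by
  filter_upwards [mk_eq_mk.1 h1, mk_eq_mk.1 h2, mk_eq_mk.1 h3] with r a b c
  exact Prod.ext a (Prod.ext b c)

/-- The derivation is the derivative along a smooth real vector field. Unlike general derivations
of the algebra of germs, these are determined by their values on the coordinates. -/
def IsVectorField (D : Derivation ℂ (SmoothGerm q) (SmoothGerm q)) : Prop :=
  ∃ (V : JetSpace → JetSpace) (hV : ContDiffAt ℝ ∞ V q), D = dirDeriv V hV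

theorem isVectorField_dirDeriv : IsVectorField (dirDeriv V hV) := ⟨V, hV, rfl⟩

namespace IsVectorField

variable {D D' : Derivation ℂ (SmoothGerm q) (SmoothGerm q)}

theorem lie (h : IsVectorField D) (h' : IsVectorField D') : IsVectorField ⁅D, D'⁆ := by
  obtain ⟨V, hV, rfl⟩ := h
  obtain ⟨W, hW, rfl⟩ := h'
  exact ⟨_, _, lie_dirDeriv hV hW⟩

theorem nsmul (n : ℕ) (h : IsVectorField D) : IsVectorField (n • D) := by
  obtain ⟨V, hV, rfl⟩ := h
  refine ⟨fun r => (n : ℝ) • V r, (contDiffAt_const (c := (n : ℝ))).smul hV, ?_⟩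
  ext1 φ
  obtain ⟨g, hg, rfl⟩ := φ.exists_rep
  rw [Derivation.smul_apply, nsmul_eq_mul, dirDeriv_mk, dirDeriv_mk,
    ← map_natCast (algebraMap ℂ (SmoothGerm q)), algebraMap_eq, mk_mul]
  refine mk_eq_mk.2 (Eventually.of_forall fun r => ?_)
  simp

theorem sub (h : IsVectorField D) (h' : IsVectorField D') : IsVectorField (D - D') := by
  obtain ⟨V, hV, rfl⟩ := h
  obtain ⟨W, hW, rfl⟩ := h'
  refine ⟨V - W, hV.sub hW, ?_⟩
  ext1 φ
  obtain ⟨g, hg, rfl⟩ := φ.exists_rep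
  rw [Derivation.sub_apply, dirDeriv_mk, dirDeriv_mk, dirDeriv_mk, mk_sub]
  refine mk_eq_mk.2 (Eventually.of_forall fun r => ?_)
  simp

theorem ext (h : IsVectorField D) (h' : IsVectorField D')
    (h1 : D (fst id contDiffAt_id) = D' (fst id contDiffAt_id))
    (h2 : D (snd id contDiffAt_id) = D' (snd id contDiffAt_id))
    (h3 : D (trd id contDiffAt_id) = D' (trd id contDiffAt_id)) : D = D' := by
  obtain ⟨V, hV, rfl⟩ := h
  obtain ⟨W, hW, rfl⟩ := h'
  rw [dirDeriv_fst_id, dirDeriv_fst_id] at h1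
  rw [dirDeriv_snd_id, dirDeriv_snd_id] at h2
  rw [dirDeriv_trd_id, dirDeriv_trd_id] at h3
  exact dirDeriv_congr hV hW (eventuallyEq_of_coords hV hW h1 h2 h3)

end IsVectorField

end JetSpace

end SmoothGerm

end

/-! ### The frame of the quartic off the hypersurface -/

section

open Filter SmoothGerm

/-- The defining function `x p - y` of the hypersurface. -/
noncomputable def wronskian (r : JetSpace) : ℂ := r.1 * r.2.2 - r.2.1

theorem wronskian_ne_zero {q : JetSpace} (hq : q ∉ hypersurfaceΓ) : wronskian q ≠ 0 :=
  fun h => hq (sub_eq_zero.1 h).symm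

theorem contDiff_wronskian : ContDiff ℝ ∞ wronskian := by
  unfold wronskian; fun_prop

/-- The field `E₁ = -W² ∂/∂p`. -/
noncomputable def frame₁ (r : JetSpace) : JetSpace := (0, 0, -wronskian r ^ 2)

/-- The field `E₂ = Z₂ / W`. -/
noncomputable def frame₂ (r : JetSpace) : JetSpace :=
  ((wronskian r)⁻¹, r.2.2 * (wronskian r)⁻¹, -wronskian r ^ 2)

theorem contDiff_frame₁ : ContDiff ℝ ∞ frame₁ :=
  contDiff_const.prodMk (contDiff_const.prodMk (contDiff_wronskian.pow 2).neg)

theorem contDiffAt_frame₂ {q : JetSpace} (hq : wronskian q ≠ 0) : ContDiffAt ℝ ∞ frame₂ q :=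
  have h := contDiff_wronskian.contDiffAt.inv hq
  h.prodMk (((by fun_prop : ContDiffAt ℝ ∞ (fun r : JetSpace => r.2.2) q).mul h).prodMk
    (contDiff_wronskian.contDiffAt.pow 2).neg)

theorem contDiffAt_const_smul {q : JetSpace} {V : JetSpace → JetSpace} (c : ℂ)
    (hV : ContDiffAt ℝ ∞ V q) :
    ContDiffAt ℝ ∞ (fun r => c • V r) q :=
  (contDiffAt_const (c := c)).smul hV

/-- The germ at `q` of a map to the space of line elements, regarded as a line element with
coordinates in the algebra of germs. -/
noncomputable def mapPoint {q : JetSpace} (f : JetSpace → JetSpace) (hf : ContDiffAt ℝ ∞ f q)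
    (hw : wronskian (f q) ≠ 0) : LinePoint (SmoothGerm q) where
  x := fst f hf
  y := snd f hf
  p := trd f hf
  ξ := mk (fun r => (wronskian (f r))⁻¹) ((contDiff_wronskian.contDiffAt.comp q hf).inv hw)
  ξ_mul := by
    rw [fst, snd, trd, mk_mul, mk_sub, mk_mul]
    refine mk_eq_mk (hh := contDiffAt_const) |>.2 ?_
    filter_upwards [(contDiff_wronskian.contDiffAt.comp q hf).continuousAt.eventually_ne hw]
      with r hr
    exact inv_mul_cancel₀ hr

/-- The germ of the identity map. -/
noncomputable abbrev basePoint {q : JetSpace} (hq : wronskian q ≠ 0) : LinePoint (SmoothGerm q) :=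
  mapPoint id contDiffAt_id hq

section
variable {q : JetSpace} (hq : wronskian q ≠ 0) (c : ℂ)

/-- The derivative along the vector field `c E₁`. -/
noncomputable def d₁ (q : JetSpace) (c : ℂ) : Derivation ℂ (SmoothGerm q) (SmoothGerm q) :=
  dirDeriv (fun r => c • frame₁ r) (contDiffAt_const_smul c contDiff_frame₁.contDiffAt)

/-- The derivative along the vector field `c E₂`. -/
noncomputable def d₂ : Derivation ℂ (SmoothGerm q) (SmoothGerm q) :=
  dirDeriv (fun r => c • frame₂ r) (contDiffAt_const_smul c (contDiffAt_frame₂ hq))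

theorem ext_basePoint {D D' : Derivation ℂ (SmoothGerm q) (SmoothGerm q)}
    (h : IsVectorField D) (h' : IsVectorField D')
    (h1 : D (basePoint hq).x = D' (basePoint hq).x)
    (h2 : D (basePoint hq).y = D' (basePoint hq).y)
    (h3 : D (basePoint hq).p = D' (basePoint hq).p) : D = D' :=
  h.ext h' h1 h2 h3

theorem d₁_x : d₁ q c (basePoint hq).x = 0 := by
  refine (dirDeriv_fst_id _).trans ?_
  exact mk_eq_mk (hh := contDiffAt_const) |>.2 (Eventually.of_forall fun r => by simp [frame₁])

theorem d₁_y : d₁ q c (basePoint hq).y = 0 := by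
  refine (dirDeriv_snd_id _).trans ?_
  exact mk_eq_mk (hh := contDiffAt_const) |>.2 (Eventually.of_forall fun r => by simp [frame₁])

theorem d₁_p : d₁ q c (basePoint hq).p = -algebraMap ℂ _ c *
    ((basePoint hq).x * (basePoint hq).p - (basePoint hq).y) ^ 2 := by
  refine (dirDeriv_trd_id _).trans ?_
  exact (mk_eq_mk
    (hh := (contDiffAt_const (c := c)).neg.mul (contDiff_wronskian.contDiffAt.pow 2))).2
    (Eventually.of_forall fun r => by simp [frame₁])

theorem d₂_x : d₂ hq c (basePoint hq).x = algebraMap ℂ _ c * (basePoint hq).ξ := by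
  refine (dirDeriv_fst_id _).trans ?_
  rfl

theorem d₂_y : d₂ hq c (basePoint hq).y =
    algebraMap ℂ _ c * ((basePoint hq).p * (basePoint hq).ξ) := by
  refine (dirDeriv_snd_id _).trans ?_
  rfl

theorem d₂_p : d₂ hq c (basePoint hq).p = -algebraMap ℂ _ c *
    ((basePoint hq).x * (basePoint hq).p - (basePoint hq).y) ^ 2 := by
  refine (dirDeriv_trd_id _).trans ?_
  exact (mk_eq_mk
    (hh := (contDiffAt_const (c := c)).neg.mul (contDiff_wronskian.contDiffAt.pow 2))).2
    (Eventually.of_forall fun r => by simp [frame₂])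

theorem isVectorField_zero : IsVectorField (0 : Derivation ℂ (SmoothGerm q) (SmoothGerm q)) := by
  have := (isVectorField_dirDeriv (contDiffAt_id (x := q))).nsmul 0
  rwa [zero_smul] at this

theorem isVectorField_d₁ : IsVectorField (d₁ q c) := isVectorField_dirDeriv _

theorem isVectorField_d₂ : IsVectorField (d₂ hq c) := isVectorField_dirDeriv _

theorem d₁_ξ : d₁ q c (basePoint hq).ξ = algebraMap ℂ _ c * (basePoint hq).x := by
  have := congrArg (d₁ q c) (basePoint hq).ξ_mul
  simp only [Derivation.leibniz, smul_eq_mul, map_sub, Derivation.map_one_eq_zero, d₁_x, d₁_y,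
    d₁_p] at this
  generalize basePoint hq = Q at *
  linear_combination Q.ξ * this - (d₁ q c Q.ξ - algebraMap ℂ _ c * Q.x *
    (Q.ξ * (Q.x * Q.p - Q.y) + 1)) * Q.ξ_mul

theorem d₂_ξ : d₂ hq c (basePoint hq).ξ = algebraMap ℂ _ c * (basePoint hq).x := by
  have := congrArg (d₂ hq c) (basePoint hq).ξ_mul
  simp only [Derivation.leibniz, smul_eq_mul, map_sub, Derivation.map_one_eq_zero, d₂_x, d₂_y,
    d₂_p] at this
  generalize basePoint hq = Q at *
  linear_combination Q.ξ * this - (d₂ hq c Q.ξ - algebraMap ℂ _ c * Q.x *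
    (Q.ξ * (Q.x * Q.p - Q.y) + 1)) * Q.ξ_mul

theorem d₁_commute (c c' : ℂ) (hq : wronskian q ≠ 0) : ⁅d₁ q c, d₁ q c'⁆ = 0 := by
  refine ext_basePoint hq ((isVectorField_d₁ c).lie (isVectorField_d₁ c'))
    isVectorField_zero ?_ ?_ ?_
  · simp [Derivation.commutator_apply, d₁_x]
  · simp [Derivation.commutator_apply, d₁_y]
  · simp only [Derivation.commutator_apply, d₁_p, d₁_x, d₁_y, Derivation.leibniz, smul_eq_mul,
      map_neg, pow_two, map_sub, Derivation.map_algebraMap]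
    simp
    ring

theorem d₂_commute (c c' : ℂ) : ⁅d₂ hq c, d₂ hq c'⁆ = 0 := by
  refine ext_basePoint hq ((isVectorField_d₂ hq c).lie (isVectorField_d₂ hq c'))
    isVectorField_zero ?_ ?_ ?_
  · simp only [Derivation.commutator_apply, d₂_x, d₂_ξ, Derivation.leibniz, smul_eq_mul,
      Derivation.map_algebraMap, Derivation.coe_zero, Pi.zero_apply]
    ring
  · simp only [Derivation.commutator_apply, d₂_y, d₂_p, d₂_ξ, Derivation.leibniz, smul_eq_mul,
      Derivation.map_algebraMap, Derivation.coe_zero, Pi.zero_apply]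
    ring
  · simp only [Derivation.commutator_apply, d₂_p, d₂_x, d₂_y, Derivation.leibniz, smul_eq_mul,
      map_neg, pow_two, map_sub, Derivation.map_algebraMap, Derivation.coe_zero, Pi.zero_apply]
    ring

theorem lie_d₁_d₂_x : ⁅d₁ q c, d₂ hq 1⁆ (basePoint hq).x = algebraMap ℂ _ c * (basePoint hq).x := by
  simp only [Derivation.commutator_apply, d₂_x, d₁_x, d₁_ξ, map_one, one_mul, map_zero, sub_zero]

theorem lie_d₁_d₂_y : ⁅d₁ q c, d₂ hq 1⁆ (basePoint hq).y = algebraMap ℂ _ c * (basePoint hq).y := by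
  simp only [Derivation.commutator_apply, d₂_y, d₁_y, d₁_p, d₁_ξ, map_one, one_mul, map_zero,
    sub_zero, Derivation.leibniz, smul_eq_mul]
  generalize basePoint hq = Q
  linear_combination -algebraMap ℂ _ c * (Q.x * Q.p - Q.y) * Q.ξ_mul

theorem lie_d₁_d₂_p : ⁅d₁ q c, d₂ hq 1⁆ (basePoint hq).p = 0 := by
  simp only [Derivation.commutator_apply, d₂_y, d₁_y, d₁_p, d₂_p, d₂_x, d₁_x, map_one, one_mul,
    sub_zero, map_neg, map_sub, Derivation.map_algebraMap, pow_two, Derivation.map_one_eq_zero,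
    Derivation.leibniz, smul_eq_mul]
  ring

/-- The frame formed by `E₁`, `i E₁`, `E₂`, `i E₂`, acting on germs at a point off the
hypersurface. -/
noncomputable def jetFrame : CRFrame (SmoothGerm q) where
  e₁ := d₁ q 1
  f₁ := d₁ q Complex.I
  e₂ := d₂ hq 1
  f₂ := d₂ hq Complex.I
  lie_e₁_f₁ a := by rw [d₁_commute _ _ hq]; rfl
  lie_e₂_f₂ a := by rw [d₂_commute]; rfl
  lie_e₃_e₁ a := by
    have : ⁅⁅d₁ q 1, d₂ hq 1⁆, d₁ q 1⁆ = 2 • d₁ q 1 := by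
      refine ext_basePoint hq
        (((isVectorField_d₁ 1).lie (isVectorField_d₂ hq 1)).lie (isVectorField_d₁ 1))
        ((isVectorField_d₁ 1).nsmul 2) ?_ ?_ ?_
      · rw [Derivation.commutator_apply, Derivation.smul_apply]
        simp [d₁_x, lie_d₁_d₂_x]
      · rw [Derivation.commutator_apply, Derivation.smul_apply]
        simp [d₁_y, lie_d₁_d₂_y]
      · rw [Derivation.commutator_apply, Derivation.smul_apply]
        simp only [d₁_p, lie_d₁_d₂_p, lie_d₁_d₂_x, lie_d₁_d₂_y, map_one, one_mul, neg_mul, map_neg,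
          pow_two, map_sub, Derivation.leibniz, smul_eq_mul, map_zero, nsmul_eq_mul]
        push_cast
        ring
    rw [this, Derivation.smul_apply, nsmul_eq_mul]; rfl
  lie_e₃_e₂ a := by
    have : ⁅⁅d₁ q 1, d₂ hq 1⁆, d₂ hq 1⁆ = 4 • d₁ q 1 - 2 • d₂ hq 1 := by
      refine ext_basePoint hq
        (((isVectorField_d₁ 1).lie (isVectorField_d₂ hq 1)).lie (isVectorField_d₂ hq 1))
        (((isVectorField_d₁ 1).nsmul 4).sub ((isVectorField_d₂ hq 1).nsmul 2)) ?_ ?_ ?_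
      · rw [Derivation.commutator_apply, Derivation.sub_apply, Derivation.smul_apply,
          Derivation.smul_apply, lie_d₁_d₂_x, Derivation.commutator_apply]
        simp only [d₁_x, d₂_x, d₁_ξ, d₂_ξ, map_one, one_mul, nsmul_eq_mul]
        push_cast
        ring
      · rw [Derivation.commutator_apply, Derivation.sub_apply, Derivation.smul_apply,
          Derivation.smul_apply, lie_d₁_d₂_y, d₂_y, map_one, one_mul, Derivation.leibniz,
          lie_d₁_d₂_p, Derivation.commutator_apply]
        simp only [d₁_x, d₁_y, d₂_y, d₁_ξ, d₂_ξ, map_one, one_mul, nsmul_eq_mul, d₂_x, smul_eq_mul]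
        push_cast
        ring
      · rw [Derivation.commutator_apply, Derivation.sub_apply, Derivation.smul_apply,
          Derivation.smul_apply]
        simp only [d₁_p, d₂_p, lie_d₁_d₂_p, lie_d₁_d₂_x, lie_d₁_d₂_y, map_one, one_mul, neg_mul,
          map_neg, pow_two, map_sub, Derivation.leibniz, smul_eq_mul, map_zero, nsmul_eq_mul]
        push_cast
        ring
    rw [this, Derivation.sub_apply, Derivation.smul_apply, Derivation.smul_apply, nsmul_eq_mul,
      nsmul_eq_mul]; rfl

end

end

/-! ### Germs of CR-maps as CR-maps over the algebra of germs -/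

section

open Filter SmoothGerm SecondOrderODE

/-- The field `E₃ = [E₁, E₂] = x ∂/∂x + y ∂/∂y`. -/
noncomputable def frame₃ (r : JetSpace) : JetSpace := (r.1, r.2.1, 0)

theorem contDiff_frame₃ : ContDiff ℝ ∞ frame₃ := by
  unfold frame₃; fun_prop

theorem lie_d₁_d₂ {q : JetSpace} (hq : wronskian q ≠ 0) (c : ℂ) : ⁅d₁ q c, d₂ hq 1⁆ =
    dirDeriv (fun r => c • frame₃ r) (contDiffAt_const_smul c contDiff_frame₃.contDiffAt) := by
  refine ext_basePoint hq ((isVectorField_d₁ c).lie (isVectorField_d₂ hq 1))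
    (isVectorField_dirDeriv _) ?_ ?_ ?_
  · rw [lie_d₁_d₂_x]
    exact (dirDeriv_fst_id (contDiffAt_const_smul c contDiff_frame₃.contDiffAt)).symm
  · rw [lie_d₁_d₂_y]
    exact (dirDeriv_snd_id (contDiffAt_const_smul c contDiff_frame₃.contDiffAt)).symm
  · rw [lie_d₁_d₂_p]
    refine Eq.trans ?_ (dirDeriv_trd_id _).symm
    exact mk_eq_mk (hg := contDiffAt_const) |>.2 (Eventually.of_forall fun r => by simp [frame₃])

theorem map_complex_smul {E F : Type*} [NormedAddCommGroup E] [NormedSpace ℂ E]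
    [NormedAddCommGroup F] [NormedSpace ℂ F] (L : E →L[ℝ] F) (c : ℂ) (v : E) :
    L (c • v) = c.re • L v + c.im • L (Complex.I • v) := by
  rw [← map_smul, ← map_smul, ← map_add]
  congr 1
  conv_lhs => rw [← Complex.re_add_im c]
  rw [add_smul, mul_smul]; simp

theorem real_linear_smul (L : JetSpace →L[ℝ] ℂ) {v : JetSpace} (h : L v = 0)
    (h' : L (Complex.I • v) = 0) (c : ℂ) : L (c • v) = 0 := by
  rw [map_complex_smul, h, h', smul_zero, smul_zero, add_zero]

theorem exists_frame_decomposition {r : JetSpace} (hr : wronskian r ≠ 0) (v : JetSpace) :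
    ∃ a b c : ℂ, v = a • frame₁ r + b • frame₂ r + c • frame₃ r := by
  refine ⟨-(v.2.2 + wronskian r ^ 3 * (v.1 + (v.2.1 - r.2.2 * v.1) / wronskian r * r.1))
    / wronskian r ^ 2,
    wronskian r * (v.1 + (v.2.1 - r.2.2 * v.1) / wronskian r * r.1),
    -(v.2.1 - r.2.2 * v.1) / wronskian r, ?_⟩
  refine Prod.ext ?_ (Prod.ext ?_ ?_)
  · simp only [frame₁, frame₂, frame₃, Prod.smul_mk, Prod.mk_add_mk, smul_eq_mul]
    field_simp
    ring
  · simp only [frame₁, frame₂, frame₃, Prod.smul_mk, Prod.mk_add_mk, smul_eq_mul]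
    field_simp
    simp only [wronskian]
    ring
  · simp only [frame₁, frame₂, frame₃, Prod.smul_mk, Prod.mk_add_mk, smul_eq_mul]
    field_simp
    ring

/-- A germ annihilated by `E₁`, `i E₁`, `E₂`, `i E₂` is also annihilated by the brackets `E₃` and
`i E₃`, hence by all real directions, and is constant. -/
theorem eq_algebraMap_value {q : JetSpace} (hq : wronskian q ≠ 0) {φ : SmoothGerm q}
    (h : (jetFrame hq).IsConstant φ) : φ = algebraMap ℂ _ (value q φ) := by
  obtain ⟨h1, h1', h2, h2'⟩ : d₁ q 1 φ = 0 ∧ d₁ q Complex.I φ = 0 ∧ d₂ hq 1 φ = 0 ∧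
    d₂ hq Complex.I φ = 0 := ⟨h.e₁, h.f₁, h.e₂, h.f₂⟩
  have h3 : ⁅d₁ q 1, d₂ hq 1⁆ φ = 0 := by
    rw [Derivation.commutator_apply, h1, h2, map_zero, map_zero, sub_zero]
  have h3' : ⁅d₁ q Complex.I, d₂ hq 1⁆ φ = 0 := by
    rw [Derivation.commutator_apply, h1', h2, map_zero, map_zero, sub_zero]
  rw [lie_d₁_d₂] at h3 h3'
  obtain ⟨g, hg, rfl⟩ := φ.exists_rep
  refine eq_algebraMap_of_fderiv_eq_zero hg ?_
  rw [d₁, dirDeriv_mk] at h1 h1'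
  rw [d₂, dirDeriv_mk] at h2 h2'
  rw [dirDeriv_mk] at h3 h3'
  filter_upwards [mk_eq_mk (hh := contDiffAt_const) |>.1 h1,
    mk_eq_mk (hh := contDiffAt_const) |>.1 h1',
    mk_eq_mk (hh := contDiffAt_const) |>.1 h2, mk_eq_mk (hh := contDiffAt_const) |>.1 h2',
    mk_eq_mk (hh := contDiffAt_const) |>.1 h3, mk_eq_mk (hh := contDiffAt_const) |>.1 h3',
    contDiff_wronskian.continuous.continuousAt.eventually_ne hq] with r k1 k1' k2 k2' k3 k3' hr
  refine ContinuousLinearMap.ext fun v => ?_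
  obtain ⟨a, b, c, rfl⟩ := exists_frame_decomposition hr v
  rw [one_smul] at k1 k2 k3
  rw [map_add, map_add, real_linear_smul _ k1 k1', real_linear_smul _ k2 k2',
    real_linear_smul _ k3 k3']
  simp

theorem mem_crDist_iff {B : SecondOrderODE} {q v : JetSpace} :
    v ∈ crDist B q ↔ v.2.1 = q.2.2 * v.1 := by
  change v ∈ Submodule.span ℂ {Z₁, Z₂ B q} ↔ _
  rw [Submodule.mem_span_pair]
  constructor
  · rintro ⟨a, b, rfl⟩
    simp [Z₁, Z₂, mul_comm]
  · intro h
    refine ⟨v.2.2 - v.1 * B q.1 q.2.1 q.2.2, v.1, ?_⟩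
    refine Prod.ext ?_ (Prod.ext ?_ ?_) <;> simp [Z₁, Z₂, h, mul_comm]

theorem quarticODE_eq (r : JetSpace) : quarticODE r.1 r.2.1 r.2.2 = -wronskian r ^ 3 := by
  simp only [quarticODE, wronskian]; ring

theorem crJ_fst {q v : JetSpace} : (crJ quarticODE q v).1 = -(Complex.I * v.1) := by
  simp [crJ, Z₁, Z₂]

theorem crJ_trd {q v : JetSpace} : (crJ quarticODE q v).2.2 =
    Complex.I * (v.2.2 + 2 * wronskian q ^ 3 * v.1) := by
  simp only [crJ, Z₁, Z₂, quarticODE_eq]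
  simp
  ring

theorem smul_frame₁_mem (c : ℂ) (r : JetSpace) : c • frame₁ r ∈ crDist quarticODE r := by
  simp [mem_crDist_iff, frame₁]

theorem smul_frame₂_mem (c : ℂ) (r : JetSpace) : c • frame₂ r ∈ crDist quarticODE r := by
  simp [mem_crDist_iff, frame₂]; ring

theorem frame₁_mem (r : JetSpace) : frame₁ r ∈ crDist quarticODE r := by
  simpa using smul_frame₁_mem 1 r

theorem frame₂_mem (r : JetSpace) : frame₂ r ∈ crDist quarticODE r := by
  simpa using smul_frame₂_mem 1 r

theorem crJ_frame₁ (r : JetSpace) : crJ quarticODE r (frame₁ r) = Complex.I • frame₁ r := by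
  simp [crJ, frame₁, Z₁, Z₂]

/-- `J` is multiplication by `-i` on the second eigenline. -/
theorem crJ_I_smul_frame₂ (r : JetSpace) :
    crJ quarticODE r (Complex.I • frame₂ r) = frame₂ r := by
  have h : (wronskian r)⁻¹ * wronskian r ^ 3 = wronskian r ^ 2 := by
    by_cases h : wronskian r = 0
    · simp [h]
    · field_simp
  refine Prod.ext ?_ (Prod.ext ?_ ?_)
  · rw [crJ_fst, Prod.smul_fst, smul_eq_mul, ← mul_assoc, Complex.I_mul_I, neg_one_mul, neg_neg]
  · rw [mem_crDist_iff.1 (crJ_mem _ _ _), crJ_fst, Prod.smul_fst, smul_eq_mul, ← mul_assoc,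
      Complex.I_mul_I, neg_one_mul, neg_neg]
    rfl
  · rw [crJ_trd]
    simp only [frame₂, Prod.smul_mk, smul_eq_mul]
    linear_combination (2 * (wronskian r)⁻¹ * wronskian r ^ 3 - wronskian r ^ 2) * Complex.I_mul_I
      - 2 * h

/-- The differential of `f` at `r` preserves `D` and commutes with `J` on `D`. -/
def IsCRAt (f : JetSpace → JetSpace) (r : JetSpace) : Prop :=
  ∀ v ∈ crDist quarticODE r, fderiv ℝ f r v ∈ crDist quarticODE (f r) ∧
    fderiv ℝ f r (crJ quarticODE r v) = crJ quarticODE (f r) (fderiv ℝ f r v)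

section

variable {q : JetSpace} {f V V' : JetSpace → JetSpace} (hf : ContDiffAt ℝ ∞ f q)
  (hw : wronskian (f q) ≠ 0) (hV : ContDiffAt ℝ ∞ V q) (hV' : ContDiffAt ℝ ∞ V' q)

theorem dirDeriv_mapPoint_x : dirDeriv V hV (mapPoint f hf hw).x =
    fst (fun r => fderiv ℝ f r (V r)) (contDiffAt_fderiv_apply hf hV) := dirDeriv_fst hf hV

theorem dirDeriv_mapPoint_y : dirDeriv V hV (mapPoint f hf hw).y =
    snd (fun r => fderiv ℝ f r (V r)) (contDiffAt_fderiv_apply hf hV) := dirDeriv_snd hf hV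

theorem dirDeriv_mapPoint_p : dirDeriv V hV (mapPoint f hf hw).p =
    trd (fun r => fderiv ℝ f r (V r)) (contDiffAt_fderiv_apply hf hV) := dirDeriv_trd hf hV

theorem dirDeriv_mapPoint_y_eq (h : ∀ᶠ r in 𝓝 q, IsCRAt f r)
    (hD : ∀ r, V r ∈ crDist quarticODE r) :
    dirDeriv V hV (mapPoint f hf hw).y =
      (mapPoint f hf hw).p * dirDeriv V hV (mapPoint f hf hw).x := by
  rw [dirDeriv_mapPoint_x, dirDeriv_mapPoint_y]
  refine Subtype.ext (Germ.coe_eq.2 ?_)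
  filter_upwards [h] with r hr using mem_crDist_iff.1 (hr _ (hD r)).1

theorem dirDeriv_crJ_mapPoint_x (h : ∀ᶠ r in 𝓝 q, IsCRAt f r)
    (hD : ∀ r, V r ∈ crDist quarticODE r) (hJ : ∀ r, crJ quarticODE r (V r) = V' r) :
    dirDeriv V' hV' (mapPoint f hf hw).x =
      -algebraMap ℂ _ Complex.I * dirDeriv V hV (mapPoint f hf hw).x := by
  rw [dirDeriv_mapPoint_x, dirDeriv_mapPoint_x]
  refine Subtype.ext (Germ.coe_eq.2 ?_)
  filter_upwards [h] with r hr
  have := congrArg (fun v : JetSpace => v.1) (hr _ (hD r)).2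
  simp only [hJ, crJ_fst] at this
  simp [this]

theorem dirDeriv_crJ_mapPoint_p (h : ∀ᶠ r in 𝓝 q, IsCRAt f r)
    (hD : ∀ r, V r ∈ crDist quarticODE r) (hJ : ∀ r, crJ quarticODE r (V r) = V' r) :
    dirDeriv V' hV' (mapPoint f hf hw).p =
      algebraMap ℂ _ Complex.I * (dirDeriv V hV (mapPoint f hf hw).p +
        2 * ((mapPoint f hf hw).x * (mapPoint f hf hw).p - (mapPoint f hf hw).y) ^ 3 *
          dirDeriv V hV (mapPoint f hf hw).x) := by
  rw [dirDeriv_mapPoint_x, dirDeriv_mapPoint_p, dirDeriv_mapPoint_p]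
  refine Subtype.ext (Germ.coe_eq.2 ?_)
  filter_upwards [h] with r hr
  have := congrArg (fun v : JetSpace => v.2.2) (hr _ (hD r)).2
  simp only [hJ, crJ_trd] at this
  exact this

theorem isCRMap_mapPoint (hq : wronskian q ≠ 0) (h : ∀ᶠ r in 𝓝 q, IsCRAt f r) :
    (jetFrame hq).IsCRMap (mapPoint f hf hw) where
  e₁_y := dirDeriv_mapPoint_y_eq hf hw _ h (smul_frame₁_mem _)
  f₁_y := dirDeriv_mapPoint_y_eq hf hw _ h (smul_frame₁_mem _)
  e₂_y := dirDeriv_mapPoint_y_eq hf hw _ h (smul_frame₂_mem _)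
  f₂_y := dirDeriv_mapPoint_y_eq hf hw _ h (smul_frame₂_mem _)
  f₁_x := dirDeriv_crJ_mapPoint_x hf hw _ _ h (smul_frame₁_mem _)
    fun r => by rw [one_smul, crJ_frame₁]
  f₁_p := dirDeriv_crJ_mapPoint_p hf hw _ _ h (smul_frame₁_mem _)
    fun r => by rw [one_smul, crJ_frame₁]
  f₂_x := by
    have : (jetFrame hq).e₂ (mapPoint f hf hw).x =
      -algebraMap ℂ _ Complex.I * (jetFrame hq).f₂ (mapPoint f hf hw).x :=
      dirDeriv_crJ_mapPoint_x hf hw _ _ h (smul_frame₂_mem _)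
        fun r => by rw [one_smul, crJ_I_smul_frame₂]
    rw [this]
    linear_combination (jetFrame hq).f₂ (mapPoint f hf hw).x *
      CRFrame.algebraMap_I_mul_self (A := SmoothGerm q)
  f₂_p := by
    have h1 : (jetFrame hq).e₂ (mapPoint f hf hw).x =
      -algebraMap ℂ _ Complex.I * (jetFrame hq).f₂ (mapPoint f hf hw).x :=
      dirDeriv_crJ_mapPoint_x hf hw _ _ h (smul_frame₂_mem _)
        fun r => by rw [one_smul, crJ_I_smul_frame₂]
    have h2 : (jetFrame hq).e₂ (mapPoint f hf hw).p =
      algebraMap ℂ _ Complex.I * ((jetFrame hq).f₂ (mapPoint f hf hw).p +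
        2 * ((mapPoint f hf hw).x * (mapPoint f hf hw).p - (mapPoint f hf hw).y) ^ 3 *
          (jetFrame hq).f₂ (mapPoint f hf hw).x) :=
      dirDeriv_crJ_mapPoint_p hf hw _ _ h (smul_frame₂_mem _)
        fun r => by rw [one_smul, crJ_I_smul_frame₂]
    rw [h1, h2]
    linear_combination (jetFrame hq).f₂ (mapPoint f hf hw).p *
      CRFrame.algebraMap_I_mul_self (A := SmoothGerm q)

theorem isCRMap_basePoint (hq : wronskian q ≠ 0) : (jetFrame hq).IsCRMap (basePoint hq) :=
  isCRMap_mapPoint _ _ hq (Eventually.of_forall fun r v hv => by simpa [fderiv_id] using hv)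

theorem isAdapted_basePoint (hq : wronskian q ≠ 0) :
    (jetFrame hq).IsAdapted (basePoint hq) := by
  set Q := basePoint hq
  have h1 : (jetFrame hq).e₁ Q.x = 0 := d₁_x hq 1
  have h2 : (jetFrame hq).e₁ Q.p = _ := d₁_p hq 1
  have h3 : (jetFrame hq).e₂ Q.x = _ := d₂_x hq 1
  have h4 : (jetFrame hq).e₂ Q.p = _ := d₂_p hq 1
  rw [map_one] at h2 h3 h4
  refine ⟨?_, ?_, ?_, ?_⟩
  · rw [LinePoint.vert, h1, h2]
    linear_combination (Q.ξ * (Q.x * Q.p - Q.y) + 1) * Q.ξ_mul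
  · rw [LinePoint.horiz, h1, mul_zero]
  · rw [LinePoint.vert, h3, h4]
    linear_combination (Q.ξ * (Q.x * Q.p - Q.y)) * Q.ξ_mul
  · rw [LinePoint.horiz, h3]
    linear_combination Q.ξ_mul

end

end

/-! ### Germs of CR-automorphisms preserve the two eigenlines -/

section

open Filter SmoothGerm SecondOrderODE

/-- A real linear map that is complex linear on the line of `e₁`, conjugate linear on the line of
`e₂`, and maps both into the same complex line is not injective. -/
theorem not_injective_of_linear_of_antilinear {E F : Type*} [NormedAddCommGroup E] [NormedSpace ℂ E]
    [NormedAddCommGroup F] [NormedSpace ℂ F] {L : E →L[ℝ] F}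
    (hL : Function.Injective L)
    {e₁ e₂ : E} (h₁ : e₁ ≠ 0) (he : ∀ c d : ℂ, c • e₁ = d • e₂ → c = 0 ∧ d = 0) {n : F} {t₁ t₂ : ℂ}
    (k₁ : L e₁ = t₁ • n) (k₁' : L (Complex.I • e₁) = (Complex.I * t₁) • n)
    (k₂ : L e₂ = t₂ • n) (k₂' : L (Complex.I • e₂) = -((Complex.I * t₂) • n)) : False := by
  -- `L (t₂ e₁) = t₁ t₂ n`, and `L (c e₂) = conj c * t₂ n` equals it for `c = conj t₁`
  have h : L (t₂ • e₁) = L ((starRingEnd ℂ) t₁ • e₂) := by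
    rw [map_complex_smul L t₂, map_complex_smul L ((starRingEnd ℂ) t₁), k₁, k₁', k₂, k₂',
      ← Complex.coe_smul, ← Complex.coe_smul, ← Complex.coe_smul, ← Complex.coe_smul, smul_smul,
      smul_smul, ← add_smul, smul_neg, smul_smul,
      smul_smul, ← sub_eq_add_neg, ← sub_smul]
    congr 1
    refine Complex.ext ?_ ?_ <;> simp <;> ring
  obtain ⟨-, ht⟩ := he _ _ (hL h)
  rw [map_eq_zero] at ht
  refine h₁ (hL ?_)
  rw [k₁, ht, zero_smul, map_zero]

theorem frame₁_ne_zero {q : JetSpace} (hq : wronskian q ≠ 0) : frame₁ q ≠ 0 := fun h => by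
  have := congrArg (fun v : JetSpace => v.2.2) h
  simp [frame₁, hq] at this

theorem frame₂_ne_zero {q : JetSpace} (hq : wronskian q ≠ 0) : frame₂ q ≠ 0 := fun h => by
  have := congrArg (fun v : JetSpace => v.1) h
  simp [frame₂, hq] at this

theorem frame_independent {q : JetSpace} (hq : wronskian q ≠ 0) (c d : ℂ)
    (h : c • frame₁ q = d • frame₂ q) : c = 0 ∧ d = 0 := by
  have h1 := congrArg (fun v : JetSpace => v.1) h
  have h2 := congrArg (fun v : JetSpace => v.2.2) h
  simp [frame₁, frame₂, hq] at h1 h2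
  exact ⟨by simpa [h1, hq] using h2, h1⟩

/-- The properties of the germ at `q` of a local CR-automorphism of the quartic that determine its
form. -/
structure IsCRGerm (f : JetSpace → JetSpace) (q : JetSpace) : Prop where
  contDiffAt : ContDiffAt ℝ ∞ f q
  isCRAt : ∀ᶠ r in 𝓝 q, IsCRAt f r
  injective : Function.Injective (fderiv ℝ f q)

theorem isCRGerm_of_mem_isotropy {q : JetSpace} {f : OpenPartialHomeomorph JetSpace JetSpace}
    (hf : f ∈ quarticODE.isotropy q) : IsCRGerm f q := by
  obtain ⟨h, hqs, hfq⟩ := hf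
  have hs := f.open_source.mem_nhds hqs
  have h1 : ContDiffAt ℝ ∞ f q := h.smooth.contDiffAt hs
  have h2 : ContDiffAt ℝ ∞ f.symm (f q) :=
    h.smooth_symm.contDiffAt (f.open_target.mem_nhds (f.map_source hqs))
  refine ⟨h1, ?_, ?_⟩
  · filter_upwards [hs] with r hr v hv using ⟨h.map_dist r hr v hv, h.map_J r hr v hv⟩
  · have h3 : HasFDerivAt (f.symm ∘ f) ((fderiv ℝ f.symm (f q)).comp (fderiv ℝ f q)) q :=
      (h2.differentiableAt (by simp)).hasFDerivAt.comp q
        (h1.differentiableAt (by simp)).hasFDerivAt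
    have h4 : HasFDerivAt (f.symm ∘ f) (ContinuousLinearMap.id ℝ JetSpace) q :=
      (hasFDerivAt_id q).congr_of_eventuallyEq (f.eventually_left_inverse hqs)
    have h5 := h3.unique h4
    intro u v huv
    have h6 := congrArg (fderiv ℝ f.symm (f q)) huv
    have h7 := fun w => congrArg (fun T : JetSpace →L[ℝ] JetSpace => T w) h5
    simp only [ContinuousLinearMap.comp_apply, ContinuousLinearMap.id_apply] at h7
    rwa [h7, h7] at h6

theorem eq_smul_Z₁ {B : SecondOrderODE} {q v : JetSpace} (hv : v ∈ crDist B q) (h : v.1 = 0) :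
    v = v.2.2 • Z₁ ∧ crJ B q v = (Complex.I * v.2.2) • Z₁ := by
  refine ⟨Prod.ext (by simp [h, Z₁]) (Prod.ext ?_ (by simp [Z₁])), by simp [crJ, h]⟩
  rw [mem_crDist_iff.1 hv, h]; simp [Z₁]

theorem eq_smul_Z₂ {B : SecondOrderODE} {q v : JetSpace} (hv : v ∈ crDist B q)
    (h : v.2.2 = v.1 * B q.1 q.2.1 q.2.2) :
    v = v.1 • Z₂ B q ∧ crJ B q v = -((Complex.I * v.1) • Z₂ B q) := by
  refine ⟨Prod.ext (by simp [Z₂]) (Prod.ext ?_ (by simp [Z₂, h])), by simp [crJ, h]⟩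
  rw [mem_crDist_iff.1 hv]; simp [Z₂, mul_comm]

theorem value_vert_horiz {q : JetSpace} {f : JetSpace → JetSpace} (h : IsCRGerm f q)
    (hfq : f q = q) (hw : wronskian (f q) ≠ 0) {V : JetSpace → JetSpace}
    (hV : ContDiffAt ℝ ∞ V q) :
    value q ((mapPoint f h.contDiffAt hw).vert (dirDeriv V hV)) =
      -(wronskian q)⁻¹ ^ 2 * (fderiv ℝ f q (V q)).2.2 - wronskian q * (fderiv ℝ f q (V q)).1 ∧
    value q ((mapPoint f h.contDiffAt hw).horiz (dirDeriv V hV)) =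
      wronskian q * (fderiv ℝ f q (V q)).1 := by
  rw [LinePoint.vert, LinePoint.horiz, dirDeriv_mapPoint_x, dirDeriv_mapPoint_p]
  simp only [map_sub, map_mul, map_neg, map_pow]
  simp [mapPoint, fst, snd, trd, hfq, wronskian]

/-- The germ of a CR-automorphism fixing `q` preserves the two eigenlines, and its multipliers do
not vanish. By the Levi form each of `E₁`, `E₂` is mapped into an eigenline; injectivity of the
differential excludes that both are mapped into the same one, and `CRFrame.IsCRMap.not_swap`
excludes a swap. -/
theorem isUnit_vert_e₁_and_horiz_e₂ {q : JetSpace} (hq : wronskian q ≠ 0)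
    {f : JetSpace → JetSpace} (h : IsCRGerm f q) (hfq : f q = q) (hw : wronskian (f q) ≠ 0) :
    IsUnit ((mapPoint f h.contDiffAt hw).vert (jetFrame hq).e₁) ∧
    IsUnit ((mapPoint f h.contDiffAt hw).horiz (jetFrame hq).e₂) := by
  have hP := isCRMap_mapPoint h.contDiffAt hw hq h.isCRAt
  have m1 := congrArg (value q) hP.vert_mul_horiz_e₁
  have m2 := congrArg (value q) hP.vert_mul_horiz_e₂
  rw [map_mul, map_zero, mul_eq_zero] at m1 m2
  obtain ⟨u1, u2⟩ : value q ((mapPoint f h.contDiffAt hw).vert (jetFrame hq).e₁) = _ ∧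
      value q ((mapPoint f h.contDiffAt hw).horiz (jetFrame hq).e₁) = _ :=
    value_vert_horiz h hfq hw _
  obtain ⟨u3, u4⟩ : value q ((mapPoint f h.contDiffAt hw).vert (jetFrame hq).e₂) = _ ∧
      value q ((mapPoint f h.contDiffAt hw).horiz (jetFrame hq).e₂) = _ :=
    value_vert_horiz h hfq hw _
  rw [one_smul] at u1 u2 u3 u4
  obtain ⟨D1, J1⟩ := h.isCRAt.self_of_nhds _ (frame₁_mem q)
  obtain ⟨D2, J2⟩ := h.isCRAt.self_of_nhds _ (smul_frame₂_mem Complex.I q)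
  have D2' := (h.isCRAt.self_of_nhds _ (frame₂_mem q)).1
  rw [crJ_frame₁] at J1
  rw [crJ_I_smul_frame₂] at J2
  rw [hfq] at D1 J1 D2 J2 D2'
  replace J2 : fderiv ℝ f q (Complex.I • frame₂ q) =
      -crJ quarticODE q (fderiv ℝ f q (frame₂ q)) := by
    rw [J2, crJ_crJ _ _ _ D2, neg_neg]
  -- the coefficient of `E₁` vanishes exactly on the second eigenline
  have hvert : ∀ v : JetSpace, -(wronskian q)⁻¹ ^ 2 * v.2.2 - wronskian q * v.1 = 0 →
      v.2.2 = v.1 * quarticODE q.1 q.2.1 q.2.2 := by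
    intro v hv
    rw [quarticODE_eq]
    field_simp at hv
    linear_combination -hv
  -- the images of both frame fields cannot lie in one and the same eigenline
  have hno1 : (fderiv ℝ f q (frame₁ q)).1 = 0 → (fderiv ℝ f q (frame₂ q)).1 = 0 → False := by
    intro k1 k2
    obtain ⟨r1, r1'⟩ := eq_smul_Z₁ D1 k1
    obtain ⟨r2, r2'⟩ := eq_smul_Z₁ D2' k2
    exact not_injective_of_linear_of_antilinear h.injective (frame₁_ne_zero hq) (frame_independent
        hq) r1 (J1.trans r1')
      r2 (J2.trans (congrArg _ r2'))
  have hno2 : (fderiv ℝ f q (frame₁ q)).2.2 =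
        (fderiv ℝ f q (frame₁ q)).1 * quarticODE q.1 q.2.1 q.2.2 →
      (fderiv ℝ f q (frame₂ q)).2.2 =
        (fderiv ℝ f q (frame₂ q)).1 * quarticODE q.1 q.2.1 q.2.2 → False := by
    intro k1 k2
    obtain ⟨r1, r1'⟩ := eq_smul_Z₂ D1 k1
    obtain ⟨r2, r2'⟩ := eq_smul_Z₂ D2' k2
    rw [r2', neg_neg] at J2
    exact not_injective_of_linear_of_antilinear h.injective (frame₂_ne_zero hq)
      (fun c d hcd => (frame_independent hq d c hcd.symm).symm) r2 J2 r1 (J1.trans r1')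
  rw [u1, u2] at m1
  rw [u3, u4] at m2
  by_cases b1 : wronskian q * (fderiv ℝ f q (frame₁ q)).1 = 0
  · have c1 := (mul_eq_zero.1 b1).resolve_left hq
    have b2 : wronskian q * (fderiv ℝ f q (frame₂ q)).1 ≠ 0 := fun b2 =>
      hno1 c1 ((mul_eq_zero.1 b2).resolve_left hq)
    have a2 := hvert _ (m2.resolve_right b2)
    refine ⟨isUnit_of_value_ne_zero (u1 ▸ fun a1 => hno2 (hvert _ a1) a2),
      isUnit_of_value_ne_zero (u4 ▸ b2)⟩
  · have a1 := m1.resolve_right b1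
    refine (hP.not_swap (isUnit_of_value_ne_zero (u2 ▸ b1))
      (isUnit_of_value_ne_zero (u3 ▸ fun a2 => hno2 (hvert _ a1) (hvert _ a2)))).elim

end

/-! ### Germs of CR-automorphisms are induced by linear maps of the plane -/

section

open Filter SmoothGerm SecondOrderODE

/-- The action on line elements of the linear map of the plane with rows `(α, β)` and `(γ, δ)`,
meaningful where `α + β p ≠ 0`. -/
noncomputable def linAction (α β γ δ : ℂ) (r : JetSpace) : JetSpace :=
  (α * r.1 + β * r.2.1, γ * r.1 + δ * r.2.1, (γ + δ * r.2.2) / (α + β * r.2.2))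

/-- The action of the linear map that fixes the point `(x, y)` of `q` and multiplies the direction
`(1, p)` of `q` by `c`; it is written as the product of a matrix and the inverse of the unimodular
matrix of `q`. -/
noncomputable def isotropyMap (q : JetSpace) (c : ℂ) : JetSpace → JetSpace :=
  linAction (q.1 * (q.2.2 * (wronskian q)⁻¹) - c * (wronskian q)⁻¹ * q.2.1)
    (c * (wronskian q)⁻¹ * q.1 - q.1 * (wronskian q)⁻¹)
    (q.2.1 * (q.2.2 * (wronskian q)⁻¹) - c * (q.2.2 * (wronskian q)⁻¹) * q.2.1)
    (c * (q.2.2 * (wronskian q)⁻¹) * q.1 - q.2.1 * (wronskian q)⁻¹)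

theorem isotropyMap_denom {q : JetSpace} (hq : wronskian q ≠ 0) (c : ℂ) :
    (q.1 * (q.2.2 * (wronskian q)⁻¹) - c * (wronskian q)⁻¹ * q.2.1) +
    (c * (wronskian q)⁻¹ * q.1 - q.1 * (wronskian q)⁻¹) * q.2.2 = c := by
  have h : (wronskian q)⁻¹ * (q.1 * q.2.2 - q.2.1) = 1 := inv_mul_cancel₀ hq
  linear_combination c * h

/-- The germ of a CR-automorphism fixing a point off the hypersurface is the action of the linear
map that fixes the point `(x, y)` of `q` and multiplies its direction by `1` or `-1`. -/
theorem eventuallyEq_isotropyMap {q : JetSpace} (hq : wronskian q ≠ 0) {f : JetSpace → JetSpace}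
    (h : IsCRGerm f q) (hfq : f q = q) :
    ∃ c : ℂ, (c = 1 ∨ c = -1) ∧ f =ᶠ[𝓝 q] isotropyMap q c := by
  have hw : wronskian (f q) ≠ 0 := by rwa [hfq]
  have hP := isCRMap_mapPoint h.contDiffAt hw hq h.isCRAt
  have hQ := isCRMap_basePoint hq
  obtain ⟨hu1, hu2⟩ := isUnit_vert_e₁_and_horiz_e₂ hq h hfq hw
  set P := mapPoint f h.contDiffAt hw with hPdef
  set Q := basePoint hq with hQdef
  obtain ⟨m, -, hmm, kA, kB, kC, kD⟩ :=
    hP.isConstant_pairing hQ (isAdapted_basePoint hq) hu1 hu2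
  obtain ⟨r1, r2, r3⟩ := LinePoint.recover (eq_algebraMap_value hq kA) (eq_algebraMap_value hq kB)
    (eq_algebraMap_value hq kC) (eq_algebraMap_value hq kD)
  have hPx : value q P.x = q.1 := congrArg (fun v : JetSpace => v.1) hfq
  have hPy : value q P.y = q.2.1 := congrArg (fun v : JetSpace => v.2.1) hfq
  have hPξ : value q P.ξ = (wronskian q)⁻¹ := congrArg (fun v => (wronskian v)⁻¹) hfq
  have hPη : value q P.η = q.2.2 * (wronskian q)⁻¹ :=
    congrArg (fun v : JetSpace => v.2.2 * (wronskian v)⁻¹) hfq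
  have hQx : value q Q.x = q.1 := rfl
  have hQy : value q Q.y = q.2.1 := rfl
  have hQξ : value q Q.ξ = (wronskian q)⁻¹ := rfl
  have hQη : value q Q.η = q.2.2 * (wronskian q)⁻¹ := rfl
  simp only [map_sub, map_mul, hPx, hPy, hPξ, hPη, hQx, hQy, hQξ, hQη] at r1 r2 r3
  have hc : value q m = 1 ∨ value q m = -1 := by
    have := congrArg (value q) hmm
    rw [map_mul, map_one] at this
    exact mul_self_eq_one_iff.1 this
  refine ⟨value q m, hc, ?_⟩
  have hc0 : value q m ≠ 0 := by rcases hc with hc | hc <;> rw [hc] <;> norm_num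
  have hden := isotropyMap_denom hq (value q m)
  rw [isotropyMap]
  have hden' : ∀ᶠ r : JetSpace in 𝓝 q,
      (q.1 * (q.2.2 * (wronskian q)⁻¹) - value q m * (wronskian q)⁻¹ * q.2.1) +
      (value q m * (wronskian q)⁻¹ * q.1 - q.1 * (wronskian q)⁻¹) * r.2.2 ≠ 0 :=
    ContinuousAt.eventually_ne (by fun_prop) (by rw [hden]; exact hc0)
  filter_upwards [Germ.coe_eq.1 (congrArg Subtype.val r1), Germ.coe_eq.1 (congrArg Subtype.val r2),
    Germ.coe_eq.1 (congrArg Subtype.val r3), hden'] with r s1 s2 s3 hr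
  refine Prod.ext s1 (Prod.ext s2 ?_)
  exact (eq_div_iff hr).2 s3

end

/-! ### Infinitesimal rigidity by means of dual numbers -/

namespace CRFrame

section Dual
open TrivSqZeroExt

variable {A : Type*} [CommRing A] [Algebra ℂ A]

/-- The coefficientwise extension of a derivation to the dual numbers. -/
def dualDerivation (D : Derivation ℂ A A) : Derivation ℂ (DualNumber A) (DualNumber A) :=
  Derivation.mk'
    { toFun := fun a => inl (D a.fst) + inr (D a.snd)
      map_add' := fun a b => by ext <;> simp
      map_smul' := fun c a => by ext <;> simp }
    (fun a b => by
      ext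
      · simp
      · simp; ring)

@[simp] theorem fst_dualDerivation (D : Derivation ℂ A A) (a : DualNumber A) :
    (dualDerivation D a).fst = D a.fst := by simp [dualDerivation]

@[simp] theorem snd_dualDerivation (D : Derivation ℂ A A) (a : DualNumber A) :
    (dualDerivation D a).snd = D a.snd := by simp [dualDerivation]

theorem lie_dualDerivation (D D' : Derivation ℂ A A) :
    ⁅dualDerivation D, dualDerivation D'⁆ = dualDerivation ⁅D, D'⁆ := by
  ext a <;> simp [Derivation.commutator_apply]

/-- The frame acting coefficientwise on the dual numbers. -/
def dual (F : CRFrame A) : CRFrame (DualNumber A) where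
  e₁ := dualDerivation F.e₁
  f₁ := dualDerivation F.f₁
  e₂ := dualDerivation F.e₂
  f₂ := dualDerivation F.f₂
  lie_e₁_f₁ a := by
    rw [lie_dualDerivation]
    ext <;> simp [F.lie_e₁_f₁]
  lie_e₂_f₂ a := by
    rw [lie_dualDerivation]
    ext <;> simp [F.lie_e₂_f₂]
  lie_e₃_e₁ a := by
    rw [lie_dualDerivation, lie_dualDerivation]
    ext
    · rw [fst_dualDerivation, F.lie_e₃_e₁]; simp [two_mul]
    · rw [snd_dualDerivation, F.lie_e₃_e₁]; simp [two_mul]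
  lie_e₃_e₂ a := by
    have h4 (b : DualNumber A) : 4 * b = 2 * b + 2 * b := by ring
    rw [lie_dualDerivation, lie_dualDerivation]
    ext
    · rw [fst_dualDerivation, F.lie_e₃_e₂, h4]; simp [two_mul]; ring
    · rw [snd_dualDerivation, F.lie_e₃_e₂, h4]; simp [two_mul]; ring

/-- The infinitesimal deformation `Q + ε δ Q`. -/
def _root_.LinePoint.deform (Q : LinePoint A) (δ : Derivation ℂ A A) : LinePoint (DualNumber A)
    where
  x := inl Q.x + inr (δ Q.x)
  y := inl Q.y + inr (δ Q.y)
  p := inl Q.p + inr (δ Q.p)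
  ξ := inl Q.ξ + inr (δ Q.ξ)
  ξ_mul := by
    have := congrArg δ Q.ξ_mul
    simp only [Derivation.leibniz, smul_eq_mul, map_sub, Derivation.map_one_eq_zero] at this
    ext
    · simpa using Q.ξ_mul
    · simp
      linear_combination this

/-- The derivation `δ` is an infinitesimal CR-automorphism, where `Q` is the identity map: for the
derivations of the frame the brackets with `δ` lie in the distribution, and bracketing with `δ`
commutes with `J`. The conditions are those of `IsCRMap`, with the bracket in place of the
derivation. -/
structure IsInfinitesimal (F : CRFrame A) (Q : LinePoint A) (δ : Derivation ℂ A A) : Prop where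
  e₁_y : ⁅δ, F.e₁⁆ Q.y = Q.p * ⁅δ, F.e₁⁆ Q.x
  f₁_y : ⁅δ, F.f₁⁆ Q.y = Q.p * ⁅δ, F.f₁⁆ Q.x
  e₂_y : ⁅δ, F.e₂⁆ Q.y = Q.p * ⁅δ, F.e₂⁆ Q.x
  f₂_y : ⁅δ, F.f₂⁆ Q.y = Q.p * ⁅δ, F.f₂⁆ Q.x
  f₁_x : ⁅δ, F.f₁⁆ Q.x = -algebraMap ℂ A Complex.I * ⁅δ, F.e₁⁆ Q.x
  f₁_p : ⁅δ, F.f₁⁆ Q.p =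
    algebraMap ℂ A Complex.I * (⁅δ, F.e₁⁆ Q.p + 2 * (Q.x * Q.p - Q.y) ^ 3 * ⁅δ, F.e₁⁆ Q.x)
  f₂_x : ⁅δ, F.f₂⁆ Q.x = algebraMap ℂ A Complex.I * ⁅δ, F.e₂⁆ Q.x
  f₂_p : ⁅δ, F.f₂⁆ Q.p =
    -algebraMap ℂ A Complex.I * (⁅δ, F.e₂⁆ Q.p + 2 * (Q.x * Q.p - Q.y) ^ 3 * ⁅δ, F.e₂⁆ Q.x)

theorem deform_y_eq {Q : LinePoint A} {δ D : Derivation ℂ A A} (hQ : D Q.y = Q.p * D Q.x)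
    (h : ⁅δ, D⁆ Q.y = Q.p * ⁅δ, D⁆ Q.x) :
    dualDerivation D (Q.deform δ).y = (Q.deform δ).p * dualDerivation D (Q.deform δ).x := by
  have := congrArg δ hQ
  simp only [Derivation.leibniz, smul_eq_mul] at this
  simp only [Derivation.commutator_apply] at h
  ext
  · simpa [LinePoint.deform] using hQ
  · simp [LinePoint.deform]
    linear_combination this - h

theorem deform_x_eq {Q : LinePoint A} {δ D D' : Derivation ℂ A A} {c : ℂ}
    (hQ : D' Q.x = algebraMap ℂ A c * D Q.x)
    (h : ⁅δ, D'⁆ Q.x = algebraMap ℂ A c * ⁅δ, D⁆ Q.x) :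
    dualDerivation D' (Q.deform δ).x =
      algebraMap ℂ (DualNumber A) c * dualDerivation D (Q.deform δ).x := by
  have := congrArg δ hQ
  simp only [Derivation.leibniz, smul_eq_mul, Derivation.map_algebraMap] at this
  simp only [Derivation.commutator_apply] at h
  ext
  · simpa [LinePoint.deform, algebraMap_eq_inl'] using hQ
  · simp [LinePoint.deform, algebraMap_eq_inl']
    linear_combination this - h

theorem deform_p_eq {Q : LinePoint A} {δ D D' : Derivation ℂ A A} {c : ℂ}
    (hQ : D' Q.p = algebraMap ℂ A c * (D Q.p + 2 * (Q.x * Q.p - Q.y) ^ 3 * D Q.x))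
    (h : ⁅δ, D'⁆ Q.p =
      algebraMap ℂ A c * (⁅δ, D⁆ Q.p + 2 * (Q.x * Q.p - Q.y) ^ 3 * ⁅δ, D⁆ Q.x)) :
    dualDerivation D' (Q.deform δ).p =
      algebraMap ℂ (DualNumber A) c * (dualDerivation D (Q.deform δ).p +
        2 * ((Q.deform δ).x * (Q.deform δ).p - (Q.deform δ).y) ^ 3 *
          dualDerivation D (Q.deform δ).x) := by
  have := congrArg δ hQ
  have h2 : (2 : DualNumber A) = 1 + 1 := by norm_num
  simp only [Derivation.leibniz, smul_eq_mul, Derivation.map_algebraMap, map_add, map_sub,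
    derivation_two, pow_succ, pow_zero, one_mul] at this
  simp only [Derivation.commutator_apply] at h
  ext
  · simp [LinePoint.deform, algebraMap_eq_inl', h2]
    linear_combination hQ
  · simp [LinePoint.deform, algebraMap_eq_inl', h2, pow_succ]
    linear_combination this - h

theorem IsCRMap.deform {F : CRFrame A} {Q : LinePoint A} {δ : Derivation ℂ A A}
    (hQ : F.IsCRMap Q) (h : F.IsInfinitesimal Q δ) : F.dual.IsCRMap (Q.deform δ) where
  e₁_y := deform_y_eq hQ.e₁_y h.e₁_y
  f₁_y := deform_y_eq hQ.f₁_y h.f₁_y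
  e₂_y := deform_y_eq hQ.e₂_y h.e₂_y
  f₂_y := deform_y_eq hQ.f₂_y h.f₂_y
  f₁_x := by
    rw [← map_neg]
    exact deform_x_eq (by rw [map_neg, hQ.f₁_x]) (by rw [map_neg, h.f₁_x])
  f₁_p := deform_p_eq hQ.f₁_p h.f₁_p
  f₂_x := deform_x_eq hQ.f₂_x h.f₂_x
  f₂_p := by
    rw [← map_neg]
    exact deform_p_eq (by rw [map_neg, hQ.f₂_p]) (by rw [map_neg, h.f₂_p])

theorem isInfinitesimal_zero (F : CRFrame A) (Q : LinePoint A) : F.IsInfinitesimal Q 0 := by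
  constructor <;> simp

theorem fst_vert_deform (Q : LinePoint A) (δ D : Derivation ℂ A A) :
    ((Q.deform δ).vert (dualDerivation D)).fst = Q.vert D := by
  simp [LinePoint.vert, LinePoint.deform]

theorem fst_horiz_deform (Q : LinePoint A) (δ D : Derivation ℂ A A) :
    ((Q.deform δ).horiz (dualDerivation D)).fst = Q.horiz D := by
  simp [LinePoint.horiz, LinePoint.deform]

theorem IsAdapted.deform_zero {F : CRFrame A} {Q : LinePoint A} (h : F.IsAdapted Q) :
    F.dual.IsAdapted (Q.deform 0) := by
  refine ⟨?_, ?_, ?_, ?_⟩ <;> ext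
  · exact (fst_vert_deform _ _ _).trans h.vert_e₁
  · simp [LinePoint.vert, LinePoint.deform, dual, pow_two]
  · exact (fst_horiz_deform _ _ _).trans h.horiz_e₁
  · simp [LinePoint.horiz, LinePoint.deform, dual]
  · exact (fst_vert_deform _ _ _).trans h.vert_e₂
  · simp [LinePoint.vert, LinePoint.deform, dual, pow_two]
  · exact (fst_horiz_deform _ _ _).trans h.horiz_e₂
  · simp [LinePoint.horiz, LinePoint.deform, dual]

theorem IsConstant.snd {F : CRFrame A} {a : DualNumber A} (h : F.dual.IsConstant a) :
    F.IsConstant a.snd where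
  e₁ := by simpa [dual] using congrArg TrivSqZeroExt.snd h.e₁
  f₁ := by simpa [dual] using congrArg TrivSqZeroExt.snd h.f₁
  e₂ := by simpa [dual] using congrArg TrivSqZeroExt.snd h.e₂
  f₂ := by simpa [dual] using congrArg TrivSqZeroExt.snd h.f₂

/-- An infinitesimal CR-automorphism `δ` vanishes if its coefficients lie in an ideal `N` that
contains no constants except `0` (for germs, the ideal of germs vanishing at the point): the
deformation `Q + ε δ Q` is a CR-map over the dual numbers, so it differs from `Q` by a constant
matrix `1 + ε C`, and the entries of `C` are constants in `N`. -/
theorem IsInfinitesimal.eq_zero {F : CRFrame A} {Q : LinePoint A} {δ : Derivation ℂ A A}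
    (hQ : F.IsCRMap Q) (hA : F.IsAdapted Q) (h : F.IsInfinitesimal Q δ)
    {N : Ideal A} (hx : δ Q.x ∈ N) (hy : δ Q.y ∈ N) (hp : δ Q.p ∈ N)
    (hN : ∀ a ∈ N, F.IsConstant a → a = 0) : δ Q.x = 0 ∧ δ Q.y = 0 ∧ δ Q.p = 0 := by
  have hξ : δ Q.ξ ∈ N := by
    have e := congrArg δ Q.ξ_mul
    simp only [Derivation.leibniz, smul_eq_mul, map_sub, Derivation.map_one_eq_zero] at e
    have : δ Q.ξ = -Q.ξ ^ 2 * (Q.x * δ Q.p + Q.p * δ Q.x - δ Q.y) := by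
      linear_combination Q.ξ * e - δ Q.ξ * Q.ξ_mul
    rw [this]
    exact N.mul_mem_left _ (N.sub_mem (N.add_mem (N.mul_mem_left _ hp) (N.mul_mem_left _ hx)) hy)
  have hη : δ Q.η ∈ N := by
    rw [LinePoint.η, Derivation.leibniz]
    exact N.add_mem (N.mul_mem_left _ hξ) (N.mul_mem_left _ hp)
  obtain ⟨m, hm, hmm, kA, kB, kC, kD⟩ := (hQ.deform h).isConstant_pairing
    (hQ.deform (isInfinitesimal_zero F Q)) hA.deform_zero
    (isUnit_iff_isUnit_fst.2 (by rw [dual, fst_vert_deform, hA.vert_e₁]; exact isUnit_one))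
    (isUnit_iff_isUnit_fst.2 (by rw [dual, fst_horiz_deform, hA.horiz_e₂]; exact isUnit_one))
  -- `m` is `1` modulo `ε`, and its square is `1`
  have hm1 : m = 1 := by
    have h1 : m.fst = 1 := by rw [hm, dual, fst_horiz_deform, hA.horiz_e₂]
    ext
    · rw [h1, fst_one]
    · have := congrArg TrivSqZeroExt.snd hmm
      simp [h1] at this
      rw [snd_one]
      refine eq_zero_of_nat_mul_eq_zero two_ne_zero ?_
      push_cast
      linear_combination this
  subst hm1
  have hx0 : ∀ δ : Derivation ℂ A A, (Q.deform δ).x = inl Q.x + inr (δ Q.x) := fun _ => rfl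
  have hy0 : ∀ δ : Derivation ℂ A A, (Q.deform δ).y = inl Q.y + inr (δ Q.y) := fun _ => rfl
  have hp0 : ∀ δ : Derivation ℂ A A, (Q.deform δ).p = inl Q.p + inr (δ Q.p) := fun _ => rfl
  have hξ0 : ∀ δ : Derivation ℂ A A, (Q.deform δ).ξ = inl Q.ξ + inr (δ Q.ξ) := fun _ => rfl
  have hη0 : ∀ δ : Derivation ℂ A A, (Q.deform δ).η = inl Q.η + inr (δ Q.η) := fun δ => by
    rw [LinePoint.η, LinePoint.η, hp0, hξ0]
    ext <;> simp [mul_comm]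
  -- the entries of the constant matrix agree with those of the identity: modulo `ε` this is the
  -- unimodularity of `Q`, and the coefficients of `ε` are constants in `N`
  obtain ⟨r1, r2, r3⟩ := LinePoint.recover (P := Q.deform δ) (Q := Q.deform 0) (m := 1)
    (a := 1) (b := 0) (c := 0) (d := 1)
    (by
      ext
      · simp [hx0, hη0, hξ0, hy0, Q.det_eq_one]
      · rw [snd_one]
        refine hN _ ?_ kA.snd
        simp [hx0, hη0, hξ0, hy0]
        exact N.sub_mem (N.mul_mem_right _ hx) (N.mul_mem_right _ hξ))
    (by
      ext
      · simp [hx0, hξ0, mul_comm]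
      · rw [snd_zero]
        refine hN _ ?_ kB.snd
        simp [hx0, hξ0]
        exact N.sub_mem (N.mul_mem_right _ hξ) (N.mul_mem_right _ hx))
    (by
      ext
      · simp [hη0, hy0, mul_comm]
      · rw [snd_zero]
        refine hN _ ?_ kC.snd
        simp [hη0, hy0]
        exact N.sub_mem (N.mul_mem_right _ hy) (N.mul_mem_right _ hη))
    (by
      ext
      · simp [hx0, hη0, hξ0, hy0]
        linear_combination Q.det_eq_one
      · rw [snd_one]
        refine hN _ ?_ kD.snd
        simp [hx0, hη0, hξ0, hy0]
        exact N.sub_mem (N.mul_mem_right _ hη) (N.mul_mem_right _ hy))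
  refine ⟨?_, ?_, ?_⟩
  · simpa [hx0, hy0] using congrArg TrivSqZeroExt.snd r1
  · simpa [hx0, hy0] using congrArg TrivSqZeroExt.snd r2
  · simpa [hp0] using congrArg TrivSqZeroExt.snd r3

end Dual
end CRFrame

/-! ### Infinitesimal CR-automorphisms off the hypersurface -/

section

open Filter SmoothGerm SecondOrderODE

section

variable {q : JetSpace} (hq : wronskian q ≠ 0) {V V' : JetSpace → JetSpace}
  (hV : ContDiffAt ℝ ∞ V q) (hV' : ContDiffAt ℝ ∞ V' q)

theorem dirDeriv_basePoint_y_eq (hD : ∀ᶠ r in 𝓝 q, V r ∈ crDist quarticODE r) :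
    dirDeriv V hV (basePoint hq).y = (basePoint hq).p * dirDeriv V hV (basePoint hq).x := by
  rw [show dirDeriv V hV (basePoint hq).y = _ from dirDeriv_snd_id hV,
    show dirDeriv V hV (basePoint hq).x = _ from dirDeriv_fst_id hV]
  refine Subtype.ext (Germ.coe_eq.2 ?_)
  filter_upwards [hD] with r hr using mem_crDist_iff.1 hr

theorem dirDeriv_crJ_basePoint_x (hJ : ∀ᶠ r in 𝓝 q, V' r = crJ quarticODE r (V r)) :
    dirDeriv V' hV' (basePoint hq).x =
      -algebraMap ℂ _ Complex.I * dirDeriv V hV (basePoint hq).x := by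
  rw [show dirDeriv V' hV' (basePoint hq).x = _ from dirDeriv_fst_id hV',
    show dirDeriv V hV (basePoint hq).x = _ from dirDeriv_fst_id hV]
  refine Subtype.ext (Germ.coe_eq.2 ?_)
  filter_upwards [hJ] with r hr
  simp [hr, crJ_fst]

theorem dirDeriv_crJ_basePoint_p (hJ : ∀ᶠ r in 𝓝 q, V' r = crJ quarticODE r (V r)) :
    dirDeriv V' hV' (basePoint hq).p =
      algebraMap ℂ _ Complex.I * (dirDeriv V hV (basePoint hq).p +
        2 * ((basePoint hq).x * (basePoint hq).p - (basePoint hq).y) ^ 3 *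
          dirDeriv V hV (basePoint hq).x) := by
  rw [show dirDeriv V' hV' (basePoint hq).p = _ from dirDeriv_trd_id hV',
    show dirDeriv V hV (basePoint hq).p = _ from dirDeriv_trd_id hV,
    show dirDeriv V hV (basePoint hq).x = _ from dirDeriv_fst_id hV]
  refine Subtype.ext (Germ.coe_eq.2 ?_)
  filter_upwards [hJ] with r hr
  exact (congrArg (fun v : JetSpace => v.2.2) hr).trans crJ_trd

end

/-- The defining properties of an infinitesimal CR-automorphism near `q`, for sections `V` of the
distribution that are defined near `q` only and agree there with a global section `Y`. -/
theorem eventually_lieBracket {B : SecondOrderODE} {X Y V V' : JetSpace → JetSpace}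
    {U : Set JetSpace} {q : JetSpace}
    (hX : IsInfinitesimalCRAut B X U) (hU : U ∈ 𝓝 q) (hY : ContDiff ℝ ∞ Y)
    (hYD : ∀ r, Y r ∈ crDist B r) (hV : Y =ᶠ[𝓝 q] V) (hV' : (fun s => crJ B s (Y s)) =ᶠ[𝓝 q] V') :
    (∀ᶠ r in 𝓝 q, VectorField.lieBracket ℝ X V r ∈ crDist B r) ∧
    ∀ᶠ r in 𝓝 q, VectorField.lieBracket ℝ X V' r = crJ B r (VectorField.lieBracket ℝ X V r) := by
  have h1 := (EventuallyEq.refl (𝓝 q) X).lieBracket_vectorField (𝕜 := ℝ) hV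
  have h2 := (EventuallyEq.refl (𝓝 q) X).lieBracket_vectorField (𝕜 := ℝ) hV'
  constructor
  · filter_upwards [h1, hU] with r hr hrU
    exact hr ▸ hX.map_dist Y hY.contDiffOn (fun s _ => hYD s) r hrU
  · filter_upwards [h1, h2, hU] with r hr hr' hrU
    rw [← hr, ← hr']
    exact hX.map_J Y hY.contDiffOn (fun s _ => hYD s) r hrU

/-- As `E₂` has a pole along the hypersurface, it is multiplied by a bump function. -/
theorem exists_smooth_extension_frame₂ {q : JetSpace} (hq : wronskian q ≠ 0) :
    ∃ Y : JetSpace → JetSpace, ContDiff ℝ ∞ Y ∧ (∀ r, ∃ c : ℂ, Y r = c • frame₂ r) ∧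
      Y =ᶠ[𝓝 q] frame₂ := by
  obtain ⟨ε, hε, hb⟩ := Metric.eventually_nhds_iff_ball.1
    (contDiff_wronskian.continuous.continuousAt.eventually_ne hq)
  let ψ : ContDiffBump q := ⟨ε / 4, ε / 2, by positivity, by linarith⟩
  refine ⟨fun r => ψ r • frame₂ r, ?_, fun r => ⟨(ψ r : ℂ), (Complex.coe_smul _ _).symm⟩, ?_⟩
  · rw [contDiff_iff_contDiffAt]
    intro r
    by_cases hr : r ∈ tsupport ψ
    · rw [ψ.tsupport_eq] at hr
      have : wronskian r ≠ 0 := hb r (Metric.closedBall_subset_ball (by simp [ψ]; linarith) hr)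
      exact ψ.contDiffAt.smul (contDiffAt_frame₂ this)
    · refine (contDiffAt_const (c := (0 : JetSpace))).congr_of_eventuallyEq ?_
      filter_upwards [(isClosed_tsupport ψ).isOpen_compl.mem_nhds hr] with s hs
      rw [image_eq_zero_of_notMem_tsupport hs, zero_smul]
  · filter_upwards [ψ.eventuallyEq_one] with r hr
    rw [hr]; simp

theorem eventually_eq_zero_of_isInfinitesimalCRAut {q : JetSpace} (hq : wronskian q ≠ 0)
    {X : JetSpace → JetSpace} {U : Set JetSpace} (hU : U ∈ 𝓝 q)
    (hX : quarticODE.IsInfinitesimalCRAut X U) (hXq : X q = 0) : ∀ᶠ r in 𝓝 q, X r = 0 := by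
  have hXs : ContDiffAt ℝ ∞ X q := hX.smooth.contDiffAt hU
  obtain ⟨Y, hY, hYc, hYe⟩ := exists_smooth_extension_frame₂ hq
  have hYD : ∀ r, Y r ∈ crDist quarticODE r := fun r => by
    obtain ⟨c, hc⟩ := hYc r
    exact hc ▸ smul_frame₂_mem c r
  have hIYD : ∀ r, Complex.I • Y r ∈ crDist quarticODE r := fun r => by
    obtain ⟨c, hc⟩ := hYc r
    rw [hc, smul_smul]
    exact smul_frame₂_mem _ r
  obtain ⟨a1, j1⟩ := eventually_lieBracket (V := fun r => (1 : ℂ) • frame₁ r)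
    (V' := fun r => Complex.I • frame₁ r) hX hU contDiff_frame₁ frame₁_mem
    (Eventually.of_forall fun r => by simp) (Eventually.of_forall fun r => by simp [crJ_frame₁])
  obtain ⟨a2, -⟩ := eventually_lieBracket (V := fun r => Complex.I • frame₁ r) hX hU
    (Y := fun r => Complex.I • frame₁ r)
    ((contDiff_const (c := Complex.I)).smul contDiff_frame₁) (smul_frame₁_mem _)
    EventuallyEq.rfl EventuallyEq.rfl
  obtain ⟨a3, -⟩ := eventually_lieBracket (V := fun r => (1 : ℂ) • frame₂ r) hX hU hY hYD
    (hYe.mono fun r hr => by simp [hr]) EventuallyEq.rfl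
  -- the pair `E₂ = J (i E₂)` is used rather than `-i E₂ = J E₂`, to avoid signs in the fields
  obtain ⟨a4, j4⟩ := eventually_lieBracket (V := fun r => Complex.I • frame₂ r)
    (V' := fun r => (1 : ℂ) • frame₂ r) (Y := fun r => Complex.I • Y r) hX hU
    ((contDiff_const (c := Complex.I)).smul hY) hIYD (hYe.mono fun r hr => by simp [hr])
    (hYe.mono fun r hr => by simp only [hr, crJ_I_smul_frame₂, one_smul])
  have h1 := contDiffAt_const_smul 1 (contDiff_frame₁.contDiffAt (x := q))
  have h1' := contDiffAt_const_smul Complex.I (contDiff_frame₁.contDiffAt (x := q))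
  have h2 := contDiffAt_const_smul 1 (contDiffAt_frame₂ hq)
  have h2' := contDiffAt_const_smul Complex.I (contDiffAt_frame₂ hq)
  have e1 : ⁅dirDeriv X hXs, (jetFrame hq).e₁⁆ = _ := lie_dirDeriv hXs h1
  have e1' : ⁅dirDeriv X hXs, (jetFrame hq).f₁⁆ = _ := lie_dirDeriv hXs h1'
  have e2 : ⁅dirDeriv X hXs, (jetFrame hq).e₂⁆ = _ := lie_dirDeriv hXs h2
  have e2' : ⁅dirDeriv X hXs, (jetFrame hq).f₂⁆ = _ := lie_dirDeriv hXs h2'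
  have k3 := dirDeriv_crJ_basePoint_x hq (contDiffAt_lieBracket hXs h2')
    (contDiffAt_lieBracket hXs h2) j4
  have k4 := dirDeriv_crJ_basePoint_p hq (contDiffAt_lieBracket hXs h2')
    (contDiffAt_lieBracket hXs h2) j4
  have hI := CRFrame.algebraMap_I_mul_self (A := SmoothGerm q)
  have hinf : (jetFrame hq).IsInfinitesimal (basePoint hq) (dirDeriv X hXs) := by
    refine ⟨?_, ?_, ?_, ?_, ?_, ?_, ?_, ?_⟩
    · rw [e1]; exact dirDeriv_basePoint_y_eq hq _ a1
    · rw [e1']; exact dirDeriv_basePoint_y_eq hq _ a2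
    · rw [e2]; exact dirDeriv_basePoint_y_eq hq _ a3
    · rw [e2']; exact dirDeriv_basePoint_y_eq hq _ a4
    · rw [e1, e1']; exact dirDeriv_crJ_basePoint_x hq _ _ j1
    · rw [e1, e1']; exact dirDeriv_crJ_basePoint_p hq _ _ j1
    · rw [e2, e2', k3]
      linear_combination dirDeriv _ (contDiffAt_lieBracket hXs h2') (basePoint hq).x * hI
    · rw [e2, e2', k3, k4]
      linear_combination dirDeriv _ (contDiffAt_lieBracket hXs h2') (basePoint hq).p * hI
  obtain ⟨g1, g2, g3⟩ := hinf.eq_zero (N := RingHom.ker (value q)) (isCRMap_basePoint hq)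
    (isAdapted_basePoint hq)
    (by
      rw [show dirDeriv X hXs (basePoint hq).x = _ from dirDeriv_fst_id hXs]
      exact congrArg (fun v : JetSpace => v.1) hXq)
    (by
      rw [show dirDeriv X hXs (basePoint hq).y = _ from dirDeriv_snd_id hXs]
      exact congrArg (fun v : JetSpace => v.2.1) hXq)
    (by
      rw [show dirDeriv X hXs (basePoint hq).p = _ from dirDeriv_trd_id hXs]
      exact congrArg (fun v : JetSpace => v.2.2) hXq)
    (fun a ha hc => by
      rw [eq_algebraMap_value hq hc, RingHom.mem_ker.1 ha, map_zero])
  have h0 : ContDiffAt ℝ ∞ (fun _ : JetSpace => (0 : JetSpace)) q := contDiffAt_const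
  exact eventuallyEq_of_coords hXs h0 ((dirDeriv_fst_id hXs).symm.trans g1)
    ((dirDeriv_snd_id hXs).symm.trans g2) ((dirDeriv_trd_id hXs).symm.trans g3)

end

/-! ### Unimodular linear maps act by CR-automorphisms; the isotropy on the hypersurface -/

section

open Filter SecondOrderODE

theorem linAction_leftInverse {α β γ δ α' β' γ' δ' : ℂ} (h₁ : α' * α + β' * γ = 1)
    (h₂ : α' * β + β' * δ = 0) (h₃ : γ' * α + δ' * γ = 0) (h₄ : γ' * β + δ' * δ = 1)
    {r : JetSpace} (hr : α + β * r.2.2 ≠ 0) :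
    α' + β' * (linAction α β γ δ r).2.2 ≠ 0 ∧
      linAction α' β' γ' δ' (linAction α β γ δ r) = r := by
  have hk : α' + β' * (linAction α β γ δ r).2.2 = (α + β * r.2.2)⁻¹ := by
    simp only [linAction]
    obtain ⟨k, hk⟩ : ∃ k, k = α + β * r.2.2 := ⟨_, rfl⟩
    rw [← hk] at hr ⊢
    field_simp
    linear_combination h₁ + r.2.2 * h₂ + α' * hk
  refine ⟨hk ▸ inv_ne_zero hr, Prod.ext ?_ (Prod.ext ?_ ?_)⟩
  · simp only [linAction]
    linear_combination r.1 * h₁ + r.2.1 * h₂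
  · simp only [linAction]
    linear_combination r.1 * h₃ + r.2.1 * h₄
  · change (γ' + δ' * (linAction α β γ δ r).2.2) / (α' + β' * (linAction α β γ δ r).2.2) = r.2.2
    rw [hk, div_inv_eq_mul]
    simp only [linAction]
    obtain ⟨k, hk⟩ : ∃ k, k = α + β * r.2.2 := ⟨_, rfl⟩
    rw [← hk] at hr ⊢
    field_simp
    linear_combination h₃ + r.2.2 * h₄ + γ' * hk

theorem contDiffOn_linAction (α β γ δ : ℂ) :
    ContDiffOn ℝ ∞ (linAction α β γ δ) {r | α + β * r.2.2 ≠ 0} := by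
  intro r hr
  have hnum : ContDiffAt ℝ ∞ (fun r : JetSpace => γ + δ * r.2.2) r := by fun_prop
  have hden : ContDiffAt ℝ ∞ (fun r : JetSpace => α + β * r.2.2) r := by fun_prop
  have : ContDiffAt ℝ ∞ (fun r : JetSpace => (γ + δ * r.2.2) / (α + β * r.2.2)) r := by
    simp only [div_eq_mul_inv]
    exact hnum.mul (hden.inv hr)
  exact ContDiffAt.contDiffWithinAt
    (ContDiffAt.prodMk (by fun_prop) (ContDiffAt.prodMk (by fun_prop) this))

/-- The action on line elements of an invertible linear map of the plane. The inverse matrix has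
the primed entries; the equations say that it is a left and a right inverse. -/
noncomputable def linActionHomeomorph (α β γ δ α' β' γ' δ' : ℂ) (h₁ : α' * α + β' * γ = 1)
    (h₂ : α' * β + β' * δ = 0) (h₃ : γ' * α + δ' * γ = 0) (h₄ : γ' * β + δ' * δ = 1)
    (k₁ : α * α' + β * γ' = 1) (k₂ : α * β' + β * δ' = 0) (k₃ : γ * α' + δ * γ' = 0)
    (k₄ : γ * β' + δ * δ' = 1) : OpenPartialHomeomorph JetSpace JetSpace where
  toFun := linAction α β γ δ
  invFun := linAction α' β' γ' δ'
  source := {r | α + β * r.2.2 ≠ 0}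
  target := {r | α' + β' * r.2.2 ≠ 0}
  map_source' _ hr := (linAction_leftInverse h₁ h₂ h₃ h₄ hr).1
  map_target' _ hr := (linAction_leftInverse k₁ k₂ k₃ k₄ hr).1
  left_inv' _ hr := (linAction_leftInverse h₁ h₂ h₃ h₄ hr).2
  right_inv' _ hr := (linAction_leftInverse k₁ k₂ k₃ k₄ hr).2
  open_source := isOpen_ne_fun (by fun_prop) (by fun_prop)
  open_target := isOpen_ne_fun (by fun_prop) (by fun_prop)
  continuousOn_toFun := (contDiffOn_linAction α β γ δ).continuousOn
  continuousOn_invFun := (contDiffOn_linAction α' β' γ' δ').continuousOn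

theorem fderiv_linAction (α β γ δ : ℂ) {r : JetSpace} (hr : α + β * r.2.2 ≠ 0) (v : JetSpace) :
    fderiv ℝ (linAction α β γ δ) r v = (α * v.1 + β * v.2.1, γ * v.1 + δ * v.2.1,
      (α * δ - β * γ) / (α + β * r.2.2) ^ 2 * v.2.2) := by
  have e1 : HasFDerivAt (fun r : JetSpace => r.1) (ContinuousLinearMap.fst ℝ ℂ (ℂ × ℂ)) r :=
    hasFDerivAt_fst
  have e2 : HasFDerivAt (fun r : JetSpace => r.2.1)
      ((ContinuousLinearMap.fst ℝ ℂ ℂ).comp (ContinuousLinearMap.snd ℝ ℂ (ℂ × ℂ))) r :=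
    hasFDerivAt_fst.comp r hasFDerivAt_snd
  have e3 : HasFDerivAt (fun r : JetSpace => r.2.2)
      ((ContinuousLinearMap.snd ℝ ℂ ℂ).comp (ContinuousLinearMap.snd ℝ ℂ (ℂ × ℂ))) r :=
    hasFDerivAt_snd.comp r hasFDerivAt_snd
  have mob := (((hasDerivAt_id r.2.2).const_mul δ).const_add γ).div
    (((hasDerivAt_id r.2.2).const_mul β).const_add α) hr
  have key := ((e1.const_mul α).add (e2.const_mul β)).prodMk
    (((e1.const_mul γ).add (e2.const_mul δ)).prodMk
      ((mob.hasFDerivAt.restrictScalars ℝ).comp r e3))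
  have h : HasFDerivAt (linAction α β γ δ) _ r := key
  rw [h.fderiv]
  refine Prod.ext ?_ (Prod.ext ?_ ?_)
  · simp
  · simp
  · simp
    field_simp
    ring

theorem wronskian_linAction (α β γ δ : ℂ) {r : JetSpace} (hr : α + β * r.2.2 ≠ 0) :
    wronskian (linAction α β γ δ r) = (α * δ - β * γ) * wronskian r / (α + β * r.2.2) := by
  simp only [wronskian, linAction]
  field_simp
  ring

/-- A linear map of determinant `Δ` multiplies `W³ dx` by `Δ³` and `dp` by `Δ`, up to the same power
of `α + β p`; the complex structure is preserved if `Δ² = 1`. -/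
theorem isCRAt_linAction {α β γ δ : ℂ} (hdet : (α * δ - β * γ) ^ 2 = 1) {r : JetSpace}
    (hr : α + β * r.2.2 ≠ 0) : IsCRAt (linAction α β γ δ) r := by
  intro v hv
  have hv' := mem_crDist_iff.1 hv
  have hm : ∀ v ∈ crDist quarticODE r,
      fderiv ℝ (linAction α β γ δ) r v ∈ crDist quarticODE (linAction α β γ δ r) := by
    intro v hv
    rw [mem_crDist_iff, fderiv_linAction α β γ δ hr]
    simp only [linAction, mem_crDist_iff.1 hv]
    rw [div_mul_eq_mul_div, eq_div_iff hr]
    ring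
  have hJ := crJ_mem quarticODE r v
  have hfst : (fderiv ℝ (linAction α β γ δ) r (crJ quarticODE r v)).1 =
      (crJ quarticODE (linAction α β γ δ r) (fderiv ℝ (linAction α β γ δ) r v)).1 := by
    rw [crJ_fst, fderiv_linAction α β γ δ hr, fderiv_linAction α β γ δ hr]
    simp only [mem_crDist_iff.1 hJ, crJ_fst, hv']
    ring
  refine ⟨hm v hv, Prod.ext hfst (Prod.ext ?_ ?_)⟩
  · rw [mem_crDist_iff.1 (hm _ hJ), mem_crDist_iff.1 (crJ_mem _ _ _), hfst]
  · rw [crJ_trd, wronskian_linAction α β γ δ hr, fderiv_linAction α β γ δ hr,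
      fderiv_linAction α β γ δ hr]
    simp only [crJ_trd, hv']
    field_simp
    linear_combination -2 * wronskian r ^ 3 * v.1 * (α * δ - β * γ) * hdet

theorem linActionHomeomorph_mem_isotropy {α β γ δ α' β' γ' δ' : ℂ} {h₁ : α' * α + β' * γ = 1}
    {h₂ : α' * β + β' * δ = 0} {h₃ : γ' * α + δ' * γ = 0} {h₄ : γ' * β + δ' * δ = 1}
    {k₁ : α * α' + β * γ' = 1} {k₂ : α * β' + β * δ' = 0} {k₃ : γ * α' + δ * γ' = 0}
    {k₄ : γ * β' + δ * δ' = 1} (hdet : (α * δ - β * γ) ^ 2 = 1) {q : JetSpace}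
    (hq : α + β * q.2.2 ≠ 0) (hfix : linAction α β γ δ q = q) :
    linActionHomeomorph α β γ δ α' β' γ' δ' h₁ h₂ h₃ h₄ k₁ k₂ k₃ k₄ ∈ quarticODE.isotropy q :=
  ⟨⟨contDiffOn_linAction α β γ δ, contDiffOn_linAction α' β' γ' δ',
    fun _ hr v hv => (isCRAt_linAction hdet hr v hv).1,
    fun _ hr v hv => (isCRAt_linAction hdet hr v hv).2⟩, hq, hfix⟩

theorem SecondOrderODE.HasLinearizableIsotropy.restrictScalars {B : SecondOrderODE} {q : JetSpace}
    (h : HasLinearizableIsotropy ℂ B q) : HasLinearizableIsotropy ℝ B q := by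
  obtain ⟨Φ, h1, h2, h3, h4, h5⟩ := h
  refine ⟨Φ, h1, h2, h3.restrict_scalars ℝ, h4.restrict_scalars ℝ, fun f hf => ?_⟩
  obtain ⟨A, hA⟩ := h5 f hf
  exact ⟨A.restrictScalars ℝ, hA⟩

/-- If `f` is linear in the chart `Φ` and its differential at `q` fixes `u`, then the line in the
direction of `u`, drawn in the chart, consists of fixed points of `f`. -/
theorem exists_curve_of_linearization {f : JetSpace → JetSpace} {q u : JetSpace}
    {Φ : OpenPartialHomeomorph JetSpace JetSpace} (hq : q ∈ Φ.source) (hΦq : Φ q = 0)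
    (hΦ : DifferentiableAt ℝ Φ q) (hΦ' : DifferentiableAt ℝ Φ.symm 0)
    (hf : DifferentiableAt ℝ f q) (hfq : f q = q) {A : JetSpace →L[ℝ] JetSpace}
    (hA : ∀ᶠ r in 𝓝 q, Φ (f r) = A (Φ r)) (hu : fderiv ℝ f q u = u) :
    ∃ c : ℝ → JetSpace, c 0 = q ∧ HasDerivAt c u 0 ∧ ∀ᶠ τ in 𝓝 0, f (c τ) = c τ := by
  set e := fderiv ℝ Φ q u with he
  have h0 : Φ.symm 0 = q := by rw [← hΦq]; exact Φ.left_inv hq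
  have hAe : A e = e := by
    have h1 : HasFDerivAt (fun r => Φ (f r)) ((fderiv ℝ Φ q).comp (fderiv ℝ f q)) q := by
      refine HasFDerivAt.comp q ?_ hf.hasFDerivAt
      rw [hfq]
      exact hΦ.hasFDerivAt
    have h2 : HasFDerivAt (fun r => A (Φ r)) (A.comp (fderiv ℝ Φ q)) q :=
      A.hasFDerivAt.comp q hΦ.hasFDerivAt
    have h3 := congrArg (fun T : JetSpace →L[ℝ] JetSpace => T u)
      ((h2.congr_of_eventuallyEq hA).unique h1)
    simpa [hu] using h3
  have hMe : fderiv ℝ Φ.symm 0 e = u := by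
    have h1 : HasFDerivAt (Φ.symm ∘ Φ) ((fderiv ℝ Φ.symm 0).comp (fderiv ℝ Φ q)) q := by
      refine HasFDerivAt.comp q ?_ hΦ.hasFDerivAt
      rw [hΦq]
      exact hΦ'.hasFDerivAt
    have h2 : HasFDerivAt (Φ.symm ∘ Φ) (ContinuousLinearMap.id ℝ JetSpace) q :=
      (hasFDerivAt_id q).congr_of_eventuallyEq (Φ.eventually_left_inverse hq)
    exact congrArg (fun T : JetSpace →L[ℝ] JetSpace => T u) (h1.unique h2)
  have hline : HasDerivAt (fun τ : ℝ => τ • e) e 0 := by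
    simpa using (hasDerivAt_id (0 : ℝ)).smul_const e
  have hc : HasDerivAt (fun τ : ℝ => Φ.symm (τ • e)) u 0 := by
    have h1 : HasFDerivAt Φ.symm (fderiv ℝ Φ.symm 0) ((0 : ℝ) • e) := by
      rw [zero_smul]; exact hΦ'.hasFDerivAt
    have := h1.comp_hasDerivAt (0 : ℝ) hline
    rwa [hMe] at this
  refine ⟨fun τ => Φ.symm (τ • e), by simp [h0], hc, ?_⟩
  have hc0 : Tendsto (fun τ : ℝ => Φ.symm (τ • e)) (𝓝 0) (𝓝 q) := by
    have := hc.continuousAt.tendsto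
    simpa [h0] using this
  have hl0 : Tendsto (fun τ : ℝ => τ • e) (𝓝 0) (𝓝 0) := by
    have := hline.continuousAt.tendsto
    simpa using this
  have h1 : ∀ᶠ r in 𝓝 q, f r ∈ Φ.source := by
    have := hf.continuousAt.eventually_mem (s := Φ.source) (by
      rw [hfq]; exact Φ.open_source.mem_nhds hq)
    exact this
  have h2 : Φ.target ∈ 𝓝 (0 : JetSpace) := Φ.open_target.mem_nhds (hΦq ▸ Φ.map_source hq)
  filter_upwards [hc0.eventually hA, hc0.eventually h1, hl0.eventually h2] with τ k1 k2 k3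
  refine Φ.injOn k2 (Φ.map_target k3) ?_
  rw [k1, Φ.right_inv k3, map_smul, hAe]

/-- The shear of the plane along the line through the origin of slope `p` fixes `q`, has a
differential that fixes `∂/∂p`, and near `q` all its fixed points have the same `p`. -/
theorem not_hasLinearizableIsotropy {q : JetSpace} (hq : q ∈ hypersurfaceΓ) :
    ¬ HasLinearizableIsotropy ℝ quarticODE q := by
  rintro ⟨Φ, h1, h2, h3, h4, h5⟩
  have hq' : q.2.1 = q.1 * q.2.2 := hq
  obtain ⟨p, hp⟩ : ∃ p, p = q.2.2 := ⟨_, rfl⟩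
  rw [← hp] at hq'
  have hk : (1 - p) + 1 * q.2.2 ≠ 0 := by rw [← hp]; simp
  have hfix : linAction (1 - p) 1 (-p ^ 2) (1 + p) q = q := by
    refine Prod.ext ?_ (Prod.ext ?_ ?_)
    · simp only [linAction, hq']; ring
    · simp only [linAction, hq']; ring
    · simp only [linAction, ← hp]; ring
  obtain ⟨A, hA⟩ := h5 _ (linActionHomeomorph_mem_isotropy (α := 1 - p) (β := 1) (γ := -p ^ 2)
    (δ := 1 + p) (α' := 1 + p) (β' := -1) (γ' := p ^ 2) (δ' := 1 - p) (h₁ := by ring)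
    (h₂ := by ring) (h₃ := by ring) (h₄ := by ring) (k₁ := by ring) (k₂ := by ring) (k₃ := by ring)
    (k₄ := by ring) (by ring) hk hfix)
  obtain ⟨c, hc0, hc, hfc⟩ := exists_curve_of_linearization (u := (0, 0, 1))
    (f := linAction (1 - p) 1 (-p ^ 2) (1 + p)) h1 h2
    ((h3.contDiffAt (Φ.open_source.mem_nhds h1)).differentiableAt (by simp))
    ((h4.contDiffAt (Φ.open_target.mem_nhds (h2 ▸ Φ.map_source h1))).differentiableAt (by simp))
    (((contDiffOn_linAction _ _ _ _).contDiffAt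
      ((isOpen_ne_fun (by fun_prop) (by fun_prop)).mem_nhds hk)).differentiableAt (by simp))
    hfix hA (by
      rw [fderiv_linAction _ _ _ _ hk, ← hp]
      simp
      ring)
  have hck : ∀ᶠ τ in 𝓝 (0 : ℝ), (1 - p) + 1 * (c τ).2.2 ≠ 0 := by
    have : ContinuousAt (fun τ => (1 - p) + 1 * (c τ).2.2) 0 :=
      continuousAt_const.add (continuousAt_const.mul hc.continuousAt.snd.snd)
    exact this.eventually_ne (by rw [hc0]; exact hk)
  have hconst : (fun τ => (c τ).2.2) =ᶠ[𝓝 0] fun _ => p := by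
    filter_upwards [hfc, hck] with τ k1 k2
    have k3 : (-p ^ 2 + (1 + p) * (c τ).2.2) / ((1 - p) + 1 * (c τ).2.2) = (c τ).2.2 :=
      congrArg (fun r : JetSpace => r.2.2) k1
    rw [div_eq_iff k2] at k3
    have k4 : ((c τ).2.2 - p) ^ 2 = 0 := by linear_combination -k3
    exact sub_eq_zero.1 (pow_eq_zero_iff two_ne_zero |>.1 k4)
  have hd : HasDerivAt (fun τ => (c τ).2.2) (1 : ℂ) 0 := hc.snd.snd
  have := hd.unique ((hasDerivAt_const (0 : ℝ) p).congr_of_eventuallyEq hconst)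
  exact one_ne_zero this

end

/-! ### The isotropy off the hypersurface -/

section

open Filter SecondOrderODE

theorem isotropyMap_one {q : JetSpace} (hq : wronskian q ≠ 0) : isotropyMap q 1 = id := by
  have h : (wronskian q)⁻¹ * (q.1 * q.2.2 - q.2.1) = 1 := inv_mul_cancel₀ hq
  have e₁ : q.1 * (q.2.2 * (wronskian q)⁻¹) - 1 * (wronskian q)⁻¹ * q.2.1 = 1 := by
    linear_combination h
  have e₂ : 1 * (wronskian q)⁻¹ * q.1 - q.1 * (wronskian q)⁻¹ = 0 := by ring
  have e₃ : q.2.1 * (q.2.2 * (wronskian q)⁻¹) - 1 * (q.2.2 * (wronskian q)⁻¹) * q.2.1 = 0 := by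
    ring
  have e₄ : 1 * (q.2.2 * (wronskian q)⁻¹) * q.1 - q.2.1 * (wronskian q)⁻¹ = 1 := by
    linear_combination h
  funext r
  rw [isotropyMap, e₁, e₂, e₃, e₄]
  simp [linAction]

theorem isotropyMap_neg_one (q : JetSpace) :
    isotropyMap q (-1) = linAction ((wronskian q)⁻¹ * (q.1 * q.2.2 + q.2.1))
      (-2 * (wronskian q)⁻¹ * q.1) (2 * (wronskian q)⁻¹ * (q.2.1 * q.2.2))
      (-(wronskian q)⁻¹ * (q.1 * q.2.2 + q.2.1)) := by
  rw [isotropyMap]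
  congr 1 <;> ring

theorem isotropyMap_neg_one_apply_self {q : JetSpace} (hq : wronskian q ≠ 0) :
    isotropyMap q (-1) q = q := by
  have hd := isotropyMap_denom hq (-1)
  have h : (wronskian q)⁻¹ * (q.1 * q.2.2 - q.2.1) = 1 := inv_mul_cancel₀ hq
  refine Prod.ext ?_ (Prod.ext ?_ ?_)
  · simp only [isotropyMap, linAction]
    linear_combination q.1 * h
  · simp only [isotropyMap, linAction]
    linear_combination q.2.1 * h
  · simp only [isotropyMap, linAction]
    rw [hd, div_eq_iff (by norm_num)]
    linear_combination -q.2.2 * h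

/-- The action of the reflection of the plane that fixes the point `(x, y)` of `q` and reverses its
direction `(1, p)`. The reflection is its own inverse. -/
noncomputable def isotropyInvolution (q : JetSpace) (hq : wronskian q ≠ 0) :
    OpenPartialHomeomorph JetSpace JetSpace :=
  have h : (wronskian q)⁻¹ * (q.1 * q.2.2 - q.2.1) = 1 := inv_mul_cancel₀ hq
  have h₁ : ((wronskian q)⁻¹ * (q.1 * q.2.2 + q.2.1)) * ((wronskian q)⁻¹ * (q.1 * q.2.2 + q.2.1)) +
      (-2 * (wronskian q)⁻¹ * q.1) * (2 * (wronskian q)⁻¹ * (q.2.1 * q.2.2)) = 1 := by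
    linear_combination ((wronskian q)⁻¹ * (q.1 * q.2.2 - q.2.1) + 1) * h
  have h₄ : (2 * (wronskian q)⁻¹ * (q.2.1 * q.2.2)) * (-2 * (wronskian q)⁻¹ * q.1) +
      (-(wronskian q)⁻¹ * (q.1 * q.2.2 + q.2.1)) * (-(wronskian q)⁻¹ * (q.1 * q.2.2 + q.2.1)) =
      1 := by
    linear_combination ((wronskian q)⁻¹ * (q.1 * q.2.2 - q.2.1) + 1) * h
  linActionHomeomorph ((wronskian q)⁻¹ * (q.1 * q.2.2 + q.2.1))
    (-2 * (wronskian q)⁻¹ * q.1) (2 * (wronskian q)⁻¹ * (q.2.1 * q.2.2))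
    (-(wronskian q)⁻¹ * (q.1 * q.2.2 + q.2.1)) _ _ _ _
    h₁ (by ring) (by ring) h₄ h₁ (by ring) (by ring) h₄

theorem coe_isotropyInvolution {q : JetSpace} (hq : wronskian q ≠ 0) :
    ⇑(isotropyInvolution q hq) = isotropyMap q (-1) :=
  (isotropyMap_neg_one q).symm

theorem isotropyInvolution_denom {q : JetSpace} (hq : wronskian q ≠ 0) :
    (wronskian q)⁻¹ * (q.1 * q.2.2 + q.2.1) + (-2 * (wronskian q)⁻¹ * q.1) * q.2.2 = -1 := by
  have h : (wronskian q)⁻¹ * (q.1 * q.2.2 - q.2.1) = 1 := inv_mul_cancel₀ hq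
  linear_combination -h

theorem isotropyInvolution_det {q : JetSpace} (hq : wronskian q ≠ 0) :
    ((wronskian q)⁻¹ * (q.1 * q.2.2 + q.2.1)) * (-(wronskian q)⁻¹ * (q.1 * q.2.2 + q.2.1)) -
      (-2 * (wronskian q)⁻¹ * q.1) * (2 * (wronskian q)⁻¹ * (q.2.1 * q.2.2)) = -1 := by
  have h : (wronskian q)⁻¹ * (q.1 * q.2.2 - q.2.1) = 1 := inv_mul_cancel₀ hq
  linear_combination -((wronskian q)⁻¹ * (q.1 * q.2.2 - q.2.1) + 1) * h

theorem mem_source_isotropyInvolution {q : JetSpace} (hq : wronskian q ≠ 0) :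
    q ∈ (isotropyInvolution q hq).source := by
  change _ ≠ (0 : ℂ)
  rw [isotropyInvolution_denom hq]
  norm_num

theorem isotropyInvolution_mem_isotropy {q : JetSpace} (hq : wronskian q ≠ 0) :
    isotropyInvolution q hq ∈ quarticODE.isotropy q := by
  have hdet := isotropyInvolution_det hq
  have hfix := isotropyMap_neg_one_apply_self hq
  rw [isotropyMap_neg_one] at hfix
  unfold isotropyInvolution
  exact linActionHomeomorph_mem_isotropy (by rw [hdet]; norm_num)
    (mem_source_isotropyInvolution hq) hfix

theorem isotropyInvolution_involutive {q : JetSpace} (hq : wronskian q ≠ 0) :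
    ∀ᶠ r in 𝓝 q, isotropyInvolution q hq (isotropyInvolution q hq r) = r :=
  (isotropyInvolution q hq).eventually_left_inverse (mem_source_isotropyInvolution hq)

theorem isotropyInvolution_ne_id {q : JetSpace} (hq : wronskian q ≠ 0) :
    ¬ ∀ᶠ r in 𝓝 q, isotropyInvolution q hq r = r := by
  intro h
  have h₁ : fderiv ℝ (isotropyInvolution q hq) q = fderiv ℝ id q := Filter.EventuallyEq.fderiv_eq h
  have h₂ := congrArg (fun T : JetSpace →L[ℝ] JetSpace => (T (0, 0, 1)).2.2) h₁
  rw [coe_isotropyInvolution, isotropyMap_neg_one] at h₂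
  simp only [fderiv_linAction _ _ _ _ (mem_source_isotropyInvolution hq), isotropyInvolution_det hq,
    isotropyInvolution_denom hq, fderiv_id, ContinuousLinearMap.id_apply] at h₂
  norm_num at h₂

theorem eq_id_or_eq_isotropyInvolution {q : JetSpace} (hq : wronskian q ≠ 0)
    {f : OpenPartialHomeomorph JetSpace JetSpace} (hf : f ∈ quarticODE.isotropy q) :
    (∀ᶠ r in 𝓝 q, f r = r) ∨ ∀ᶠ r in 𝓝 q, f r = isotropyInvolution q hq r := by
  obtain ⟨c, rfl | rfl, h⟩ := eventuallyEq_isotropyMap hq (isCRGerm_of_mem_isotropy hf) hf.2.2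
  · left
    rwa [isotropyMap_one hq] at h
  · right
    rwa [coe_isotropyInvolution]

theorem contDiffOn_linearizingChart (a b c d k l : ℂ) :
    ContDiffOn ℂ ∞ (fun r : JetSpace => (r.1 + k, r.2.1 + l, (a + b * r.2.2) / (c + d * r.2.2)))
      {r | c + d * r.2.2 ≠ 0} := by
  intro r hr
  have hnum : ContDiffAt ℂ ∞ (fun r : JetSpace => a + b * r.2.2) r := by fun_prop
  have hden : ContDiffAt ℂ ∞ (fun r : JetSpace => c + d * r.2.2) r := by fun_prop
  have h : ContDiffAt ℂ ∞ (fun r : JetSpace => (a + b * r.2.2) / (c + d * r.2.2)) r := by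
    simp only [div_eq_mul_inv]
    exact hnum.mul (hden.inv hr)
  exact ((by fun_prop : ContDiffAt ℂ ∞ (fun r : JetSpace => r.1 + k) r).prodMk
    ((by fun_prop : ContDiffAt ℂ ∞ (fun r : JetSpace => r.2.1 + l) r).prodMk h)).contDiffWithinAt

/-- The chart `(x - x₀, y - y₀, (p - p₀) / (x₀ p - y₀))` centred at `q = (x₀, y₀, p₀)`. Its last
coordinate is the slope relative to the basis `(1, p₀)`, `(x₀, y₀)` of eigenvectors of the
reflection, up to a constant factor, so that the reflection changes its sign. -/
noncomputable def linearizingChart (q : JetSpace) (hq : wronskian q ≠ 0) :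
    OpenPartialHomeomorph JetSpace JetSpace where
  toFun r := (r.1 + -q.1, r.2.1 + -q.2.1, (-q.2.2 + 1 * r.2.2) / (-q.2.1 + q.1 * r.2.2))
  invFun r := (r.1 + q.1, r.2.1 + q.2.1, (q.2.2 + -q.2.1 * r.2.2) / (1 + -q.1 * r.2.2))
  source := {r | -q.2.1 + q.1 * r.2.2 ≠ 0}
  target := {r | 1 + -q.1 * r.2.2 ≠ 0}
  map_source' r hr := by
    have h : (1 : ℂ) + -q.1 * ((-q.2.2 + 1 * r.2.2) / (-q.2.1 + q.1 * r.2.2)) =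
        wronskian q / (-q.2.1 + q.1 * r.2.2) := by
      rw [eq_div_iff hr, add_mul, mul_assoc, div_mul_cancel₀ _ hr, wronskian]
      ring
    change (1 : ℂ) + -q.1 * ((-q.2.2 + 1 * r.2.2) / (-q.2.1 + q.1 * r.2.2)) ≠ 0
    rw [h]
    exact div_ne_zero hq hr
  map_target' r hr := by
    have h : -q.2.1 + q.1 * ((q.2.2 + -q.2.1 * r.2.2) / (1 + -q.1 * r.2.2)) =
        wronskian q / (1 + -q.1 * r.2.2) := by
      rw [eq_div_iff hr, add_mul, mul_assoc, div_mul_cancel₀ _ hr, wronskian]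
      ring
    change -q.2.1 + q.1 * ((q.2.2 + -q.2.1 * r.2.2) / (1 + -q.1 * r.2.2)) ≠ 0
    rw [h]
    exact div_ne_zero hq hr
  left_inv' r hr := by
    have hr' : -q.2.1 + q.1 * r.2.2 ≠ 0 := hr
    have h : (1 : ℂ) + -q.1 * ((-q.2.2 + 1 * r.2.2) / (-q.2.1 + q.1 * r.2.2)) =
        wronskian q / (-q.2.1 + q.1 * r.2.2) := by
      rw [eq_div_iff hr', add_mul, mul_assoc, div_mul_cancel₀ _ hr', wronskian]
      ring
    refine Prod.ext (by simp) (Prod.ext (by simp) ?_)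
    simp only
    rw [h, div_eq_iff (div_ne_zero hq hr'), mul_div_assoc', mul_div_assoc', eq_div_iff hr', add_mul,
      div_mul_cancel₀ _ hr', wronskian]
    ring
  right_inv' r hr := by
    have hr' : 1 + -q.1 * r.2.2 ≠ 0 := hr
    have h : -q.2.1 + q.1 * ((q.2.2 + -q.2.1 * r.2.2) / (1 + -q.1 * r.2.2)) =
        wronskian q / (1 + -q.1 * r.2.2) := by
      rw [eq_div_iff hr', add_mul, mul_assoc, div_mul_cancel₀ _ hr', wronskian]
      ring
    refine Prod.ext (by simp) (Prod.ext (by simp) ?_)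
    simp only
    rw [h, div_eq_iff (div_ne_zero hq hr'), mul_div_assoc', mul_div_assoc', eq_div_iff hr', add_mul,
      div_mul_cancel₀ _ hr', wronskian]
    ring
  open_source := isOpen_ne_fun (by fun_prop) (by fun_prop)
  open_target := isOpen_ne_fun (by fun_prop) (by fun_prop)
  continuousOn_toFun := (contDiffOn_linearizingChart _ _ _ _ _ _).continuousOn
  continuousOn_invFun := (contDiffOn_linearizingChart _ _ _ _ _ _).continuousOn

theorem linearizingChart_isotropyInvolution {q : JetSpace} (hq : wronskian q ≠ 0) {r : JetSpace}
    (hr : r ∈ (isotropyInvolution q hq).source) (hr' : r ∈ (linearizingChart q hq).source) :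
    linearizingChart q hq (isotropyInvolution q hq r) =
      (((wronskian q)⁻¹ * (q.1 * q.2.2 + q.2.1)) * (linearizingChart q hq r).1 +
          (-2 * (wronskian q)⁻¹ * q.1) * (linearizingChart q hq r).2.1,
        (2 * (wronskian q)⁻¹ * (q.2.1 * q.2.2)) * (linearizingChart q hq r).1 +
          (-(wronskian q)⁻¹ * (q.1 * q.2.2 + q.2.1)) * (linearizingChart q hq r).2.1,
        -(linearizingChart q hq r).2.2) := by
  have h : (wronskian q)⁻¹ * (q.1 * q.2.2 - q.2.1) = 1 := inv_mul_cancel₀ hq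
  rw [coe_isotropyInvolution, isotropyMap_neg_one]
  have hk : (wronskian q)⁻¹ * (q.1 * q.2.2 + q.2.1) + -2 * (wronskian q)⁻¹ * q.1 * r.2.2 ≠ 0 := hr
  have hm : -q.2.1 + q.1 * r.2.2 ≠ 0 := hr'
  refine Prod.ext ?_ (Prod.ext ?_ ?_)
  · simp only [linearizingChart, linAction, OpenPartialHomeomorph.coe_mk]
    linear_combination q.1 * h
  · simp only [linearizingChart, linAction, OpenPartialHomeomorph.coe_mk]
    linear_combination q.2.1 * h
  · change (-q.2.2 + 1 * _) / (-q.2.1 + q.1 * _) = -((-q.2.2 + 1 * r.2.2) / (-q.2.1 + q.1 * r.2.2))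
    simp only [linAction]
    generalize (wronskian q)⁻¹ = w at *
    set k := w * (q.1 * q.2.2 + q.2.1) + -2 * w * q.1 * r.2.2 with hkdef
    have e₁ : -q.2.2 + 1 * ((2 * w * (q.2.1 * q.2.2) + -w * (q.1 * q.2.2 + q.2.1) * r.2.2) / k) =
        (-q.2.2 + 1 * r.2.2) / k := by
      rw [eq_div_iff hk, add_mul, one_mul, div_mul_cancel₀ _ hk, hkdef]
      linear_combination (r.2.2 - q.2.2) * h
    have e₂ : -q.2.1 + q.1 * ((2 * w * (q.2.1 * q.2.2) + -w * (q.1 * q.2.2 + q.2.1) * r.2.2) / k) =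
        -(-q.2.1 + q.1 * r.2.2) / k := by
      rw [eq_div_iff hk, add_mul, mul_assoc, div_mul_cancel₀ _ hk, hkdef]
      linear_combination (q.2.1 - q.1 * r.2.2) * h
    rw [e₁, e₂, div_div_div_cancel_right₀ hk, div_neg]

theorem hasLinearizableIsotropy {q : JetSpace} (hq : wronskian q ≠ 0) :
    HasLinearizableIsotropy ℂ quarticODE q := by
  have hsrc : q ∈ (linearizingChart q hq).source := by
    change -q.2.1 + q.1 * q.2.2 ≠ 0
    rwa [neg_add_eq_sub]
  refine ⟨linearizingChart q hq, hsrc, ?_, contDiffOn_linearizingChart _ _ _ _ _ _,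
    contDiffOn_linearizingChart _ _ _ _ _ _, fun f hf => ?_⟩
  · simp [linearizingChart]
  rcases eq_id_or_eq_isotropyInvolution hq hf with h | h
  · refine ⟨ContinuousLinearMap.id ℂ JetSpace, ?_⟩
    filter_upwards [h] with r hr
    rw [hr]
    rfl
  · let X := ContinuousLinearMap.fst ℂ ℂ (ℂ × ℂ)
    let Y := (ContinuousLinearMap.fst ℂ ℂ ℂ).comp (ContinuousLinearMap.snd ℂ ℂ (ℂ × ℂ))
    let P := (ContinuousLinearMap.snd ℂ ℂ ℂ).comp (ContinuousLinearMap.snd ℂ ℂ (ℂ × ℂ))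
    refine ⟨(((wronskian q)⁻¹ * (q.1 * q.2.2 + q.2.1)) • X + (-2 * (wronskian q)⁻¹ * q.1) • Y).prod
      (((2 * (wronskian q)⁻¹ * (q.2.1 * q.2.2)) • X +
        (-(wronskian q)⁻¹ * (q.1 * q.2.2 + q.2.1)) • Y).prod (-P)), ?_⟩
    filter_upwards [h, (linearizingChart q hq).open_source.mem_nhds hsrc,
      (isotropyInvolution q hq).open_source.mem_nhds (mem_source_isotropyInvolution hq)]
      with r h₁ h₂ h₃
    rw [h₁, linearizingChart_isotropyInvolution hq h₃ h₂]
    rfl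

end

/-! ### Affine changes of the variables of the ODE -/

section

open Filter SecondOrderODE

section
variable {g : (ℂ × ℂ) ≃ᵃ[ℂ] (ℂ × ℂ)} {α β γ δ e₁ e₂ : ℂ} {u v : ℂ → ℂ} {U V : Set ℂ}

theorem graph_image (hg : ∀ x y, g (x, y) = (α * x + β * y + e₁, γ * x + δ * y + e₂))
    (h : g '' ((fun x => (x, u x)) '' U) = (fun x => (x, v x)) '' V) :
    (fun x => α * x + β * u x + e₁) '' U = V ∧
      ∀ x ∈ U, v (α * x + β * u x + e₁) = γ * x + δ * u x + e₂ := by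
  have key : ∀ x ∈ U, α * x + β * u x + e₁ ∈ V ∧
      v (α * x + β * u x + e₁) = γ * x + δ * u x + e₂ := by
    intro x hx
    obtain ⟨z, hz, hzx⟩ : g (x, u x) ∈ (fun x => (x, v x)) '' V := by
      rw [← h]
      exact ⟨_, ⟨x, hx, rfl⟩, rfl⟩
    rw [hg, Prod.mk.injEq] at hzx
    obtain ⟨rfl, h₂⟩ := hzx
    exact ⟨hz, h₂⟩
  refine ⟨Set.Subset.antisymm ?_ ?_, fun x hx => (key x hx).2⟩
  · rintro _ ⟨x, hx, rfl⟩
    exact (key x hx).1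
  · intro z hz
    obtain ⟨_, ⟨x, hx, rfl⟩, hzx⟩ : (z, v z) ∈ g '' ((fun x => (x, u x)) '' U) := by
      rw [h]
      exact ⟨z, hz, rfl⟩
    simp only [hg, Prod.mk.injEq] at hzx
    exact ⟨x, hx, hzx.1⟩

theorem deriv_of_graph_image (hg : ∀ x y, g (x, y) = (α * x + β * y + e₁, γ * x + δ * y + e₂))
    (hdet : α * δ - β * γ ≠ 0) (hU : IsOpen U) (hV : IsOpen V) (hu : DifferentiableOn ℂ u U)
    (hv : DifferentiableOn ℂ v V)
    (h : g '' ((fun x => (x, u x)) '' U) = (fun x => (x, v x)) '' V) {x : ℂ} (hx : x ∈ U) :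
    α + β * deriv u x ≠ 0 ∧
      deriv v (α * x + β * u x + e₁) = (γ + δ * deriv u x) / (α + β * deriv u x) := by
  obtain ⟨hUV, hvu⟩ := graph_image hg h
  have hux := (hu.differentiableAt (hU.mem_nhds hx)).hasDerivAt
  have hhx : α * x + β * u x + e₁ ∈ V := hUV ▸ ⟨x, hx, rfl⟩
  have hvx := (hv.differentiableAt (hV.mem_nhds hhx)).hasDerivAt
  have h₁ : HasDerivAt (fun x => α * x + β * u x + e₁) (α + β * deriv u x) x := by
    simpa using (((hasDerivAt_id x).const_mul α).add (hux.const_mul β)).add_const e₁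
  have h₂ : HasDerivAt (fun x => γ * x + δ * u x + e₂) (γ + δ * deriv u x) x := by
    simpa using (((hasDerivAt_id x).const_mul γ).add (hux.const_mul δ)).add_const e₂
  have h₃ : HasDerivAt (fun x => v (α * x + β * u x + e₁)) _ x := hvx.comp x h₁
  have h₄ : (fun x => v (α * x + β * u x + e₁)) =ᶠ[𝓝 x] fun x => γ * x + δ * u x + e₂ := by
    filter_upwards [hU.mem_nhds hx] with z hz using hvu z hz
  have h₅ := h₃.unique (h₂.congr_of_eventuallyEq h₄)
  -- otherwise `γ + δ u'` would vanish as well, by the chain rule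
  have hk : α + β * deriv u x ≠ 0 := by
    intro hk
    rw [hk, mul_zero] at h₅
    exact hdet (by linear_combination δ * hk + β * h₅)
  exact ⟨hk, by rw [eq_div_iff hk, h₅]⟩

theorem deriv_deriv_of_graph_image
    (hg : ∀ x y, g (x, y) = (α * x + β * y + e₁, γ * x + δ * y + e₂))
    (hdet : α * δ - β * γ ≠ 0) (hU : IsOpen U) (hV : IsOpen V) (hu : DifferentiableOn ℂ u U)
    (hv : DifferentiableOn ℂ v V)
    (h : g '' ((fun x => (x, u x)) '' U) = (fun x => (x, v x)) '' V) {x : ℂ} (hx : x ∈ U) :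
    (α + β * deriv u x) ^ 3 * deriv (deriv v) (α * x + β * u x + e₁) =
      (α * δ - β * γ) * deriv (deriv u) x := by
  obtain ⟨hUV, -⟩ := graph_image hg h
  have hk := (deriv_of_graph_image hg hdet hU hV hu hv h hx).1
  have hux := (hu.differentiableAt (hU.mem_nhds hx)).hasDerivAt
  have hux' := ((hu.deriv hU).differentiableAt (hU.mem_nhds hx)).hasDerivAt
  have hhx : α * x + β * u x + e₁ ∈ V := hUV ▸ ⟨x, hx, rfl⟩
  have hvx := ((hv.deriv hV).differentiableAt (hV.mem_nhds hhx)).hasDerivAt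
  have h₁ : HasDerivAt (fun x => α * x + β * u x + e₁) (α + β * deriv u x) x := by
    simpa using (((hasDerivAt_id x).const_mul α).add (hux.const_mul β)).add_const e₁
  have h₂ := ((hux'.const_mul δ).const_add γ).div ((hux'.const_mul β).const_add α) hk
  have h₃ := HasDerivAt.comp (h₂ := deriv v) x hvx h₁
  have h₄ : (fun x => deriv v (α * x + β * u x + e₁)) =ᶠ[𝓝 x]
      fun x => (γ + δ * deriv u x) / (α + β * deriv u x) := by
    filter_upwards [hU.mem_nhds hx] with z hz
    exact (deriv_of_graph_image hg hdet hU hV hu hv h hz).2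
  have h₅ := h₃.unique (h₂.congr_of_eventuallyEq h₄)
  rw [eq_div_iff (pow_ne_zero 2 hk)] at h₅
  linear_combination h₅

end

/-- The transformation rule of second order ODEs under the affine map
`(x, y) ↦ (α x + β y + e₁, γ x + δ y + e₂)`. -/
theorem carriesODE_of_transformation {g : (ℂ × ℂ) ≃ᵃ[ℂ] (ℂ × ℂ)} {α β γ δ e₁ e₂ : ℂ}
    {B B' : SecondOrderODE}
    (hg : ∀ x y, g (x, y) = (α * x + β * y + e₁, γ * x + δ * y + e₂))
    (hdet : α * δ - β * γ ≠ 0)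
    (hB : ∀ x y p, α + β * p ≠ 0 → (α + β * p) ^ 3 *
      B' (α * x + β * y + e₁) (γ * x + δ * y + e₂) ((γ + δ * p) / (α + β * p)) =
        (α * δ - β * γ) * B x y p) :
    CarriesODE g B B' := by
  intro U V u v hU hV hu hv h
  obtain ⟨hUV, hvu⟩ := graph_image hg h
  have key : ∀ x ∈ U, (deriv (deriv u) x = B x (u x) (deriv u x) ↔
      deriv (deriv v) (α * x + β * u x + e₁) = B' (α * x + β * u x + e₁)
        (v (α * x + β * u x + e₁)) (deriv v (α * x + β * u x + e₁))) := by
    intro x hx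
    obtain ⟨hk, hv₁⟩ := deriv_of_graph_image hg hdet hU hV hu hv h hx
    have hv₂ := deriv_deriv_of_graph_image hg hdet hU hV hu hv h hx
    rw [hv₁, hvu x hx, ← mul_right_inj' hdet, ← hv₂, ← hB _ _ _ hk,
      mul_right_inj' (pow_ne_zero 3 hk)]
  constructor
  · rintro ⟨-, h'⟩
    refine ⟨hv, ?_⟩
    rw [← hUV]
    rintro _ ⟨x, hx, rfl⟩
    exact (key x hx).1 (h' x hx)
  · rintro ⟨-, h'⟩
    exact ⟨hu, fun x hx => (key x hx).2 (h' _ (hUV ▸ ⟨x, hx, rfl⟩))⟩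

theorem admitsShear_shiftedQuarticODE (K e : ℂ) : AdmitsShear (shiftedQuarticODE K e) := by
  intro t g hg
  refine carriesODE_of_transformation (α := 1) (β := t) (γ := 0) (δ := 1) (e₁ := 0) (e₂ := 0)
    (fun x y => by rw [hg]; simp) (by norm_num) fun x y p hk => ?_
  simp only [shiftedQuarticODE]
  rw [mul_left_comm, ← mul_pow, mul_sub, mul_left_comm, mul_div_cancel₀ _ hk]
  ring

/-- The affine map of the plane whose inverse is
`(x, y) ↦ (a (x + e₁) + c (y + e₂), b (x + e₁) + d (y + e₂))`. -/
noncomputable def affineMapOfDet (a b c d e₁ e₂ : ℂ) (h : a * d - b * c ≠ 0) :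
    (ℂ × ℂ) ≃ᵃ[ℂ] (ℂ × ℂ) where
  toFun z :=
    ((d * z.1 - c * z.2) / (a * d - b * c) - e₁, (a * z.2 - b * z.1) / (a * d - b * c) - e₂)
  invFun z := (a * (z.1 + e₁) + c * (z.2 + e₂), b * (z.1 + e₁) + d * (z.2 + e₂))
  left_inv z := by
    refine Prod.ext ?_ ?_
    · simp only [sub_add_cancel]
      rw [mul_div_assoc', mul_div_assoc', ← add_div, div_eq_iff h]
      ring
    · simp only [sub_add_cancel]
      rw [mul_div_assoc', mul_div_assoc', ← add_div, div_eq_iff h]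
      ring
  right_inv z := by
    refine Prod.ext ?_ ?_
    · simp only
      rw [sub_eq_iff_eq_add, div_eq_iff h]
      ring
    · simp only
      rw [sub_eq_iff_eq_add, div_eq_iff h]
      ring
  linear :=
    { toFun := fun z =>
        ((d * z.1 - c * z.2) / (a * d - b * c), (a * z.2 - b * z.1) / (a * d - b * c))
      invFun := fun z => (a * z.1 + c * z.2, b * z.1 + d * z.2)
      map_add' := fun z w => by
        refine Prod.ext ?_ ?_ <;> simp only [Prod.fst_add, Prod.snd_add] <;> ring
      map_smul' := fun k z => by
        refine Prod.ext ?_ ?_ <;>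
          simp only [Prod.smul_fst, Prod.smul_snd, smul_eq_mul, RingHom.id_apply] <;> ring
      left_inv := fun z => by
        refine Prod.ext ?_ ?_ <;> simp only <;>
          rw [mul_div_assoc', mul_div_assoc', ← add_div, div_eq_iff h] <;> ring
      right_inv := fun z => by
        refine Prod.ext ?_ ?_ <;> simp only <;> rw [div_eq_iff h] <;> ring }
  map_vadd' z w := by
    refine Prod.ext ?_ ?_ <;>
      simp only [vadd_eq_add, Prod.fst_add, Prod.snd_add, Equiv.coe_fn_mk, LinearEquiv.coe_mk,
        LinearMap.coe_mk, AddHom.coe_mk] <;> ring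

theorem carriesODE_affineMapOfDet {a b c d e₁ e₂ : ℂ} (h : a * d - b * c ≠ 0)
    {B B' : SecondOrderODE} (hB : ∀ x y p, d - c * p ≠ 0 → (d - c * p) ^ 3 *
      B' ((d * x - c * y) / (a * d - b * c) - e₁) ((a * y - b * x) / (a * d - b * c) - e₂)
        ((a * p - b) / (d - c * p)) = (a * d - b * c) ^ 2 * B x y p) :
    CarriesODE (affineMapOfDet a b c d e₁ e₂ h) B B' := by
  set D := a * d - b * c with hD
  have hdet : d / D * (a / D) - -c / D * (-b / D) = D⁻¹ := by
    field_simp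
    rw [hD]; ring
  refine carriesODE_of_transformation (α := d / D) (β := -c / D) (γ := -b / D) (δ := a / D)
    (e₁ := -e₁) (e₂ := -e₂) (fun x y => ?_) (by rw [hdet]; exact inv_ne_zero h) fun x y p hk => ?_
  · change ((d * x - c * y) / D - e₁, (a * y - b * x) / D - e₂) = _
    refine Prod.ext ?_ ?_ <;> simp only <;> ring
  · have hk' : d / D + -c / D * p = (d - c * p) / D := by ring
    have hs : -b / D + a / D * p = (a * p - b) / D := by ring
    rw [hk'] at hk
    have hdc : d - c * p ≠ 0 := fun h0 => hk (by rw [h0, zero_div])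
    have hx : d / D * x + -c / D * y + -e₁ = (d * x - c * y) / D - e₁ := by ring
    have hy : -b / D * x + a / D * y + -e₂ = (a * y - b * x) / D - e₂ := by ring
    rw [hk', hs, hx, hy, hdet, div_div_div_cancel_right₀ h, div_pow, div_mul_eq_mul_div,
      hB _ _ _ hdc]
    field_simp

theorem exists_affine_explicit (a b c d : ℂ) (ha : a ≠ 0) (h : a * d - b * c ≠ 0) :
    ∃ g : (ℂ × ℂ) ≃ᵃ[ℂ] (ℂ × ℂ),
      (∀ x₁ y₁ : ℂ, g.symm (x₁, y₁) = (a * (x₁ + 1) + c * y₁, b * (x₁ + 1) + d * y₁)) ∧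
      CarriesElement g (a, b, b / a) 0 ∧
      CarriesODE g quarticODE (shiftedQuarticODE ((a * d - b * c) ^ 2) 1) := by
  refine ⟨affineMapOfDet a b c d 1 0 h, fun x₁ y₁ => ?_, ⟨?_, a⁻¹, inv_ne_zero ha, ?_⟩, ?_⟩
  · change (a * (x₁ + 1) + c * (y₁ + 0), b * (x₁ + 1) + d * (y₁ + 0)) = _
    rw [add_zero]
  · change ((d * a - c * b) / (a * d - b * c) - 1, (a * b - b * a) / (a * d - b * c) - 0) = (0, 0)
    refine Prod.ext ?_ ?_
    · simp only
      rw [sub_eq_zero, div_eq_iff h]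
      ring
    · simp only
      ring
  · change ((d * 1 - c * (b / a)) / (a * d - b * c), (a * (b / a) - b * 1) / (a * d - b * c)) =
      (a⁻¹ * 1, a⁻¹ * 0)
    refine Prod.ext ?_ ?_
    · simp only
      rw [div_eq_iff h]
      field_simp
    · simp only
      field_simp
      ring
  · refine carriesODE_affineMapOfDet h fun x y p hk => ?_
    simp only [shiftedQuarticODE, quarticODE, sub_zero, sub_add_cancel]
    rw [mul_left_comm, ← mul_pow]
    congr 2
    have e : (d * x - c * y) / (a * d - b * c) * (a * p - b) =
        (d * x - c * y) * (a * p - b) / (a * d - b * c) := by ring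
    rw [mul_sub, mul_left_comm, mul_div_cancel₀ _ hk, e, mul_div_assoc', ← sub_div,
      div_eq_iff h]
    ring

theorem exists_affine_of_mem_hypersurfaceΓ {q : JetSpace} (hq : q ∈ hypersurfaceΓ) :
    ∃ (g : (ℂ × ℂ) ≃ᵃ[ℂ] (ℂ × ℂ)) (K e : ℂ), K ≠ 0 ∧ CarriesElement g q 0 ∧
      CarriesODE g quarticODE (shiftedQuarticODE K e) := by
  obtain ⟨x, y, p⟩ := q
  obtain rfl : y = x * p := hq
  -- the explicit maps exist only for `x ≠ 0`; at `x = 0` the map `(x, y) ↦ (x, y - p x)` will do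
  by_cases hx : x = 0
  · subst hx
    refine ⟨affineMapOfDet 1 p 0 1 0 0 (by norm_num), 1, 0, one_ne_zero, ⟨?_, 1, one_ne_zero, ?_⟩,
      carriesODE_affineMapOfDet _ fun x y s hk => ?_⟩
    · change ((1 * 0 - 0 * (0 * p)) / (1 * 1 - p * 0) - 0,
        (1 * (0 * p) - p * 0) / (1 * 1 - p * 0) - 0) = ((0 : ℂ), (0 : ℂ))
      simp
    · change ((1 * 1 - 0 * p) / (1 * 1 - p * 0), (1 * p - p * 1) / (1 * 1 - p * 0)) =
        ((1 * 1 : ℂ), (1 * 0 : ℂ))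
      simp
    · simp only [shiftedQuarticODE, quarticODE]
      norm_num
      ring
  · obtain ⟨g, -, h₁, h₂⟩ := exists_affine_explicit x (x * p) 0 1 hx (by simpa using hx)
    rw [mul_div_cancel_left₀ _ hx] at h₁
    exact ⟨g, _, 1, by simpa using hx, h₁, h₂⟩

end

/-! ### The isotropy of the quartic -/

theorem mainTheorem3 :
    -- the points with non-linearizable isotropy form exactly the hypersurface
    ({q : JetSpace | ¬ quarticODE.HasLinearizableIsotropy ℂ q} = hypersurfaceΓ ∧
      {q : JetSpace | ¬ quarticODE.HasLinearizableIsotropy ℝ q} = hypersurfaceΓ) ∧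
    -- affine maps carry every point of the hypersurface to 0 and keep the ODE shear invariant
    (∀ q ∈ hypersurfaceΓ, ∃ (g : (ℂ × ℂ) ≃ᵃ[ℂ] (ℂ × ℂ)) (K e : ℂ), K ≠ 0 ∧
      CarriesElement g q 0 ∧ CarriesODE g quarticODE (shiftedQuarticODE K e) ∧
      AdmitsShear (shiftedQuarticODE K e)) ∧
    -- the explicit maps at the points (a, b, b/a)
    (∀ a b c d : ℂ, a ≠ 0 → a * d - b * c ≠ 0 → ∃ g : (ℂ × ℂ) ≃ᵃ[ℂ] (ℂ × ℂ),
      (∀ x₁ y₁ : ℂ, g.symm (x₁, y₁) = (a * (x₁ + 1) + c * y₁, b * (x₁ + 1) + d * y₁)) ∧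
      CarriesElement g (a, b, b / a) 0 ∧
      CarriesODE g quarticODE (shiftedQuarticODE ((a * d - b * c) ^ 2) 1)) ∧
    -- outside the hypersurface there are no infinitesimal isotropic automorphisms
    (∀ q ∉ hypersurfaceΓ, ∀ (U : Set JetSpace) (X : JetSpace → JetSpace), IsOpen U → q ∈ U →
      quarticODE.IsInfinitesimalCRAut X U → X q = 0 → ∀ᶠ r in 𝓝 q, X r = 0) ∧
    -- and the isotropy group consists of the identity and one involution
    (∀ q ∉ hypersurfaceΓ, ∃ σ ∈ quarticODE.isotropy q,
      (¬ ∀ᶠ r in 𝓝 q, σ r = r) ∧ (∀ᶠ r in 𝓝 q, σ (σ r) = r) ∧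
      ∀ f ∈ quarticODE.isotropy q, (∀ᶠ r in 𝓝 q, f r = r) ∨ (∀ᶠ r in 𝓝 q, f r = σ r)) := by
  refine ⟨⟨Set.ext fun q => ?_, Set.ext fun q => ?_⟩, fun q hq => ?_,
    exists_affine_explicit, fun q hq U X hU hqU hX hXq => ?_, fun q hq => ?_⟩
  · refine ⟨fun h => ?_, fun hq h => not_hasLinearizableIsotropy hq h.restrictScalars⟩
    by_contra hq
    exact h (hasLinearizableIsotropy (wronskian_ne_zero hq))
  · refine ⟨fun h => ?_, not_hasLinearizableIsotropy⟩
    by_contra hq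
    exact h (hasLinearizableIsotropy (wronskian_ne_zero hq)).restrictScalars
  · obtain ⟨g, K, e, hK, h₁, h₂⟩ := exists_affine_of_mem_hypersurfaceΓ hq
    exact ⟨g, K, e, hK, h₁, h₂, admitsShear_shiftedQuarticODE K e⟩
  · exact eventually_eq_zero_of_isInfinitesimalCRAut (wronskian_ne_zero hq) (hU.mem_nhds hqU) hX hXq
  · have hw := wronskian_ne_zero hq
    exact ⟨isotropyInvolution q hw, isotropyInvolution_mem_isotropy hw, isotropyInvolution_ne_id hw,
      isotropyInvolution_involutive hw, fun f hf => eq_id_or_eq_isotropyInvolution hw hf⟩
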